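/- All logarithms are to base $2$. A random variable $X$ on $\{0,1\}^n$ is an $(n,k)$-source if its min-entropy $\mathrm{H}_\infty(X)=-\log\max_x \Pr[X=x]$ is at least $k$. Let $\mathrm{SD}[A,B]=\frac12\sum_z|\Pr[A=z]-\Pr[B=z]|$ be the statistical distance, let $U_m$ be uniform on $\{0,1\}^m$ and independent of everything else, and write $A\circ B$ for a pair of random variables. A function $\mathrm{Ext}:\{0,1\}^{n_1}\times\{0,1\}^{n_2}\to\{0,1\}^m$ is an $(n_1,k_1,n_2,k_2,m,\epsilon)$ two-source extractor if $\mathrm{SD}[\mathrm{Ext}(X,Y),U_m]\le\epsilon$ for all independent $(n_1,k_1)$-sources $X$ and $(n_2,k_2)$-sources $Y$. It is strong in either input if moreover $\mathrm{SD}[\mathrm{Ext}(X,Y)\circ X,U_m\circ X]\le\epsilon$ and $\mathrm{SD}[\mathrm{Ext}(X,Y)\circ Y,U_m\circ Y]\le\epsilon$ for all such $X,Y$. Theorem 1 (Explicit and Efficient Raz Extractor). Let $n_1,k_1,n_2,k_2,m$ be positive integers with $k_1\le n_1$, $k_2\le n_2$ and $n_2\le n_1/2$, let $0<\delta<1/2$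 and $0.25<\lambda<\delta k_2/16-1$, and suppose that $$k_1\ge\Big(\tfrac12+\delta\Big)n_1+2\log n_1,\qquad k_2\ge\max\Big[3.2\log\Big(\frac{8n_1}{k_2}\Big),\,40\Big],\qquad m\le\frac1\lambda\Big(\frac{\delta k_2}{16}-1\Big).$$ Then there exist an explicit $(n_1,k_1,n_2,k_2,m,\epsilon)$ two-source extractor with $\epsilon\le 2^{(1-4\lambda)m/2-1}$, and an explicit $(n_1,k_1',n_2,k_2',m,\epsilon')$ two-source extractor that is strong in either input, with $\epsilon'\le 2^{(1-4\lambda)m/2}$ and $$k_1'=k_1+3(m+1),\qquad k_2'=k_2+3(m+1).$$ Both can be computed in $O(n_1(\log n_1)^2)$ time. Precisely: there are two fixed programs for a word RAM with words of $O(\log n_1)$ bits and an absolute constant $C$, none of them depending on the parameters, such that for all parameters as above the following holds. Irreducible polynomials of degree $\lceil n_1/2\rceil$ over $\mathrm{GF}(2)$ exist, and for every such polynomial $P$ (a description of the field $\mathrm{GF}(2^{\lceil n_1/2\rceil})$, on which the extractors may depend), the programs, given $n_1,k_1,n_2,k_2,m$, $P$, $x$ and $y$, output $\mathrm{Ext}(x,y)$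 for the first and for the second extractor respectively, for all $x\in\{0,1\}^{n_1}$ and $y\in\{0,1\}^{n_2}$, within $C\,n_1(\log n_1)^2$ steps. -/

import Mathlib

namespace RazExtractor

/-! ### Classical random variables on bitstrings -/

/-- Bitstrings of length `n`. -/
abbrev BitStr (n : ℕ) : Type := Fin n → Bool

/-- Statistical distance `SD[p, q] = (1/2) ∑ x, |p x - q x|`. -/
noncomputable def statDist {α : Type} [Fintype α] (p q : PMF α) : ℝ :=
  (1 / 2) * ∑ x, |(p x).toReal - (q x).toReal|

/-- Min-entropy (base 2): `H_∞(X) = - log (max_x p_X(x))`. -/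
noncomputable def minEntropy {α : Type} [Fintype α] (X : PMF α) : ℝ :=
  - Real.logb 2 (⨆ x, (X x).toReal)

/-- `X` (the law of a random variable on `{0,1}^n`) is an `(n, k)`-source. -/
def IsSource {n : ℕ} (X : PMF (BitStr n)) (k : ℝ) : Prop := k ≤ minEntropy X

/-- The law of `(A, B)` for independent `A`, `B` with laws `p`, `q`. -/
noncomputable def indep {α β : Type} (p : PMF α) (q : PMF β) : PMF (α × β) :=
  p.bind fun a => q.map fun b => (a, b)

/-- The uniform law `U_m` on `{0,1}^m`. -/
noncomputable def unif (m : ℕ) : PMF (BitStr m) := PMF.uniformOfFintype (BitStr m)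

/-- `Ext` is an `(n₁, k₁, n₂, k₂, m, ε)` two-source extractor. -/
def IsTwoSourceExtractor {n₁ n₂ m : ℕ} (Ext : BitStr n₁ → BitStr n₂ → BitStr m)
    (k₁ k₂ ε : ℝ) : Prop :=
  ∀ (X : PMF (BitStr n₁)) (Y : PMF (BitStr n₂)), IsSource X k₁ → IsSource Y k₂ →
    statDist ((indep X Y).map fun z => Ext z.1 z.2) (unif m) ≤ ε

/-- The strong property in the first input: `SD[Ext(X,Y)∘X, U_m∘X] ≤ ε`. -/
def IsStrongInFirst {n₁ n₂ m : ℕ} (Ext : BitStr n₁ → BitStr n₂ → BitStr m)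
    (k₁ k₂ ε : ℝ) : Prop :=
  ∀ (X : PMF (BitStr n₁)) (Y : PMF (BitStr n₂)), IsSource X k₁ → IsSource Y k₂ →
    statDist ((indep X Y).map fun z => (Ext z.1 z.2, z.1)) (indep (unif m) X) ≤ ε

/-- The strong property in the second input: `SD[Ext(X,Y)∘Y, U_m∘Y] ≤ ε`. -/
def IsStrongInSecond {n₁ n₂ m : ℕ} (Ext : BitStr n₁ → BitStr n₂ → BitStr m)
    (k₁ k₂ ε : ℝ) : Prop :=
  ∀ (X : PMF (BitStr n₁)) (Y : PMF (BitStr n₂)), IsSource X k₁ → IsSource Y k₂ →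
    statDist ((indep X Y).map fun z => (Ext z.1 z.2, z.2)) (indep (unif m) Y) ≤ ε

/-- A two-source extractor that is strong in either input. -/
structure IsStrongTwoSourceExtractor {n₁ n₂ m : ℕ} (Ext : BitStr n₁ → BitStr n₂ → BitStr m)
    (k₁ k₂ ε : ℝ) : Prop where
  extractor : IsTwoSourceExtractor Ext k₁ k₂ ε
  strong_first : IsStrongInFirst Ext k₁ k₂ ε
  strong_second : IsStrongInSecond Ext k₁ k₂ ε

/-! ### A word RAM with a step count -/

/-- Binary operations of the machine; all of them act on `w`-bit words. -/
inductive WordOp : Type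
  | add | sub | mul | div | mod | and | or | xor | shl | shr | lt | eq

/-- The value of an operation on the words `a` and `b`, for word length `w`. -/
def WordOp.eval (w : ℕ) : WordOp → ℕ → ℕ → ℕ
  | .add, a, b => (a + b) % 2 ^ w
  | .sub, a, b => (a + (2 ^ w - b)) % 2 ^ w
  | .mul, a, b => (a * b) % 2 ^ w
  | .div, a, b => a / b
  | .mod, a, b => a % b
  | .and, a, b => a &&& b
  | .or, a, b => a ||| b
  | .xor, a, b => a ^^^ b
  | .shl, a, b => (a <<< b) % 2 ^ w
  | .shr, a, b => a >>> b
  | .lt, a, b => if a < b then 1 else 0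
  | .eq, a, b => if a = b then 1 else 0

/-- Programs. A program names finitely many registers and addresses memory indirectly. -/
inductive Prog : Type
  /-- do nothing -/
  | skip : Prog
  /-- `const d v`: register `d` receives the constant `v` -/
  | const (d v : ℕ) : Prog
  /-- `op o d a b`: register `d` receives the result of `o` on registers `a` and `b` -/
  | op (o : WordOp) (d a b : ℕ) : Prog
  /-- `load d a`: register `d` receives the memory cell whose address is in register `a` -/
  | load (d a : ℕ) : Prog
  /-- `store a b`: the memory cell whose address is in register `a` receives register `b` -/
  | store (a b : ℕ) : Prog
  /-- sequential composition -/
  | seq (p q : Prog) : Prog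
  /-- `ifNZ r p q`: if register `r` is non-zero then `p` else `q` -/
  | ifNZ (r : ℕ) (p q : Prog) : Prog
  /-- `whileNZ r p`: while register `r` is non-zero do `p` -/
  | whileNZ (r : ℕ) (p : Prog) : Prog

/-- A configuration: the contents of the registers and of the memory cells. -/
structure State : Type where
  reg : ℕ → ℕ
  mem : ℕ → ℕ

/-- Overwrite a register. -/
def State.setReg (s : State) (d v : ℕ) : State := { s with reg := Function.update s.reg d v }

/-- Overwrite a memory cell. -/
def State.setMem (s : State) (a v : ℕ) : State := { s with mem := Function.update s.mem a v }

/-- `Exec w p s t s'`: with word length `w`, the program `p` started in `s` halts in `s'` after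
exactly `t` steps. Every basic instruction and every test of a register costs one step. -/
inductive Exec (w : ℕ) : Prog → State → ℕ → State → Prop
  | skip (s : State) : Exec w .skip s 1 s
  | const (d v : ℕ) (s : State) : Exec w (.const d v) s 1 (s.setReg d (v % 2 ^ w))
  | op (o : WordOp) (d a b : ℕ) (s : State) :
      Exec w (.op o d a b) s 1 (s.setReg d (o.eval w (s.reg a) (s.reg b)))
  | load (d a : ℕ) (s : State) : Exec w (.load d a) s 1 (s.setReg d (s.mem (s.reg a)))
  | store (a b : ℕ) (s : State) : Exec w (.store a b) s 1 (s.setMem (s.reg a) (s.reg b))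
  | seq {p q : Prog} {s s' s'' : State} {t t' : ℕ} (hp : Exec w p s t s')
      (hq : Exec w q s' t' s'') : Exec w (.seq p q) s (t + t') s''
  | if_pos {r : ℕ} {p q : Prog} {s s' : State} {t : ℕ} (hr : s.reg r ≠ 0)
      (hp : Exec w p s t s') : Exec w (.ifNZ r p q) s (t + 1) s'
  | if_neg {r : ℕ} {p q : Prog} {s s' : State} {t : ℕ} (hr : s.reg r = 0)
      (hq : Exec w q s t s') : Exec w (.ifNZ r p q) s (t + 1) s'
  | while_stop {r : ℕ} {p : Prog} {s : State} (hr : s.reg r = 0) :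
      Exec w (.whileNZ r p) s 1 s
  | while_step {r : ℕ} {p : Prog} {s s' s'' : State} {t t' : ℕ} (hr : s.reg r ≠ 0)
      (hp : Exec w p s t s') (hw : Exec w (.whileNZ r p) s' t' s'') :
      Exec w (.whileNZ r p) s (t + t' + 1) s''

/-- The initial configuration: registers `0, …, 4` hold `n₁, k₁, n₂, k₂, m` and the others hold `0`;
the memory holds the bits of `x`, then the bits of `y`, then the coefficients of the polynomial
`P` over `GF(2)` from the constant one upwards (one bit per cell), then zeros. -/
def initState (n₁ k₁ n₂ k₂ m : ℕ) (P : Polynomial (ZMod 2)) (x : BitStr n₁) (y : BitStr n₂) :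
    State where
  reg := fun i =>
    if i = 0 then n₁ else if i = 1 then k₁ else if i = 2 then n₂ else if i = 3 then k₂
    else if i = 4 then m else 0
  mem := fun a =>
    if h : a < n₁ then (x ⟨a, h⟩).toNat
    else if h' : a - n₁ < n₂ then (y ⟨a - n₁, h'⟩).toNat
    else (P.coeff (a - n₁ - n₂)).val

/-- The program `prog`, on a machine with words of `c (⌊log n₁⌋ + 1)` bits and given the numerical
parameters and the polynomial `P`, computes `Ext(x, y)` for all `x` and `y` in at most `T` steps;
the output bits are left in the memory cells `0, …, m - 1`. -/
def ComputesInTime (prog : Prog) (c : ℕ) (T : ℝ) {n₁ n₂ m : ℕ} (k₁ k₂ : ℕ)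
    (P : Polynomial (ZMod 2)) (Ext : BitStr n₁ → BitStr n₂ → BitStr m) : Prop :=
  ∀ (x : BitStr n₁) (y : BitStr n₂), ∃ (t : ℕ) (s : State),
    Exec (c * (Nat.log 2 n₁ + 1)) prog (initState n₁ k₁ n₂ k₂ m P x y) t s ∧
    (t : ℝ) ≤ T ∧ ∀ i : Fin m, s.mem i = (Ext x y i).toNat

end RazExtractor

/-! The extractor splits `x = (a, b)` into its first half `a` and a second half `b` of `d = ⌈n₁/2⌉`
bits. It outputs the first `m` coordinates of `c₀ b (a + y)^(2^L - 1)` in the field `GF(2)[X]/(P)`,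
where `2^L` is the least power of two above `d` and `c₀` is a nonzero constant.

Security. By Fourier analysis on the output (`sum_abs_le_fourier`) it suffices to bound the average
over `X` of `|∑ w(y) χ(Ext(x, y))|` for each nontrivial character `χ` and all weights with `|w| ≤
Y`. Arbitrary weights cost nothing in the argument, and they can absorb signs; so one bound gives
strength in both inputs (`statDist_le_of_charSum`). By Jensen, the `2k`-th power of this average is
at most the `2k`-th moment over uniform `x`, up to the entropy deficiency of `X`. Expanding the
moment produces products of `χ(Ext(x, y))` over sets `S` of at most `2k` points, weighted by a
random walk that toggles points (`moment_bound`). The empty set contributes the return probability,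
small by the min-entropy of `Y` (`walk_empty_le`). A nonempty `S` contributes a bias: `∏ χ(Ext(x,
y))` is `χ` of `c₀ b ∑ (a + y)^(2^L - 1)`. Its sum over `b` vanishes unless `a` is a root of `∑ (X +
y)^(2^L - 1)`. In characteristic two this polynomial is nonzero for `|S| ≤ 2^L`, by a Vandermonde
argument (`sum_X_add_C_pow_ne_zero`, `bias_le`). The choice `k = 2 ⌊n₁/k₂⌋` gives the stated error
(`raz_estimate`). This extractor is already strong with the smaller entropies and the smaller error,
so a single function and a single program serve both claims.

Time. Field elements are polynomials of degree below `d`, kept as values at `2D = 2^(L+1)` points of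
a small field `GF(2^κ)` with `κ = O(log n₁)`, whose elements fit into machine words. The small field
is a tower of quadratic Artin–Schreier extensions, in which a product costs a constant number of
steps thanks to a table for quarter words (`IsWordMul.nimStep`, `kmulE_ev`). The points are the span
of a Cantor basis, over which an additive Fourier transform in the novel polynomial basis takes `O(D
L)` steps (`fwdIter_eval`, `invIter_eval`). Products modulo `P` use Montgomery reduction with
respect to `s = sub L`, which is zero on the lower half of the points and one on the upper half, so
that the quotient is read off on the lower half and the remainder on the upper half (`montgomery`,
`mmP_run`). Each such product introduces a factor `s⁻¹`; these factors add up to `c₀ = s^-(2^L -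
1)`, which does no harm to the extractor. The power takes `2 L` products (`powersLoop_run`), hence
`O(n₁ (log n₁)²)` steps.

Likewise the bits of `a`, `b`, `y` and of the output are coordinates in the novel basis: the
analysis needs only linear injections into the field and a linear surjection from it. Only `P`
itself has to be converted from the monomial basis (`convP_run`).

The program is written in a small structured language, whose compilation to the word RAM is proved
correct with exact step counts (`St.exec`). -/

namespace RazExtractor

/-! ### A structured language compiled to the word RAM -/

/-- Expressions: variables live in registers, `ld` reads memory. -/
inductive Ex : Type
  | var (i : ℕ)
  | lit (v : ℕ)
  | op (o : WordOp) (a b : Ex)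
  | ld (a : Ex)

namespace Ex

def ev (w : ℕ) (ρ μ : ℕ → ℕ) : Ex → ℕ
  | var i => ρ i
  | lit v => v % 2 ^ w
  | op o a b => o.eval w (a.ev w ρ μ) (b.ev w ρ μ)
  | ld a => μ (a.ev w ρ μ)

/-- Code leaving the value in register `K`, using only registers `≥ K`. -/
def code : Ex → ℕ → Prog
  | var i, K => .op .or K i i
  | lit v, K => .const K v
  | op o a b, K => .seq (a.code K) (.seq (b.code (K + 1)) (.op o K K (K + 1)))
  | ld a, K => .seq (a.code K) (.load K K)

def cost : Ex → ℕ
  | var _ => 1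
  | lit _ => 1
  | op _ a b => a.cost + (b.cost + 1)
  | ld a => a.cost + 1

def wf (K : ℕ) : Ex → Prop
  | var i => i < K
  | lit _ => True
  | op _ a b => a.wf K ∧ b.wf K
  | ld a => a.wf K

theorem wf_mono {K K' : ℕ} (h : K ≤ K') : ∀ {e : Ex}, e.wf K → e.wf K'
  | var _, he => lt_of_lt_of_le he h
  | lit _, _ => trivial
  | op _ _ _, he => ⟨wf_mono h he.1, wf_mono h he.2⟩
  | ld a, he => wf_mono (e := a) h he

theorem ev_congr {w K : ℕ} {ρ ρ' μ : ℕ → ℕ} (h : ∀ i < K, ρ i = ρ' i) :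
    ∀ {e : Ex}, e.wf K → e.ev w ρ μ = e.ev w ρ' μ
  | var _, he => h _ he
  | lit _, _ => rfl
  | op _ _ _, he => by simp only [ev, ev_congr h he.1, ev_congr h he.2]
  | ld a, he => by simp only [ev, ev_congr (e := a) h he]

/-- `K` works as a stack pointer: the code of the right operand starts at `K + 1`, so it leaves
intact the left operand in register `K` and the variables below `K`. -/
theorem exec (w : ℕ) : ∀ (e : Ex) (K : ℕ) (s : State), e.wf K →
    ∃ s', Exec w (e.code K) s e.cost s' ∧ s'.mem = s.mem ∧ (∀ i < K, s'.reg i = s.reg i) ∧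
      s'.reg K = e.ev w s.reg s.mem
  | var i, K, s, _ => by
    refine ⟨_, Exec.op .or K i i s, rfl, fun j hj => ?_, ?_⟩
    · simp [State.setReg, hj.ne]
    · simp [State.setReg, WordOp.eval, ev]
  | lit v, K, s, _ => by
    refine ⟨_, Exec.const K v s, rfl, fun j hj => ?_, ?_⟩
    · simp [State.setReg, hj.ne]
    · simp [State.setReg, ev]
  | op o a b, K, s, he => by
    obtain ⟨s₁, h₁, m₁, r₁, v₁⟩ := exec w a K s he.1
    obtain ⟨s₂, h₂, m₂, r₂, v₂⟩ := exec w b (K + 1) s₁ (wf_mono (Nat.le_succ K) he.2)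
    refine ⟨_, Exec.seq h₁ (Exec.seq h₂ (Exec.op o K K (K + 1) s₂)), ?_, fun j hj => ?_, ?_⟩
    · simp [State.setReg, m₁, m₂]
    · simp [State.setReg, hj.ne, r₂ j (by omega), r₁ j hj]
    · simp only [State.setReg, Function.update_self, ev]
      rw [v₂, r₂ K (by omega), v₁, m₁, ev_congr r₁ he.2]
  | ld a, K, s, he => by
    obtain ⟨s₁, h₁, m₁, r₁, v₁⟩ := exec w a K s he
    refine ⟨_, Exec.seq h₁ (Exec.load K K s₁), ?_, fun j hj => ?_, ?_⟩
    · simp [State.setReg, m₁]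
    · simp [State.setReg, hj.ne, r₁ j hj]
    · simp [State.setReg, ev, v₁, m₁]

end Ex

/-- Statements: only the memory is mutable; `bind` and `loop` bind fresh variables. -/
inductive St : Type
  | store (a v : Ex)
  | seq (p q : St)
  | bind (e : Ex) (b : St)
  | loop (e : Ex) (b : St)

/-- Iterate a memory transformer with the index as a parameter. -/
def iter (f : ℕ → (ℕ → ℕ) → (ℕ → ℕ)) (μ : ℕ → ℕ) : ℕ → (ℕ → ℕ)
  | 0 => μ
  | n + 1 => f n (iter f μ n)

/-- The environment inside a loop body: index, limit, and the constant one. -/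
def loopEnv (K : ℕ) (ρ : ℕ → ℕ) (n i : ℕ) : ℕ → ℕ :=
  Function.update (Function.update (Function.update ρ K i) (K + 1) n) (K + 2) 1

namespace St

/-- A fresh variable is named by the current depth `K`. The loop limit is reduced modulo `2 ^ w`
because registers and memory cells are not forced to hold `w`-bit words; a reduced limit keeps the
counter from overflowing. -/
def run (w : ℕ) : St → ℕ → (ℕ → ℕ) → (ℕ → ℕ) → (ℕ → ℕ)
  | store a v, _, ρ, μ => Function.update μ (a.ev w ρ μ) (v.ev w ρ μ)
  | seq p q, K, ρ, μ => q.run w K ρ (p.run w K ρ μ)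
  | bind e b, K, ρ, μ => b.run w (K + 1) (Function.update ρ K (e.ev w ρ μ)) μ
  | loop e b, K, ρ, μ =>
    iter (fun i m => b.run w (K + 3) (loopEnv K ρ (e.ev w ρ μ % 2 ^ w) i) m) μ
      (e.ev w ρ μ % 2 ^ w)

/-- In a loop, the 6 counts five set-up instructions and the final failing test; the 3 per round
counts the increment, the comparison and the successful test. -/
def cost (w : ℕ) : St → ℕ → (ℕ → ℕ) → (ℕ → ℕ) → ℕ
  | store a v, _, _, _ => a.cost + (v.cost + 1)
  | seq p q, K, ρ, μ => p.cost w K ρ μ + q.cost w K ρ (p.run w K ρ μ)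
  | bind e b, K, ρ, μ => e.cost + b.cost w (K + 1) (Function.update ρ K (e.ev w ρ μ)) μ
  | loop e b, K, ρ, μ =>
    e.cost + 6 + ∑ i ∈ Finset.range (e.ev w ρ μ % 2 ^ w),
      (b.cost w (K + 3) (loopEnv K ρ (e.ev w ρ μ % 2 ^ w) i)
        (iter (fun i m => b.run w (K + 3) (loopEnv K ρ (e.ev w ρ μ % 2 ^ w) i) m) μ i) + 3)

def wf : St → ℕ → Prop
  | store a v, K => a.wf K ∧ v.wf K
  | seq p q, K => p.wf K ∧ q.wf K
  | bind e b, K => e.wf K ∧ b.wf (K + 1)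
  | loop e b, K => e.wf K ∧ b.wf (K + 3)

def code : St → ℕ → Prog
  | store a v, K => .seq (a.code K) (.seq (v.code (K + 1)) (.store K (K + 1)))
  | seq p q, K => .seq (p.code K) (q.code K)
  | bind e b, K => .seq (e.code K) (b.code (K + 1))
  | loop e b, K =>
    -- Adding the zero in `K + 2` is what reduces the limit modulo `2 ^ w`; afterwards `K + 2` holds
    -- the increment.
    .seq (e.code (K + 1)) (.seq (.const (K + 2) 0) (.seq (.op .add (K + 1) (K + 1) (K + 2))
      (.seq (.const K 0) (.seq (.const (K + 2) 1) (.seq (.op .lt (K + 3) K (K + 1))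
        -- The body may use `K + 3` as scratch space, so the flag is recomputed at the end of every
        -- round.
        (.whileNZ (K + 3) (.seq (b.code (K + 3)) (.seq (.op .add K K (K + 2))
          (.op .lt (K + 3) K (K + 1))))))))))

/-- Induction on the number `l` of rounds left. Only registers below `K + 3` must survive the body,
since the flag is rebuilt from the counter. -/
theorem exec_while {w K n : ℕ} {c : Prog} {f : ℕ → (ℕ → ℕ) → (ℕ → ℕ)} {T : ℕ → ℕ}
    {μ ρ : ℕ → ℕ} (hn : n < 2 ^ w)
    (hbody : ∀ i < n, ∀ s : State, s.mem = iter f μ i → (∀ k < K + 3, s.reg k = loopEnv K ρ n i k) →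
      ∃ s', Exec w c s (T i) s' ∧ s'.mem = iter f μ (i + 1) ∧ ∀ k < K + 3, s'.reg k = s.reg k) :
    ∀ (l i : ℕ) (s : State), i + l = n → s.mem = iter f μ i →
      (∀ k < K + 3, s.reg k = loopEnv K ρ n i k) →
      s.reg (K + 3) = (if i < n then 1 else 0) →
      ∃ s', Exec w (.whileNZ (K + 3) (.seq c (.seq (.op .add K K (K + 2))
          (.op .lt (K + 3) K (K + 1))))) s (1 + ∑ k ∈ Finset.Ico i n, (T k + 3)) s' ∧
        s'.mem = iter f μ n ∧ ∀ k < K, s'.reg k = s.reg k := by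
  intro l
  induction l with
  | zero =>
    intro i s hi hm hr h3
    obtain rfl : i = n := by omega
    refine ⟨s, ?_, hm, fun _ _ => rfl⟩
    simpa using Exec.while_stop (by simpa using h3)
  | succ l ih =>
    intro i s hi hm hr h3
    have hin : i < n := by omega
    obtain ⟨s₁, e₁, m₁, r₁⟩ := hbody i hin s hm hr
    have hK : s₁.reg K = i := by
      rw [r₁ K (by omega), hr K (by omega)]; simp [loopEnv]
    have hK1 : s₁.reg (K + 1) = n := by
      rw [r₁ _ (by omega), hr _ (by omega)]; simp [loopEnv]
    have hK2 : s₁.reg (K + 2) = 1 := by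
      rw [r₁ _ (by omega), hr _ (by omega)]; simp [loopEnv]
    set s₂ := s₁.setReg K (i + 1) with hs₂
    have e₂ : Exec w (.op .add K K (K + 2)) s₁ 1 s₂ := by
      have := Exec.op (w := w) .add K K (K + 2) s₁
      rwa [hK, hK2, WordOp.eval, Nat.mod_eq_of_lt (by omega)] at this
    set s₃ := s₂.setReg (K + 3) (if i + 1 < n then 1 else 0) with hs₃
    have e₃ : Exec w (.op .lt (K + 3) K (K + 1)) s₂ 1 s₃ := by
      have := Exec.op (w := w) .lt (K + 3) K (K + 1) s₂
      have h1 : s₂.reg K = i + 1 := by simp [hs₂, State.setReg]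
      have h2 : s₂.reg (K + 1) = n := by simp [hs₂, State.setReg, hK1]
      rwa [h1, h2, WordOp.eval] at this
    obtain ⟨s₄, e₄, m₄, r₄⟩ := ih (i + 1) s₃ (by omega)
      (by simpa [hs₃, hs₂, State.setReg] using m₁)
      (by
        intro k hk
        rcases Nat.lt_trichotomy k K with h | h | h
        · have := hr k hk
          simp only [loopEnv, Function.update_apply] at this ⊢
          simp only [hs₃, hs₂, State.setReg, Function.update_apply]
          rw [if_neg (by omega), if_neg (by omega), r₁ k hk, this]
          simp [show k ≠ K by omega]
        · subst h; simp [hs₃, hs₂, State.setReg, loopEnv]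
        · have := hr k hk
          simp only [loopEnv, Function.update_apply] at this ⊢
          simp only [hs₃, hs₂, State.setReg, Function.update_apply]
          rw [if_neg (by omega), if_neg (by omega), r₁ k hk, this]
          simp [show k ≠ K by omega])
      (by simp [hs₃, State.setReg])
    refine ⟨s₄, ?_, m₄, fun k hk => ?_⟩
    · have := Exec.while_step (by simp [h3, hin]) (Exec.seq e₁ (Exec.seq e₂ e₃)) e₄
      rw [Finset.sum_eq_sum_Ico_succ_bot hin]
      convert this using 1
      all_goals first | rfl | ring1
    · rw [r₄ k hk]
      simp only [hs₃, hs₂, State.setReg, Function.update_apply]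
      rw [if_neg (by omega), if_neg (by omega), r₁ k (by omega)]

/-- Structural induction. Positivity of `w` keeps the increment of a loop from being reduced to
zero. -/
theorem exec {w : ℕ} (hw : 0 < w) : ∀ (p : St) (K : ℕ) (ρ : ℕ → ℕ) (s : State), p.wf K →
    (∀ i < K, s.reg i = ρ i) →
    ∃ s', Exec w (p.code K) s (p.cost w K ρ s.mem) s' ∧ s'.mem = p.run w K ρ s.mem ∧
      ∀ i < K, s'.reg i = s.reg i
  | store a v, K, ρ, s, hp, hr => by
    obtain ⟨s₁, h₁, m₁, r₁, v₁⟩ := Ex.exec w a K s hp.1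
    obtain ⟨s₂, h₂, m₂, r₂, v₂⟩ := Ex.exec w v (K + 1) s₁ (Ex.wf_mono (Nat.le_succ K) hp.2)
    refine ⟨_, Exec.seq h₁ (Exec.seq h₂ (Exec.store K (K + 1) s₂)), ?_, fun j hj => ?_⟩
    · simp only [State.setMem, run]
      rw [v₂, r₂ K (by omega), v₁, m₂, m₁, Ex.ev_congr hr hp.1,
        Ex.ev_congr (fun i hi => (r₁ i hi).trans (hr i hi)) hp.2]
    · simp [State.setMem, r₂ j (by omega), r₁ j hj]
  | seq p q, K, ρ, s, hp, hr => by
    obtain ⟨s₁, h₁, m₁, r₁⟩ := exec hw p K ρ s hp.1 hr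
    obtain ⟨s₂, h₂, m₂, r₂⟩ := exec hw q K ρ s₁ hp.2 (fun i hi => (r₁ i hi).trans (hr i hi))
    rw [m₁] at h₂ m₂
    exact ⟨s₂, Exec.seq h₁ h₂, m₂, fun i hi => (r₂ i hi).trans (r₁ i hi)⟩
  | bind e b, K, ρ, s, hp, hr => by
    obtain ⟨s₁, h₁, m₁, r₁, v₁⟩ := Ex.exec w e K s hp.1
    rw [Ex.ev_congr hr hp.1] at v₁
    obtain ⟨s₂, h₂, m₂, r₂⟩ := exec hw b (K + 1) (Function.update ρ K (e.ev w ρ s.mem)) s₁ hp.2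
      (by
        intro i hi
        rcases eq_or_ne i K with rfl | h
        · simp [v₁]
        · simp [h, r₁ i (by omega), hr i (by omega)])
    rw [m₁] at h₂ m₂
    exact ⟨s₂, Exec.seq h₁ h₂, m₂, fun i hi => (r₂ i (by omega)).trans (r₁ i hi)⟩
  | loop e b, K, ρ, s, hp, hr => by
    obtain ⟨s₁, h₁, m₁, r₁, v₁⟩ := Ex.exec w e (K + 1) s (Ex.wf_mono (Nat.le_succ K) hp.1)
    rw [Ex.ev_congr hr hp.1] at v₁
    set n := e.ev w ρ s.mem % 2 ^ w with hn
    have hn' : n < 2 ^ w := Nat.mod_lt _ (by positivity)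
    have h1w : 1 % 2 ^ w = 1 := Nat.mod_eq_of_lt (Nat.one_lt_two_pow hw.ne')
    set f := fun i m => b.run w (K + 3) (loopEnv K ρ n i) m with hf
    set s₂ := (((s₁.setReg (K + 2) 0).setReg (K + 1) n).setReg K 0).setReg (K + 2) 1 with hs₂
    have e₁ := Exec.const (w := w) (K + 2) 0 s₁
    rw [Nat.zero_mod] at e₁
    have e₂ := Exec.op (w := w) .add (K + 1) (K + 1) (K + 2) (s₁.setReg (K + 2) 0)
    have e₂' : WordOp.add.eval w ((s₁.setReg (K + 2) 0).reg (K + 1))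
        ((s₁.setReg (K + 2) 0).reg (K + 2)) = n := by
      simp [State.setReg, WordOp.eval, v₁, hn]
    rw [e₂'] at e₂
    have e₃ := Exec.const (w := w) K 0 ((s₁.setReg (K + 2) 0).setReg (K + 1) n)
    rw [Nat.zero_mod] at e₃
    have e₄ := Exec.const (w := w) (K + 2) 1 (((s₁.setReg (K + 2) 0).setReg (K + 1) n).setReg K 0)
    rw [h1w, ← hs₂] at e₄
    have e₅ := Exec.op (w := w) .lt (K + 3) K (K + 1) s₂
    have e₅' : WordOp.lt.eval w (s₂.reg K) (s₂.reg (K + 1)) = if 0 < n then 1 else 0 := by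
      simp [hs₂, State.setReg, WordOp.eval]
    rw [e₅'] at e₅
    set s₃ := s₂.setReg (K + 3) (if 0 < n then 1 else 0) with hs₃
    obtain ⟨s₄, h₄, m₄, r₄⟩ := exec_while (w := w) (K := K) (n := n) (c := b.code (K + 3)) (f := f)
      (T := fun i => b.cost w (K + 3) (loopEnv K ρ n i) (iter f s.mem i)) (μ := s.mem) (ρ := ρ) hn'
      (by
        intro i _ t hm ht
        obtain ⟨t', h', m', r'⟩ := exec hw b (K + 3) (loopEnv K ρ n i) t hp.2 ht
        rw [hm] at h' m'
        exact ⟨t', h', m', r'⟩)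
      n 0 s₃ (by omega) (by simp [hs₃, hs₂, State.setReg, m₁, iter])
      (by
        intro k hk
        simp only [hs₃, hs₂, State.setReg, loopEnv, Function.update_apply]
        rcases Nat.lt_trichotomy k K with h | h | h
        · simp [show k ≠ K + 3 by omega, show k ≠ K + 2 by omega, show k ≠ K + 1 by omega,
            show k ≠ K by omega, r₁ k (by omega), hr k h]
        · simp [h]
        · rcases (show k = K + 1 ∨ k = K + 2 by omega) with rfl | rfl <;> simp)
      (by simp [hs₃, State.setReg])
    refine ⟨s₄, ?_, m₄, fun k hk => ?_⟩
    · have := Exec.seq h₁ (Exec.seq e₁ (Exec.seq e₂ (Exec.seq e₃ (Exec.seq e₄ (Exec.seq e₅ h₄)))))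
      rw [← Finset.range_eq_Ico] at this
      have ht : (loop e b).cost w K ρ s.mem = e.cost + 6 + ∑ i ∈ Finset.range n,
          (b.cost w (K + 3) (loopEnv K ρ n i) (iter f s.mem i) + 3) := by
        simp only [cost, hn, hf]
      rw [ht]
      convert this using 1
      all_goals first | rfl | ring1
    · rw [r₄ k hk]
      simp [hs₃, hs₂, State.setReg, show k ≠ K + 3 by omega, show k ≠ K + 2 by omega,
        show k ≠ K + 1 by omega, show k ≠ K by omega, r₁ k (by omega)]

end St
end RazExtractor

namespace RazExtractor

/-! ### The random walk on subsets and the moment bound -/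

theorem symmDiff_symmDiff_self_right {α : Type} [DecidableEq α] (S T : Finset α) : symmDiff
    (symmDiff S T) T = S := by
  rw [symmDiff_assoc, symmDiff_self]; exact symmDiff_bot S

/-- As `f y ^ 2 = 1`, multiplying by `f y` supplies the factor if it is missing and cancels it if it
is present. -/
theorem prod_symmDiff_singleton {α : Type} [DecidableEq α] {f : α → ℝ} (hf : ∀ y, f y ^ 2 = 1)
    (S : Finset α) (y : α) :
    ∏ z ∈ symmDiff S {y}, f z = f y * ∏ z ∈ S, f z := by
  by_cases h : y ∈ S
  · have : symmDiff S {y} = S.erase y := by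
      ext z; simp only [Finset.mem_symmDiff, Finset.mem_singleton, Finset.mem_erase]
      by_cases hz : z = y <;> simp [hz, h]
    rw [this, ← Finset.mul_prod_erase S f h, ← mul_assoc, ← pow_two, hf, one_mul]
  · have : symmDiff S {y} = insert y S := by
      ext z; simp only [Finset.mem_symmDiff, Finset.mem_singleton, Finset.mem_insert]
      by_cases hz : z = y <;> simp [hz, h]
    rw [this, Finset.prod_insert h]

section Walk
variable {α : Type} [Fintype α] [DecidableEq α]

/-- The weighted number of walks of length `r` from `∅` to `S`, where each step toggles a point. -/
noncomputable def walk (w : α → ℝ) : ℕ → Finset α → ℝ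
  | 0, S => if S = ∅ then 1 else 0
  | r + 1, S => ∑ y, w y * walk w r (symmDiff S {y})

/-- The power expands into sequences of points. Since squares are 1, only the set of points
occurring an odd number of times matters, and this set performs the walk. -/
theorem pow_sum_eq_walk (w f : α → ℝ) (hf : ∀ y, f y ^ 2 = 1) (r : ℕ) :
    (∑ y, w y * f y) ^ r = ∑ S : Finset α, walk w r S * ∏ y ∈ S, f y := by
  induction r with
  | zero => simp [walk]
  | succ r ih =>
    rw [pow_succ', ih, Finset.sum_mul]
    simp only [walk, Finset.sum_mul]
    rw [Finset.sum_comm (s := (Finset.univ : Finset (Finset α)))]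
    refine Finset.sum_congr rfl fun y _ => ?_
    rw [Finset.mul_sum]
    refine Finset.sum_nbij' (fun S => symmDiff S {y}) (fun S => symmDiff S {y}) (by simp) (by simp)
      (by simp) (by simp) ?_
    intro S _
    rw [symmDiff_symmDiff_self_right, prod_symmDiff_singleton hf]
    ring

theorem walk_nonneg {p : α → ℝ} (hp : ∀ y, 0 ≤ p y) (r : ℕ) (S : Finset α) : 0 ≤ walk p r S := by
  induction r generalizing S with
  | zero => simp only [walk]; split_ifs <;> norm_num
  | succ r ih => exact Finset.sum_nonneg fun y _ => mul_nonneg (hp y) (ih _)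

theorem abs_walk_le {w p : α → ℝ} (hw : ∀ y, |w y| ≤ p y) (r : ℕ) (S : Finset α) :
    |walk w r S| ≤ walk p r S := by
  induction r generalizing S with
  | zero => simp only [walk]; split_ifs <;> norm_num
  | succ r ih =>
    refine (Finset.abs_sum_le_sum_abs _ _).trans (Finset.sum_le_sum fun y _ => ?_)
    rw [abs_mul]
    exact mul_le_mul (hw y) (ih _) (abs_nonneg _) ((abs_nonneg _).trans (hw y))

theorem sum_walk (p : α → ℝ) (r : ℕ) : ∑ S, walk p r S = (∑ y, p y) ^ r := by
  have := pow_sum_eq_walk p (fun _ => 1) (by simp) r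
  simpa using this.symm

/-- A step changes the cardinality by at most one. -/
theorem walk_eq_zero (w : α → ℝ) {r : ℕ} {S : Finset α} (h : r < S.card) : walk w r S = 0 := by
  induction r generalizing S with
  | zero =>
    simp only [walk]
    rw [if_neg]
    rintro rfl
    simp at h
  | succ r ih =>
    refine Finset.sum_eq_zero fun y _ => ?_
    rw [ih, mul_zero]
    have h1 : S ⊆ symmDiff S {y} ∪ {y} := by
      intro z hz
      simp only [Finset.mem_union, Finset.mem_symmDiff, Finset.mem_singleton]
      by_cases hzy : z = y <;> simp [hz, hzy]
    have h2 := (Finset.card_le_card h1).trans (Finset.card_union_le _ _)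
    simp at h2
    omega

/-- A walk to `insert y S` toggles `y` at one of its `r + 1` steps; deleting this step leaves a walk
to `S`, and the deleted step weighs at most `c`. The induction separates the walks whose last step
toggles `y` from the others. -/
theorem walk_insert_le {p : α → ℝ} {c : ℝ} (hp : ∀ y, 0 ≤ p y) (hc : ∀ y, p y ≤ c) (r : ℕ)
    {S : Finset α} {y : α} (hy : y ∉ S) :
    walk p (r + 1) (insert y S) ≤ (r + 1) * c * walk p r S := by
  have hins : symmDiff (insert y S) {y} = S := by
    ext z; simp only [Finset.mem_symmDiff, Finset.mem_singleton, Finset.mem_insert]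
    by_cases hz : z = y <;> simp [hz, hy]
  induction r generalizing S with
  | zero =>
    change ∑ z, p z * walk p 0 (symmDiff (insert y S) {z}) ≤
      (((0 : ℕ) : ℝ) + 1) * c * walk p 0 S
    rw [← Finset.add_sum_erase _ _ (Finset.mem_univ y), hins]
    rw [Finset.sum_eq_zero, add_zero]
    · simpa using mul_le_mul_of_nonneg_right (hc y) (walk_nonneg hp 0 S)
    · intro z hz
      rw [Finset.mem_erase] at hz
      have : symmDiff (insert y S) {z} ≠ ∅ := by
        refine Finset.ne_empty_of_mem (a := y) ?_
        simp [Finset.mem_symmDiff, hz.1.symm]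
      simp [walk, this]
  | succ r ih =>
    rw [walk, ← Finset.add_sum_erase _ _ (Finset.mem_univ y), hins]
    have h1 : p y * walk p (r + 1) S ≤ c * walk p (r + 1) S :=
      mul_le_mul_of_nonneg_right (hc y) (walk_nonneg hp _ S)
    have h2 : ∑ z ∈ Finset.univ.erase y, p z * walk p (r + 1) (symmDiff (insert y S) {z}) ≤
        (r + 1) * c * walk p (r + 1) S := by
      calc _ ≤ ∑ z ∈ Finset.univ.erase y, p z * ((r + 1) * c * walk p r (symmDiff S {z})) := by
            refine Finset.sum_le_sum fun z hz => mul_le_mul_of_nonneg_left ?_ (hp z)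
            have hzy : y ≠ z := (Finset.ne_of_mem_erase hz).symm
            have hy' : y ∉ symmDiff S {z} := by simp [Finset.mem_symmDiff, hy, hzy]
            have hs : symmDiff (insert y S) {z} = insert y (symmDiff S {z}) := by
              ext a; simp only [Finset.mem_symmDiff, Finset.mem_singleton, Finset.mem_insert]
              by_cases ha : a = y
              · simp [ha, hzy]
              · simp [ha]
            rw [hs]
            refine ih hy' ?_
            rw [← hs]
            ext a
            simp only [Finset.mem_symmDiff, Finset.mem_singleton, Finset.mem_insert]
            by_cases ha : a = y
            · simp [ha, hzy, hy]
            · simp [ha]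
        _ ≤ ∑ z, p z * ((r + 1) * c * walk p r (symmDiff S {z})) := by
            have hc0 : 0 ≤ c := (hp y).trans (hc y)
            refine Finset.sum_le_sum_of_subset_of_nonneg (Finset.erase_subset _ _) fun z _ _ => ?_
            have := walk_nonneg hp r (symmDiff S {z})
            have := hp z
            positivity
        _ = (r + 1) * c * walk p (r + 1) S := by
            rw [walk, Finset.mul_sum]
            exact Finset.sum_congr rfl fun z _ => by ring
    push_cast
    linarith

/-- The last step of a closed walk starts from a singleton. By `walk_insert_le` reaching it costs at
most `(2k + 1) c` times the closed walks of length `2k`, and the weights `p` sum to one. -/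
theorem walk_empty_le {p : α → ℝ} {c : ℝ} (hp : ∀ y, 0 ≤ p y) (hc : ∀ y, p y ≤ c) (hc0 : 0 ≤ c)
    (hs : ∑ y, p y = 1) (k : ℕ) : walk p (2 * k) ∅ ≤ (2 * k * c) ^ k := by
  induction k with
  | zero => simp [walk]
  | succ k ih =>
    have h1 : walk p (2 * (k + 1)) ∅ ≤ (2 * k + 1) * c * walk p (2 * k) ∅ := by
      rw [show 2 * (k + 1) = (2 * k + 1) + 1 by ring, walk]
      calc _ ≤ ∑ y, p y * ((2 * k + 1) * c * walk p (2 * k) ∅) := by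
            refine Finset.sum_le_sum fun y _ => mul_le_mul_of_nonneg_left ?_ (hp y)
            have := walk_insert_le hp hc (2 * k) (Finset.notMem_empty y)
            have h2 : symmDiff (∅ : Finset α) {y} = insert y ∅ := by
              ext z; simp [Finset.mem_symmDiff]
            rw [h2]
            push_cast at this
            exact this
        _ = _ := by rw [← Finset.sum_mul, hs, one_mul]
    refine h1.trans ?_
    rw [pow_succ']
    push_cast
    have h3 : (2 * k * c) ^ k ≤ (2 * (k + 1) * c) ^ k := by
      gcongr
      linarith
    have h4 : (0 : ℝ) ≤ (2 * k + 1) * c := by positivity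
    calc (2 * k + 1) * c * walk p (2 * k) ∅ ≤ (2 * k + 1) * c * (2 * (k + 1) * c) ^ k :=
          mul_le_mul_of_nonneg_left (ih.trans h3) h4
      _ ≤ _ := by gcongr; linarith

end Walk

section Moment
variable {ξ α : Type} [Fintype ξ] [Fintype α] [DecidableEq α]

/-- The moment bound: small bias of the products `∏ y ∈ S, f x y` over uniform `x` bounds the
average of `|∑ y, w y * f x y|` under any distribution `q` with small point masses. -/
theorem moment_bound {q : ξ → ℝ} {cX : ℝ} (hq : ∀ x, 0 ≤ q x) (hqc : ∀ x, q x ≤ cX)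
    (hq1 : ∑ x, q x = 1) (hcX : 0 ≤ cX)
    {p : α → ℝ} {c : ℝ} (hp : ∀ y, 0 ≤ p y) (hc : ∀ y, p y ≤ c) (hc0 : 0 ≤ c)
    (hp1 : ∑ y, p y = 1) {w : α → ℝ} (hw : ∀ y, |w y| ≤ p y)
    {f : ξ → α → ℝ} (hf : ∀ x y, f x y ^ 2 = 1) {k : ℕ} {η : ℝ} (hη : 0 ≤ η)
    (hbias : ∀ S : Finset α, S.Nonempty → S.card ≤ 2 * k → |∑ x, ∏ y ∈ S, f x y| ≤ η) :
    (∑ x, q x * |∑ y, w y * f x y|) ^ (2 * k) ≤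
      cX * (Fintype.card ξ * (2 * k * c) ^ k + η) := by
  have hJ := Real.pow_arith_mean_le_arith_mean_pow Finset.univ q
    (fun x => |∑ y, w y * f x y|) (fun x _ => hq x) hq1 (fun x _ => abs_nonneg _) (2 * k)
  refine hJ.trans ?_
  -- Only the bound on point masses of `q` is used here: the terms are nonnegative as the exponent
  -- is even, so the average becomes an unweighted sum at the price `cX`.
  have h1 : ∑ x, q x * |∑ y, w y * f x y| ^ (2 * k) ≤ cX * ∑ x, (∑ y, w y * f x y) ^ (2 * k) := by
    rw [Finset.mul_sum]
    refine Finset.sum_le_sum fun x _ => ?_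
    rw [(even_two_mul k).pow_abs]
    exact mul_le_mul_of_nonneg_right (hqc x) ((even_two_mul k).pow_nonneg _)
  refine h1.trans (mul_le_mul_of_nonneg_left ?_ hcX)
  simp only [fun x => pow_sum_eq_walk w (f x) (hf x) (2 * k)]
  rw [Finset.sum_comm]
  simp only [← Finset.mul_sum]
  -- The empty set collects the walks that return, whose product is constantly 1; any other set
  -- contributes at most the bias `η` times its walk weight.
  rw [← Finset.add_sum_erase _ _ (Finset.mem_univ (∅ : Finset α))]
  refine add_le_add ?_ ?_
  · simp only [Finset.prod_empty, Finset.sum_const, Finset.card_univ, nsmul_eq_mul, mul_one]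
    rw [mul_comm]
    exact mul_le_mul_of_nonneg_left ((le_abs_self _).trans ((abs_walk_le hw _ _).trans
      (walk_empty_le hp hc hc0 hp1 k))) (Nat.cast_nonneg _)
  · calc _ ≤ ∑ S ∈ Finset.univ.erase (∅ : Finset α), walk p (2 * k) S * η := by
          refine Finset.sum_le_sum fun S hS => ?_
          refine (le_abs_self _).trans ?_
          rw [abs_mul]
          by_cases hS' : S.card ≤ 2 * k
          · exact mul_le_mul (abs_walk_le hw _ _) (hbias S
              (Finset.nonempty_iff_ne_empty.2 (Finset.ne_of_mem_erase hS)) hS') (abs_nonneg _)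
              (walk_nonneg hp _ _)
          · rw [walk_eq_zero w (not_le.1 hS'), walk_eq_zero p (not_le.1 hS')]
            simp
      _ ≤ ∑ S, walk p (2 * k) S * η :=
          Finset.sum_le_sum_of_subset_of_nonneg (Finset.erase_subset _ _)
            fun S _ _ => mul_nonneg (walk_nonneg hp _ _) hη
      _ = η := by rw [← Finset.sum_mul, sum_walk, hp1, one_pow, one_mul]

end Moment

/-! ### Characters of `{0,1}^m` -/

/-- The character of `{0,1}^m` with index `τ`. -/
noncomputable def bitChar {m : ℕ} (τ z : BitStr m) : ℝ := ∏ i, if τ i && z i then -1 else 1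

theorem bitChar_sq {m : ℕ} (τ z : BitStr m) : bitChar τ z ^ 2 = 1 := by
  rw [bitChar, ← Finset.prod_pow]
  refine Finset.prod_eq_one fun i _ => ?_
  split_ifs <;> norm_num

theorem sum_bitChar_mul {m : ℕ} (z z' : BitStr m) :
    ∑ τ, bitChar τ z * bitChar τ z' = if z = z' then 2 ^ m else 0 := by
  simp only [bitChar, ← Finset.prod_mul_distrib]
  have key := (Finset.prod_univ_sum (fun _ : Fin m => (Finset.univ : Finset Bool))
    (fun i b => (if b && z i then (-1 : ℝ) else 1) * (if b && z' i then -1 else 1))).symm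
  rw [Fintype.piFinset_univ] at key
  rw [key]
  split_ifs with h
  · subst h
    rw [Finset.prod_congr rfl (g := fun _ => (2 : ℝ))]
    · simp
    · intro i _
      cases z i <;> norm_num
  · obtain ⟨i, hi⟩ := Function.ne_iff.1 h
    refine Finset.prod_eq_zero (Finset.mem_univ i) ?_
    revert hi
    cases z i <;> cases z' i <;> norm_num

theorem sum_bitChar {m : ℕ} {τ : BitStr m} (h : ∃ i, τ i = true) : ∑ z, bitChar τ z = 0 := by
  have := sum_bitChar_mul τ (fun _ => false)
  rw [if_neg] at this
  · rw [← this]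
    refine Finset.sum_congr rfl fun z _ => ?_
    simp [bitChar, Bool.and_comm]
  · rintro rfl
    simp at h

/-- A function on `{0,1}^m` of sum zero has `ℓ¹` norm at most the sum of the absolute values of its
nontrivial Fourier coefficients. -/
theorem sum_abs_le_fourier {m : ℕ} (D : BitStr m → ℝ) (h0 : ∑ z, D z = 0) :
    ∑ z, |D z| ≤ ∑ τ ∈ Finset.univ.filter (fun τ : BitStr m => ∃ i, τ i = true),
      |∑ z, D z * bitChar τ z| := by
  -- Fourier inversion; the final sum over the `2 ^ m` points `z` cancels the factor `2 ^ m`.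
  have key : ∀ z, (2 : ℝ) ^ m * D z = ∑ τ, (∑ z', D z' * bitChar τ z') * bitChar τ z := by
    intro z
    simp only [Finset.sum_mul]
    rw [Finset.sum_comm]
    simp only [mul_assoc, ← Finset.mul_sum, sum_bitChar_mul]
    simp [mul_comm]
  have hb : ∀ τ z : BitStr m, |bitChar τ z| = 1 := fun τ z => by
    have := bitChar_sq τ z
    rwa [← sq_abs, pow_eq_one_iff_of_nonneg (abs_nonneg _) two_ne_zero] at this
  have hz : ∀ z, (2 : ℝ) ^ m * |D z| ≤
      ∑ τ ∈ Finset.univ.filter (fun τ : BitStr m => ∃ i, τ i = true), |∑ z, D z * bitChar τ z| := by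
    intro z
    rw [← abs_of_pos (show (0 : ℝ) < 2 ^ m by positivity), ← abs_mul, key]
    rw [← Finset.sum_filter_add_sum_filter_not _ (fun τ : BitStr m => ∃ i, τ i = true)]
    have h2 : ∑ τ ∈ Finset.univ.filter (fun τ : BitStr m => ¬ ∃ i, τ i = true),
        (∑ z', D z' * bitChar τ z') * bitChar τ z = 0 := by
      refine Finset.sum_eq_zero fun τ hτ => ?_
      have : ∀ z', bitChar τ z' = 1 := fun z' => by
        refine Finset.prod_eq_one fun i _ => ?_
        simp only [Finset.mem_filter, Finset.mem_univ, true_and, not_exists] at hτ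
        simp [hτ i]
      simp [this, h0]
    rw [h2, add_zero]
    refine (Finset.abs_sum_le_sum_abs _ _).trans (le_of_eq (Finset.sum_congr rfl fun τ _ => ?_))
    rw [abs_mul, hb, mul_one]
  have h3 : (2 : ℝ) ^ m * ∑ z, |D z| ≤ 2 ^ m *
      ∑ τ ∈ Finset.univ.filter (fun τ : BitStr m => ∃ i, τ i = true), |∑ z, D z * bitChar τ z| := by
    rw [Finset.mul_sum]
    refine (Finset.sum_le_sum fun z _ => hz z).trans (le_of_eq ?_)
    rw [Finset.sum_const, Finset.card_univ, nsmul_eq_mul]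
    simp
  exact le_of_mul_le_mul_left h3 (by positivity)

end RazExtractor

namespace RazExtractor

/-! ### Statistical distance from character sums -/

theorem toReal_map_apply {α β : Type} [Fintype α] [DecidableEq β] (p : PMF α) (f : α → β) (b : β) :
    ((p.map f) b).toReal = ∑ a, if f a = b then (p a).toReal else 0 := by
  classical
  rw [PMF.map_apply, tsum_fintype, ENNReal.toReal_sum]
  · refine Finset.sum_congr rfl fun a _ => ?_
    by_cases h : f a = b
    · simp [h]
    · simp [h, Ne.symm h]
  · intro a _
    split_ifs
    · exact PMF.apply_ne_top _ _
    · exact ENNReal.zero_ne_top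

theorem toReal_indep_apply {α β : Type} [Fintype α] [Fintype β] [DecidableEq α] [DecidableEq β]
    (p : PMF α) (q : PMF β) (z : α × β) :
    ((indep p q) z).toReal = (p z.1).toReal * (q z.2).toReal := by
  classical
  obtain ⟨a, b⟩ := z
  rw [indep, PMF.bind_apply, tsum_fintype, Finset.sum_eq_single a]
  · rw [ENNReal.toReal_mul, toReal_map_apply, Finset.sum_eq_single b] <;> simp +contextual
  · intro a' _ h
    simp [PMF.map_apply, Ne.symm h]
  · simp

theorem toReal_unif_apply {m : ℕ} (z : BitStr m) : (unif m z).toReal = (2 ^ m)⁻¹ := by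
  simp [unif, PMF.uniformOfFintype_apply]

theorem sum_toReal {α : Type} [Fintype α] (p : PMF α) : ∑ a, (p a).toReal = 1 := by
  rw [← ENNReal.toReal_sum fun a _ => PMF.apply_ne_top p a, ← tsum_fintype (L := .unconditional _),
      p.tsum_coe]
  rfl

theorem IsSource.apply_le {n : ℕ} {X : PMF (BitStr n)} {k : ℝ} (h : IsSource X k) (x : BitStr n) :
    (X x).toReal ≤ 2 ^ (-k) := by
  have hb : BddAbove (Set.range fun x => (X x).toReal) := (Set.finite_range _).bddAbove
  have hx : (X x).toReal ≤ ⨆ x, (X x).toReal := le_ciSup hb x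
  refine hx.trans ?_
  -- `Real.logb 2 0 = 0` is a default value, so undoing the logarithm needs a point of positive
  -- mass.
  have hpos : 0 < ⨆ x, (X x).toReal := by
    obtain ⟨y, hy⟩ := X.support_nonempty
    refine lt_of_lt_of_le ?_ (le_ciSup hb y)
    exact ENNReal.toReal_pos ((PMF.mem_support_iff _ _).1 hy) (PMF.apply_ne_top _ _)
  rw [IsSource, minEntropy] at h
  have h2 : Real.logb 2 (⨆ x, (X x).toReal) ≤ -k := by linarith
  rwa [Real.logb_le_iff_le_rpow (by norm_num) hpos] at h2

section SD
variable {n₁ n₂ m : ℕ} {Ext : BitStr n₁ → BitStr n₂ → BitStr m}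
  {X : PMF (BitStr n₁)} {Y : PMF (BitStr n₂)} {Γ : ℝ}

/-- The nontrivial Fourier coefficients of the uniform law vanish, so the defect has those of the
law of `g`. -/
theorem fourier_defect {α : Type} [Fintype α] {p : α → ℝ} (hp : ∑ y, p y = 1) (g : α → BitStr m) :
    ∑ z, |(∑ y, if g y = z then p y else 0) - (2 ^ m)⁻¹| ≤
      ∑ τ ∈ Finset.univ.filter (fun τ : BitStr m => ∃ i, τ i = true),
        |∑ y, p y * bitChar τ (g y)| := by
  refine (sum_abs_le_fourier _ ?_).trans (le_of_eq (Finset.sum_congr rfl fun τ hτ => ?_))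
  · rw [Finset.sum_sub_distrib, Finset.sum_comm]
    simp [hp]
  · congr 1
    simp only [sub_mul, Finset.sum_sub_distrib, ← Finset.mul_sum]
    rw [sum_bitChar (Finset.mem_filter.1 hτ).2, mul_zero, sub_zero]
    simp only [Finset.sum_mul]
    rw [Finset.sum_comm]
    refine Finset.sum_congr rfl fun y _ => ?_
    simp [ite_mul]

theorem card_nontrivial_le : ((Finset.univ.filter
    (fun τ : BitStr m => ∃ i, τ i = true)).card : ℝ) ≤ 2 ^ m := by
  have := Finset.card_filter_le (Finset.univ : Finset (BitStr m)) (fun τ => ∃ i, τ i = true)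
  rw [Finset.card_univ] at this
  simp only [Fintype.card_fun, Fintype.card_bool, Fintype.card_fin] at this
  exact_mod_cast this

theorem sum_defect_le (hΓ : 0 ≤ Γ) (H : ∀ τ : BitStr m, (∃ i, τ i = true) →
    ∑ x, (X x).toReal * |∑ y, (Y y).toReal * bitChar τ (Ext x y)| ≤ Γ) :
    ∑ x, (X x).toReal * ∑ z, |(∑ y, if Ext x y = z then (Y y).toReal else 0) - (2 ^ m)⁻¹| ≤
      2 ^ m * Γ := by
  calc _ ≤ ∑ x, (X x).toReal * ∑ τ ∈ Finset.univ.filter (fun τ : BitStr m => ∃ i, τ i = true),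
        |∑ y, (Y y).toReal * bitChar τ (Ext x y)| :=
        Finset.sum_le_sum fun x _ => mul_le_mul_of_nonneg_left (fourier_defect (sum_toReal Y) _)
          ENNReal.toReal_nonneg
    _ = ∑ τ ∈ Finset.univ.filter (fun τ : BitStr m => ∃ i, τ i = true),
        ∑ x, (X x).toReal * |∑ y, (Y y).toReal * bitChar τ (Ext x y)| := by
        simp only [Finset.mul_sum]
        rw [Finset.sum_comm]
    _ ≤ ∑ τ ∈ Finset.univ.filter (fun τ : BitStr m => ∃ i, τ i = true), Γ :=
        Finset.sum_le_sum fun τ hτ => H τ (Finset.mem_filter.1 hτ).2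
    _ ≤ 2 ^ m * Γ := by
        rw [Finset.sum_const, nsmul_eq_mul]
        exact mul_le_mul_of_nonneg_right card_nontrivial_le hΓ

/-- Both laws have marginal `X`, so the distance is the average over `x` of the distance of the
conditional output from uniform. -/
theorem statDist_first_eq :
    statDist ((indep X Y).map fun z => (Ext z.1 z.2, z.1)) (indep (unif m) X) =
      1 / 2 * ∑ x, (X x).toReal *
        ∑ z, |(∑ y, if Ext x y = z then (Y y).toReal else 0) - (2 ^ m)⁻¹| := by
  rw [statDist, Fintype.sum_prod_type, Finset.sum_comm]
  congr 1
  refine Finset.sum_congr rfl fun x _ => ?_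
  rw [Finset.mul_sum]
  refine Finset.sum_congr rfl fun z _ => ?_
  rw [toReal_map_apply, toReal_indep_apply, toReal_unif_apply, Fintype.sum_prod_type,
    Finset.sum_eq_single x]
  · have hx : 0 ≤ (X x).toReal := ENNReal.toReal_nonneg
    rw [← abs_of_nonneg hx, ← abs_mul, mul_sub, Finset.mul_sum, abs_of_nonneg hx,
        mul_comm _ (X x).toReal]
    congr 2
    refine Finset.sum_congr rfl fun y _ => ?_
    simp [toReal_indep_apply]
  · intro x' _ h
    simp [h]
  · simp

theorem statDist_second_eq :
    statDist ((indep X Y).map fun z => (Ext z.1 z.2, z.2)) (indep (unif m) Y) =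
      1 / 2 * ∑ y, (Y y).toReal *
        ∑ z, |(∑ x, if Ext x y = z then (X x).toReal else 0) - (2 ^ m)⁻¹| := by
  rw [statDist, Fintype.sum_prod_type, Finset.sum_comm]
  congr 1
  refine Finset.sum_congr rfl fun y _ => ?_
  rw [Finset.mul_sum]
  refine Finset.sum_congr rfl fun z _ => ?_
  rw [toReal_map_apply, toReal_indep_apply, toReal_unif_apply, Fintype.sum_prod_type_right,
    Finset.sum_eq_single y]
  · have hx : 0 ≤ (Y y).toReal := ENNReal.toReal_nonneg
    rw [← abs_of_nonneg hx, ← abs_mul, mul_sub, Finset.mul_sum, abs_of_nonneg hx,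
        mul_comm _ (Y y).toReal]
    congr 2
    refine Finset.sum_congr rfl fun y _ => ?_
    simp [toReal_indep_apply, mul_comm]
  · intro x' _ h
    simp [h]
  · simp

/-- Forgetting the revealed input cannot increase the distance: the triangle inequality in the sum
over `x`. -/
theorem statDist_le_first :
    statDist ((indep X Y).map fun z => Ext z.1 z.2) (unif m) ≤
      statDist ((indep X Y).map fun z => (Ext z.1 z.2, z.1)) (indep (unif m) X) := by
  rw [statDist_first_eq, statDist]
  refine mul_le_mul_of_nonneg_left ?_ (by norm_num)
  simp only [Finset.mul_sum]
  rw [Finset.sum_comm]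
  refine Finset.sum_le_sum fun z _ => ?_
  calc _ = |∑ x, (X x).toReal * ((∑ y, if Ext x y = z then (Y y).toReal else 0) - (2 ^ m)⁻¹)| := by
        simp only [mul_sub, Finset.sum_sub_distrib, ← Finset.sum_mul]
        rw [sum_toReal, one_mul, toReal_unif_apply, toReal_map_apply, Fintype.sum_prod_type]
        congr 2
        refine Finset.sum_congr rfl fun x _ => ?_
        rw [Finset.mul_sum]
        refine Finset.sum_congr rfl fun y _ => ?_
        simp [toReal_indep_apply]
    _ ≤ _ := by
        refine (Finset.abs_sum_le_sum_abs _ _).trans (le_of_eq (Finset.sum_congr rfl fun x _ => ?_))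
        rw [abs_mul, abs_of_nonneg ENNReal.toReal_nonneg]

/-- Bounds on all weighted character sums bound the three statistical distances. -/
theorem statDist_le_of_charSum (hΓ : 0 ≤ Γ) (H : ∀ τ : BitStr m, (∃ i, τ i = true) →
    ∀ w : BitStr n₂ → ℝ, (∀ y, |w y| ≤ (Y y).toReal) →
      ∑ x, (X x).toReal * |∑ y, w y * bitChar τ (Ext x y)| ≤ Γ) :
    statDist ((indep X Y).map fun z => (Ext z.1 z.2, z.1)) (indep (unif m) X) ≤
      1 / 2 * (2 ^ m * Γ) ∧
    statDist ((indep X Y).map fun z => (Ext z.1 z.2, z.2)) (indep (unif m) Y) ≤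
      1 / 2 * (2 ^ m * Γ) := by
  have hY : ∀ y, 0 ≤ (Y y).toReal := fun y => ENNReal.toReal_nonneg
  constructor
  · rw [statDist_first_eq]
    exact mul_le_mul_of_nonneg_left (sum_defect_le hΓ fun τ hτ =>
      H τ hτ _ fun y => (abs_of_nonneg (hY y)).le) (by norm_num)
  · rw [statDist_second_eq]
    refine mul_le_mul_of_nonneg_left (sum_defect_le (Ext := fun y x => Ext x y) hΓ
      fun τ hτ => ?_) (by norm_num)
    -- The signs of the inner sums remove the absolute values for fixed `y`, and then become part of
    -- the weights `w`. This is why the hypothesis allows all weights bounded by `Y`, and why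
    -- strength in the second input costs no further entropy.
    set s : BitStr n₂ → ℝ := fun y => SignType.sign (∑ x, (X x).toReal * bitChar τ (Ext x y))
    have hs : ∀ y, |s y| ≤ 1 := fun y => by
      simp only [s]
      rcases lt_trichotomy (∑ x, (X x).toReal * bitChar τ (Ext x y)) 0 with h | h | h <;> simp [h]
    calc _ = ∑ y, (Y y).toReal * (s y * ∑ x, (X x).toReal * bitChar τ (Ext x y)) := by
          refine Finset.sum_congr rfl fun y _ => ?_
          rw [sign_mul_self]
      _ = ∑ x, (X x).toReal * ∑ y, ((Y y).toReal * s y) * bitChar τ (Ext x y) := by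
          simp only [Finset.mul_sum]
          rw [Finset.sum_comm]
          exact Finset.sum_congr rfl fun x _ => Finset.sum_congr rfl fun y _ => by ring
      _ ≤ ∑ x, (X x).toReal * |∑ y, ((Y y).toReal * s y) * bitChar τ (Ext x y)| :=
          Finset.sum_le_sum fun x _ => mul_le_mul_of_nonneg_left (le_abs_self _)
            ENNReal.toReal_nonneg
      _ ≤ Γ := H τ hτ _ fun y => by
          rw [abs_mul, abs_of_nonneg (hY y)]
          exact mul_le_of_le_one_right (hY y) (hs y)

end SD

/-! ### Small bias from powers in a field of characteristic two -/

section Bias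
open Polynomial
variable {F : Type} [Field F] [CharP F 2]

/-- In characteristic two, `∑ y ∈ S, (X + y) ^ (2 ^ l - 1)` is a nonzero polynomial for small `S`. -/
theorem sum_X_add_C_pow_ne_zero [DecidableEq F] {l : ℕ} {S : Finset F} (hS : S.Nonempty)
    (hc : S.card ≤ 2 ^ l) : ∑ y ∈ S, (X + C y) ^ (2 ^ l - 1) ≠ 0 := by
  intro h
  -- Multiplied by `X + y`, both sides become `X ^ 2 ^ l + y ^ 2 ^ l`; all binomial coefficients of
  -- `2 ^ l - 1` are odd.
  have hexp : ∀ y : F, (X + C y) ^ (2 ^ l - 1) =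
      ∑ j ∈ Finset.range (2 ^ l), (X : F[X]) ^ j * C y ^ (2 ^ l - 1 - j) := by
    intro y
    have h1 : (X + C y) ≠ 0 := X_add_C_ne_zero y
    refine mul_right_cancel₀ h1 ?_
    rw [← pow_succ, Nat.sub_add_cancel Nat.one_le_two_pow, add_pow_char_pow]
    have h2 := (Commute.all (X : F[X]) (C y)).geom_sum₂_mul (2 ^ l)
    have h3 : ∀ a : F[X], -a = a := fun a => CharTwo.neg_eq a
    rw [sub_eq_add_neg, sub_eq_add_neg, h3, h3] at h2
    rw [h2]
  -- The coefficients of the zero polynomial are the power sums of `S`; hence every polynomial of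
  -- degree below `2 ^ l` sums to zero over `S`.
  have hcoef : ∀ j < 2 ^ l, ∑ y ∈ S, y ^ j = 0 := by
    intro j hj
    have := congrArg (fun f => coeff f (2 ^ l - 1 - j)) h
    simp only [hexp, finsetSum_coeff, ← C_pow, coeff_mul_C, coeff_X_pow, coeff_zero] at this
    rw [← this]
    refine Finset.sum_congr rfl fun y _ => ?_
    rw [Finset.sum_eq_single (2 ^ l - 1 - j)]
    · simp only [if_true, one_mul]
      congr 1
      omega
    · intro b _ hb
      simp [hb.symm]
    · intro hb
      simp only [Finset.mem_range] at hb
      omega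
  have hpoly : ∀ f : F[X], f.natDegree < 2 ^ l → ∑ y ∈ S, f.eval y = 0 := by
    intro f hf
    simp only [eval_eq_sum_range]
    rw [Finset.sum_comm]
    refine Finset.sum_eq_zero fun j hj => ?_
    rw [← Finset.mul_sum, hcoef j (by rw [Finset.mem_range] at hj; omega), mul_zero]
  obtain ⟨y₀, hy₀⟩ := hS
  -- A test polynomial of degree `S.card - 1` vanishing on `S` except at `y₀`: this is where the
  -- bound on `S.card` enters.
  have h1 := hpoly (∏ y ∈ S.erase y₀, (X - C y)) (by
    rw [natDegree_prod_of_monic _ _ fun y _ => monic_X_sub_C y]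
    simp only [natDegree_X_sub_C, Finset.sum_const, smul_eq_mul, mul_one]
    rw [Finset.card_erase_of_mem hy₀]
    have := Finset.card_pos.2 ⟨y₀, hy₀⟩
    omega)
  rw [← Finset.add_sum_erase _ _ hy₀, Finset.sum_eq_zero, add_zero, eval_prod,
    Finset.prod_eq_zero_iff] at h1
  · obtain ⟨y, hy, h2⟩ := h1
    rw [eval_sub, eval_X, eval_C, sub_eq_zero] at h2
    exact (Finset.ne_of_mem_erase hy) h2.symm
  · intro y hy
    rw [eval_prod]
    exact Finset.prod_eq_zero hy (by simp)

variable {m : ℕ}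

/-- The bits of a vector over `ZMod 2`. -/
def toBits (v : Fin m → ZMod 2) : BitStr m := fun i => decide (v i = 1)

theorem bitChar_toBits_add (τ : BitStr m) (v v' : Fin m → ZMod 2) :
    bitChar τ (toBits (v + v')) = bitChar τ (toBits v) * bitChar τ (toBits v') := by
  simp only [bitChar, ← Finset.prod_mul_distrib]
  refine Finset.prod_congr rfl fun i _ => ?_
  have : ∀ a b : ZMod 2, ∀ t : Bool, (if t && decide (a + b = 1) then (-1 : ℝ) else 1) =
      (if t && decide (a = 1) then (-1 : ℝ) else 1) * (if t && decide (b = 1) then -1 else 1) := by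
    intro a b t
    have h : ∀ a b : ZMod 2, decide (a + b = 1) = xor (decide (a = 1)) (decide (b = 1)) := by decide
    rw [h]
    cases decide (a = 1) <;> cases decide (b = 1) <;> cases t <;> simp
  simpa [toBits] using this (v i) (v' i) (τ i)

/-- Translating `b` by `z / G`, where the character is `-1` at `z`, flips the sign of the sum. -/
theorem sum_bitChar_toBits_mul [Fintype F] {π : F →+ (Fin m → ZMod 2)} (hπ : Function.Surjective π)
    {τ : BitStr m} (hτ : ∃ i, τ i = true) {G : F} (hG : G ≠ 0) :
    ∑ b, bitChar τ (toBits (π (b * G))) = 0 := by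
  obtain ⟨i, hi⟩ := hτ
  obtain ⟨z, hz⟩ := hπ (Pi.single i 1)
  have h1 : bitChar τ (toBits (π z)) = -1 := by
    rw [hz, bitChar, Finset.prod_eq_single i]
    · simp [hi, toBits]
    · intro j _ hj
      simp [toBits, hj]
    · simp
  have h2 := Equiv.sum_comp (Equiv.addRight (z / G)) (fun b => bitChar τ (toBits (π (b * G))))
  simp only [Equiv.coe_addRight, add_mul, map_add, bitChar_toBits_add, div_mul_cancel₀ _ hG, h1,
    ← Finset.sum_mul] at h2
  linarith

theorem prod_bitChar_toBits {β : Type} (τ : BitStr m) (S : Finset β) (g : β → Fin m → ZMod 2) :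
    ∏ y ∈ S, bitChar τ (toBits (g y)) = bitChar τ (toBits (∑ y ∈ S, g y)) := by
  classical
  induction S using Finset.induction_on with
  | empty => simp [bitChar, toBits]
  | insert y S hy ih => rw [Finset.prod_insert hy, Finset.sum_insert hy, bitChar_toBits_add, ih]

/-- The zeros are roots of one nonzero polynomial of degree below `2 ^ l`. -/
theorem card_zeros_le [DecidableEq F] {α : Type} [Fintype α] {ι : α → F}
    (hι : Function.Injective ι) {l : ℕ} {S : Finset F} (hS : S.Nonempty) (hc : S.card ≤ 2 ^ l) :
    (Finset.univ.filter fun a => ∑ y ∈ S, (ι a + y) ^ (2 ^ l - 1) = 0).card ≤ 2 ^ l := by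
  have hne := sum_X_add_C_pow_ne_zero hS hc
  set f : F[X] := ∑ y ∈ S, (X + C y) ^ (2 ^ l - 1) with hf
  have hdeg : f.natDegree ≤ 2 ^ l := by
    refine natDegree_sum_le_of_forall_le _ _ fun y _ => ?_
    rw [natDegree_pow, natDegree_X_add_C, mul_one]
    omega
  rw [← Finset.card_image_of_injective _ hι]
  refine (Finset.card_le_card (t := f.roots.toFinset) ?_).trans
    ((Multiset.toFinset_card_le _).trans ((card_roots' f).trans hdeg))
  intro b hb
  obtain ⟨a, ha, rfl⟩ := Finset.mem_image.1 hb
  rw [Multiset.mem_toFinset, mem_roots hne, IsRoot.def, hf, eval_finsetSum]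
  simpa using (Finset.mem_filter.1 ha).2

/-- The bias of the functions `(a, b) ↦ c₀ * b * (a + y) ^ (2 ^ l - 1)` on small sets of `y`. -/
theorem bias_le [Fintype F] {α β ξ : Type} [Fintype α] [Fintype ξ] {ι : α → F}
    (hι : Function.Injective ι)
    {κ : β → F} (hκ : Function.Injective κ) (e : ξ ≃ α × F) {c₀ : F} (hc₀ : c₀ ≠ 0)
    {π : F →+ (Fin m → ZMod 2)} (hπ : Function.Surjective π) {τ : BitStr m}
    (hτ : ∃ i, τ i = true) {l : ℕ} {S : Finset β} (hS : S.Nonempty) (hc : S.card ≤ 2 ^ l) :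
    |∑ x, ∏ y ∈ S, bitChar τ (toBits (π (c₀ * (e x).2 * (ι (e x).1 + κ y) ^ (2 ^ l - 1))))| ≤
      2 ^ l * Fintype.card F := by
  classical
  simp only [prod_bitChar_toBits, ← map_sum, ← Finset.mul_sum]
  rw [← e.symm.sum_comp]
  simp only [Equiv.apply_symm_apply]
  rw [Fintype.sum_prod_type]
  have hmap : ∀ a, ∑ y ∈ S, (ι a + κ y) ^ (2 ^ l - 1) =
      ∑ y ∈ S.map ⟨κ, hκ⟩, (ι a + y) ^ (2 ^ l - 1) := fun a => by simp
  have hz := card_zeros_le hι (l := l) (S := S.map ⟨κ, hκ⟩) (by simpa using hS) (by simpa using hc)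
  set Z := Finset.univ.filter fun a => ∑ y ∈ S.map ⟨κ, hκ⟩, (ι a + y) ^ (2 ^ l - 1) = 0 with hZ
  have hb : ∀ z : BitStr m, |bitChar τ z| = 1 := fun z => by
    have := bitChar_sq τ z
    rwa [← sq_abs, pow_eq_one_iff_of_nonneg (abs_nonneg _) two_ne_zero] at this
  rw [← Finset.sum_filter_add_sum_filter_not _ (fun a => a ∈ Z)]
  -- Outside `Z` the character is applied to `b` times a nonzero element, so the sum over `b`
  -- vanishes. On `Z` the trivial bound is used.
  have h0 : ∑ a ∈ Finset.univ.filter (fun a => a ∉ Z), ∑ b, bitChar τ (toBits (π (c₀ * b *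
      ∑ y ∈ S, (ι a + κ y) ^ (2 ^ l - 1)))) = 0 := by
    refine Finset.sum_eq_zero fun a ha => ?_
    rw [hmap]
    have hne : ∑ y ∈ S.map ⟨κ, hκ⟩, (ι a + y) ^ (2 ^ l - 1) ≠ 0 := by
      simpa [hZ] using ha
    have := sum_bitChar_toBits_mul hπ hτ (mul_ne_zero hc₀ hne)
    rw [← this]
    refine Finset.sum_congr rfl fun b _ => ?_
    congr 3
    ring
  rw [h0, add_zero, Finset.filter_mem_eq_inter, Finset.univ_inter]
  refine (Finset.abs_sum_le_sum_abs _ _).trans ?_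
  calc _ ≤ ∑ a ∈ Z, (Fintype.card F : ℝ) := by
        refine Finset.sum_le_sum fun a _ => (Finset.abs_sum_le_sum_abs _ _).trans (le_of_eq ?_)
        simp [hb]
    _ ≤ _ := by
        rw [Finset.sum_const, nsmul_eq_mul]
        exact mul_le_mul_of_nonneg_right (by exact_mod_cast hz) (Nat.cast_nonneg _)

end Bias

/-- The analysis of the extractor `(x, y) ↦ π (c₀ * b * (a + y) ^ (2 ^ l - 1))`, `x = (a, b)`. -/
theorem extractor_of_pow {F : Type} [Field F] [CharP F 2] [Fintype F] {n₁ n₂ m h l k : ℕ}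
    {ι : BitStr h → F} (hι : Function.Injective ι) {κ : BitStr n₂ → F} (hκ : Function.Injective κ)
    (e : BitStr n₁ ≃ BitStr h × F) {c₀ : F} (hc₀ : c₀ ≠ 0)
    {π : F →+ (Fin m → ZMod 2)} (hπ : Function.Surjective π)
    {Ext : BitStr n₁ → BitStr n₂ → BitStr m}
    (hExt : ∀ x y, Ext x y = toBits (π (c₀ * (e x).2 * (ι (e x).1 + κ y) ^ (2 ^ l - 1))))
    (hk : 0 < k) (hkl : 2 * k ≤ 2 ^ l) {k₁ k₂ Γ : ℝ} (hΓ : 0 ≤ Γ)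
    (hnum : 2 ^ (-k₁) * (2 : ℝ) ^ n₁ * ((2 * k * 2 ^ (-k₂)) ^ k + 2 ^ l / 2 ^ h) ≤ Γ ^ (2 * k)) :
    IsStrongTwoSourceExtractor Ext k₁ k₂ (1 / 2 * (2 ^ m * Γ)) := by
  have main : ∀ (X : PMF (BitStr n₁)) (Y : PMF (BitStr n₂)), IsSource X k₁ → IsSource Y k₂ →
      statDist ((indep X Y).map fun z => (Ext z.1 z.2, z.1)) (indep (unif m) X) ≤
        1 / 2 * (2 ^ m * Γ) ∧
      statDist ((indep X Y).map fun z => (Ext z.1 z.2, z.2)) (indep (unif m) Y) ≤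
        1 / 2 * (2 ^ m * Γ) := by
    intro X Y hX hY
    refine statDist_le_of_charSum hΓ fun τ hτ w hw => ?_
    -- This turns the bias `2 ^ l * |F|` into the fraction `2 ^ l / 2 ^ h` of all inputs.
    have hcard : (2 : ℝ) ^ n₁ = 2 ^ h * Fintype.card F := by
      have := Fintype.card_congr e
      simp only [Fintype.card_fun, Fintype.card_bool, Fintype.card_fin, Fintype.card_prod] at this
      exact_mod_cast this
    have := moment_bound (q := fun x => (X x).toReal) (cX := 2 ^ (-k₁))
      (fun x => ENNReal.toReal_nonneg) hX.apply_le (sum_toReal X) (by positivity)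
      (p := fun y => (Y y).toReal) (c := 2 ^ (-k₂)) (fun x => ENNReal.toReal_nonneg) hY.apply_le
      (by positivity) (sum_toReal Y) hw (f := fun x y => bitChar τ (Ext x y))
      (fun x y => bitChar_sq _ _) (k := k) (η := 2 ^ l * Fintype.card F) (by positivity)
      (fun S hS hc => by
        simp only [hExt]
        exact bias_le hι hκ e hc₀ hπ hτ hS (hc.trans hkl))
    refine le_of_pow_le_pow_left₀ (n := 2 * k) (by omega) hΓ (this.trans (le_trans (le_of_eq ?_) hnum))
    rw [show (Fintype.card (BitStr n₁) : ℝ) = 2 ^ n₁ by simp]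
    rw [mul_assoc, mul_add, hcard]
    field_simp
  exact ⟨fun X Y hX hY => statDist_le_first.trans (main X Y hX hY).1,
    fun X Y hX hY => (main X Y hX hY).1, fun X Y hX hY => (main X Y hX hY).2⟩

end RazExtractor

namespace RazExtractor

/-! ### The numerical estimate -/

-- With `q = n₁ / k₂`, the moment has exponent `4 q` and the entropy deficiency costs `2 ^ ((1/2 -
-- δ) n₁) / n₁ ^ 2`. The return term is about `2 ^ (-1.375 q k₂)`, which wins since `n₁ ≤ 1.5 q k₂`;
-- the bias term wins because the first half has about `n₁ / 2` bits. Each product is at most half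
-- of the target `2 ^ (-q δ k₂ + 16 q)`.
set_option maxHeartbeats 1000000 in
theorem raz_estimate {n₁ k₁ n₂ k₂ m l : ℕ} {δ lam : ℝ} (hk₂ : 0 < k₂)
    (hkn₂ : k₂ ≤ n₂) (hδ : 0 < δ) (hδ' : δ < 1 / 2) (hlam : 0.25 < lam)
    (hn : (n₂ : ℝ) ≤ (n₁ : ℝ) / 2) (hk₁ : (k₁ : ℝ) ≥ (1 / 2 + δ) * n₁ + 2 * Real.logb 2 n₁)
    (hmax : (k₂ : ℝ) ≥ max (3.2 * Real.logb 2 (8 * n₁ / k₂)) 40)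
    (hm : (m : ℝ) ≤ 1 / lam * (δ * k₂ / 16 - 1)) (hl : 2 ^ l ≤ n₁ + 1) :
    (2 : ℝ) ^ (-(k₁ : ℝ)) * (2 : ℝ) ^ n₁ *
      ((2 * ((2 * (n₁ / k₂) : ℕ) : ℝ) * 2 ^ (-(k₂ : ℝ))) ^ (2 * (n₁ / k₂)) +
        2 ^ l / 2 ^ (n₁ / 2)) ≤
      ((2 : ℝ) ^ (-(2 * lam * m + m / 2))) ^ (2 * (2 * (n₁ / k₂))) := by
  have h40 : (40 : ℝ) ≤ k₂ := (le_max_right _ _).trans hmax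
  have h32 : 3.2 * Real.logb 2 (8 * n₁ / k₂) ≤ (k₂ : ℝ) := (le_max_left _ _).trans hmax
  have hkn : (k₂ : ℝ) ≤ n₂ := by exact_mod_cast hkn₂
  have hn80 : (80 : ℝ) ≤ n₁ := by linarith
  have h2kn : 2 * k₂ ≤ n₁ := by
    have : (2 : ℝ) * k₂ ≤ n₁ := by linarith
    exact_mod_cast this
  set q := n₁ / k₂ with hq
  have hq2 : 2 ≤ q := (Nat.le_div_iff_mul_le hk₂).2 h2kn
  have hqn : (q : ℝ) * k₂ ≤ n₁ := by exact_mod_cast Nat.div_mul_le_self n₁ k₂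
  have hnq : (n₁ : ℝ) ≤ 1.5 * (q * k₂) := by
    have h1 : n₁ < (q + 1) * k₂ := by
      rw [mul_comm]; exact Nat.lt_mul_div_succ n₁ hk₂
    have h2 : (n₁ : ℝ) < (q + 1) * k₂ := by exact_mod_cast h1
    have h3 : (2 : ℝ) ≤ q := by exact_mod_cast hq2
    nlinarith
  have hq2' : (2 : ℝ) ≤ q := by exact_mod_cast hq2
  have hlam0 : 0 < lam := by linarith
  have hlm : lam * m ≤ δ * k₂ / 16 - 1 := by
    rwa [one_div, ← div_eq_inv_mul, le_div_iff₀ hlam0, mul_comm] at hm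
  -- `lam > 1/4` gives `m / 2 ≤ 2 * lam * m`, so the exponent is at most `4 * lam * m`.
  have hE : 2 * lam * m + m / 2 ≤ δ * k₂ / 4 - 4 := by
    have hm0 : (0 : ℝ) ≤ m := Nat.cast_nonneg m
    nlinarith
  have hB : (2 : ℝ) ^ (-(q * δ * k₂) + 16 * q) ≤
      ((2 : ℝ) ^ (-(2 * lam * m + m / 2))) ^ (2 * (2 * q)) := by
    rw [← Real.rpow_natCast, ← Real.rpow_mul (by norm_num)]
    refine Real.rpow_le_rpow_of_exponent_le (by norm_num) ?_
    push_cast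
    have := mul_le_mul_of_nonneg_right hE (by positivity : (0 : ℝ) ≤ 4 * q)
    linarith
  refine le_trans ?_ hB
  have hnpos : (0 : ℝ) < n₁ := by linarith
  have hA : (2 : ℝ) ^ (-(k₁ : ℝ)) * (2 : ℝ) ^ n₁ ≤ 2 ^ ((1 / 2 - δ) * n₁) / (n₁ : ℝ) ^ 2 := by
    have h1 : ((n₁ : ℝ)) ^ 2 = (2 : ℝ) ^ (2 * Real.logb 2 n₁) := by
      rw [mul_comm, Real.rpow_mul (by norm_num), Real.rpow_logb (by norm_num) (by norm_num) hnpos]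
      norm_cast
    rw [h1, ← Real.rpow_natCast, ← Real.rpow_add (by norm_num), ← Real.rpow_sub (by norm_num)]
    refine Real.rpow_le_rpow_of_exponent_le (by norm_num) ?_
    linarith
  have hsum : (0 : ℝ) ≤ (2 * ((2 * q : ℕ) : ℝ) * 2 ^ (-(k₂ : ℝ))) ^ (2 * q) +
        2 ^ l / 2 ^ (n₁ / 2) := by positivity
  refine (mul_le_mul_of_nonneg_right hA hsum).trans ?_
  rw [mul_add]
  have hn1 : (2 : ℝ) / n₁ ^ 2 ≤ 1 := by
    rw [div_le_one (by positivity)]; nlinarith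
  have hA' : (2 : ℝ) ^ ((1 / 2 - δ) * n₁) / (n₁ : ℝ) ^ 2 ≤ 2 ^ ((1 / 2 - δ) * n₁) / 2 := by
    gcongr
    nlinarith
  have p1 : (2 : ℝ) ^ ((1 / 2 - δ) * n₁) / (n₁ : ℝ) ^ 2 * (2 * ((2 * q : ℕ) : ℝ) * 2 ^ (-(k₂ : ℝ))) ^ (2 * q)
      ≤ 2 ^ (-(q * δ * k₂) + 16 * q) / 2 := by
    -- The constant 3.2 enters here: `4 q` is at most half of `8 n₁ / k₂`. The return term then has
    -- exponent `2 q (1/3.2 - 1) k₂ - 2 q`, and `2 (1 - 1/3.2) = 1.375`.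
    have h4q : (2 * ((2 * q : ℕ) : ℝ)) ≤ 2 ^ ((k₂ : ℝ) / 3.2 - 1) := by
      have hk0 : (0 : ℝ) < k₂ := by linarith
      have h1 : (4 * q : ℝ) ≤ (8 * n₁ / k₂) / 2 := by
        rw [le_div_iff₀ (by norm_num), le_div_iff₀ hk0]; nlinarith
      have h2 : (8 * n₁ / k₂ : ℝ) ≤ 2 ^ ((k₂ : ℝ) / 3.2) := by
        rw [← Real.logb_le_iff_le_rpow (by norm_num) (by positivity), le_div_iff₀ (by norm_num)]
        linarith
      rw [Real.rpow_sub (by norm_num), Real.rpow_one]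
      push_cast
      linarith
    have h5 : (2 * ((2 * q : ℕ) : ℝ) * 2 ^ (-(k₂ : ℝ))) ^ (2 * q) ≤
        2 ^ (((k₂ : ℝ) / 3.2 - 1 - k₂) * (2 * q)) := by
      calc _ ≤ ((2 : ℝ) ^ ((k₂ : ℝ) / 3.2 - 1) * 2 ^ (-(k₂ : ℝ))) ^ (2 * q) := by gcongr
        _ = _ := by
          rw [← Real.rpow_add (by norm_num), ← Real.rpow_natCast, ← Real.rpow_mul (by norm_num)]
          push_cast
          ring_nf
    refine (mul_le_mul hA' h5 (by positivity) (by positivity)).trans ?_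
    rw [div_mul_eq_mul_div, ← Real.rpow_add (by norm_num)]
    refine div_le_div_of_nonneg_right ?_ (by norm_num)
    refine Real.rpow_le_rpow_of_exponent_le (by norm_num) ?_
    have e1 : ((k₂ : ℝ) / 3.2 - 1 - k₂) * (2 * q) = -(1.375 * (q * k₂)) - 2 * q := by ring
    have e2 : (1 / 2 - δ) * n₁ ≤ 0.75 * (q * k₂) - 1.5 * (δ * (q * k₂)) := by
      have := mul_le_mul_of_nonneg_left hnq (by linarith : 0 ≤ 1 / 2 - δ)
      linarith
    have e3 : (0 : ℝ) ≤ q * k₂ := by positivity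
    have e4 : 0 ≤ δ * (q * k₂) := by positivity
    have e5 : q * δ * k₂ = δ * (q * k₂) := by ring
    rw [e1, e5]
    linarith
  have p2 : (2 : ℝ) ^ ((1 / 2 - δ) * n₁) / (n₁ : ℝ) ^ 2 * (2 ^ l / 2 ^ (n₁ / 2))
      ≤ 2 ^ (-(q * δ * k₂) + 16 * q) / 2 := by
    -- The factor `n₁ ^ 2`, gained from the logarithmic term in `k₁`, pays for the at most `n₁ + 1`
    -- exceptional roots.
    have hl' : (2 : ℝ) ^ l ≤ n₁ + 1 := by exact_mod_cast hl
    have hh : (2 : ℝ) ^ (((n₁ : ℝ) - 1) / 2) ≤ 2 ^ (n₁ / 2) := by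
      rw [← Real.rpow_natCast]
      refine Real.rpow_le_rpow_of_exponent_le (by norm_num) ?_
      have : n₁ ≤ 2 * (n₁ / 2) + 1 := by omega
      have : (n₁ : ℝ) ≤ 2 * ((n₁ / 2 : ℕ) : ℝ) + 1 := by exact_mod_cast this
      linarith
    calc _ ≤ (2 : ℝ) ^ ((1 / 2 - δ) * n₁) / (n₁ : ℝ) ^ 2 *
          ((n₁ + 1) / 2 ^ (((n₁ : ℝ) - 1) / 2)) := by gcongr
      _ = 2 ^ ((1 / 2 - δ) * n₁ - ((n₁ : ℝ) - 1) / 2) * ((n₁ + 1) / (n₁ : ℝ) ^ 2) := by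
          rw [Real.rpow_sub (by norm_num)]
          field_simp
      _ ≤ 2 ^ (-(q * δ * k₂) + 16 * q) * (1 / 2) := by
          have e1 : (n₁ + 1 : ℝ) / (n₁ : ℝ) ^ 2 ≤ 1 / 2 := by
            rw [div_le_div_iff₀ (by positivity) (by norm_num)]
            nlinarith
          have e2 : (1 / 2 - δ) * n₁ - ((n₁ : ℝ) - 1) / 2 ≤ -(q * δ * k₂) + 16 * q := by
            have := mul_le_mul_of_nonneg_left hqn hδ.le
            linarith
          exact mul_le_mul (Real.rpow_le_rpow_of_exponent_le (by norm_num) e2) e1 (by positivity)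
            (by positivity)
      _ = _ := by ring
  linarith

end RazExtractor

namespace RazExtractor

/-! ### Sums and products over the binary digits of a number -/

section Bits

/-- The cutoff `n` is harmless since `n < 2 ^ n`; `bsum_eq` replaces it by any bound on the number
of digits. Tower elements, transform points, linearized polynomials and the novel basis are all
built with these two operations. -/
def bsum {M : Type} [AddCommMonoid M] (f : ℕ → M) (n : ℕ) : M :=
  ∑ l ∈ Finset.range n, if n.testBit l then f l else 0

def bprod {M : Type} [CommMonoid M] (f : ℕ → M) (n : ℕ) : M :=
  ∏ l ∈ Finset.range n, if n.testBit l then f l else 1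

theorem bsum_eq {M : Type} [AddCommMonoid M] (f : ℕ → M) {n N : ℕ} (h : n < 2 ^ N) :
    bsum f n = ∑ l ∈ Finset.range N, if n.testBit l then f l else 0 := by
  have key : ∀ {A B : ℕ}, n < 2 ^ A → A ≤ B →
      ∑ l ∈ Finset.range B, (if n.testBit l then f l else 0) =
        ∑ l ∈ Finset.range A, if n.testBit l then f l else 0 := by
    intro A B hA hAB
    symm
    refine Finset.sum_subset (Finset.range_mono hAB) fun l _ hl => ?_
    rw [Finset.mem_range, not_lt] at hl
    rw [Nat.testBit_lt_two_pow (hA.trans_le (Nat.pow_le_pow_right (by norm_num) hl))]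
    simp
  rcases le_total n N with h' | h'
  · rw [key Nat.lt_two_pow_self h']; rfl
  · rw [← key h h']; rfl

@[simp] theorem bsum_zero {M : Type} [AddCommMonoid M] (f : ℕ → M) : bsum f 0 = 0 := rfl

@[simp] theorem bprod_zero {M : Type} [CommMonoid M] (f : ℕ → M) : bprod f 0 = 1 := rfl

theorem bsum_add_two_pow {M : Type} [AddCommMonoid M] (f : ℕ → M) {k i : ℕ} (h : k < 2 ^ i) :
    bsum f (k + 2 ^ i) = bsum f k + f i := by
  rw [bsum_eq f (show k + 2 ^ i < 2 ^ (i + 1) by rw [pow_succ]; omega), bsum_eq f h,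
    Finset.sum_range_succ]
  have hi : (k + 2 ^ i).testBit i = true := by
    rw [Nat.add_comm, Nat.testBit_two_pow_add_eq, Nat.testBit_lt_two_pow h]; rfl
  rw [hi, if_pos rfl]
  congr 1
  refine Finset.sum_congr rfl fun l hl => ?_
  rw [Nat.add_comm, Nat.testBit_two_pow_add_gt (Finset.mem_range.1 hl)]

theorem bprod_add_two_pow {M : Type} [CommMonoid M] (f : ℕ → M) {k i : ℕ} (h : k < 2 ^ i) :
    bprod f (k + 2 ^ i) = bprod f k * f i :=
  bsum_add_two_pow (M := Additive M) f h

theorem bsum_two_pow {M : Type} [AddCommMonoid M] (f : ℕ → M) (i : ℕ) : bsum f (2 ^ i) = f i := by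
  have := bsum_add_two_pow f (k := 0) (i := i) (by positivity)
  simpa using this

theorem bsum_shiftLeft {M : Type} [AddCommMonoid M] (f : ℕ → M) (k i : ℕ) :
    bsum f (k * 2 ^ i) = bsum (fun l => f (l + i)) k := by
  obtain ⟨N, hN⟩ : ∃ N, k < 2 ^ N := ⟨k, Nat.lt_two_pow_self⟩
  rw [bsum_eq f (show k * 2 ^ i < 2 ^ (i + N) by
    rw [pow_add, mul_comm]; exact Nat.mul_lt_mul_of_pos_left hN (by positivity)), bsum_eq _ hN,
    Finset.sum_range_add]
  rw [Finset.sum_eq_zero, zero_add]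
  · refine Finset.sum_congr rfl fun l _ => ?_
    rw [Nat.testBit_mul_two_pow]
    simp [Nat.add_comm]
  · intro l hl
    rw [Finset.mem_range] at hl
    rw [Nat.testBit_mul_two_pow]
    simp [Nat.not_le.2 hl]

theorem bsum_xor {M : Type} [AddCommMonoid M] (hM : ∀ x : M, x + x = 0) (f : ℕ → M) (a b : ℕ) :
    bsum f (a ^^^ b) = bsum f a + bsum f b := by
  obtain ⟨N, hN⟩ : ∃ N, max a b < 2 ^ N := ⟨max a b, Nat.lt_two_pow_self⟩
  have ha : a < 2 ^ N := (le_max_left _ _).trans_lt hN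
  have hb : b < 2 ^ N := (le_max_right _ _).trans_lt hN
  rw [bsum_eq f (Nat.xor_lt_two_pow ha hb), bsum_eq f ha, bsum_eq f hb, ← Finset.sum_add_distrib]
  refine Finset.sum_congr rfl fun l _ => ?_
  rw [Nat.testBit_xor]
  cases a.testBit l <;> cases b.testBit l <;> simp [hM]

end Bits

/-! ### The quadratic tower in characteristic two -/

section Tower
set_option linter.unusedSectionVars false
variable (K : Type) [Field K] [CharP K 2] [IsAlgClosed K]

theorem exists_artinSchreier (c : K) : ∃ x : K, x ^ 2 + x = c := by
  obtain ⟨x, hx⟩ := IsAlgClosed.exists_root (Polynomial.X ^ 2 + Polynomial.X - Polynomial.C c)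
    (by
      have : (Polynomial.X ^ 2 + Polynomial.X - Polynomial.C c : Polynomial K).degree = 2 := by
        compute_degree!
      rw [this]; norm_num)
  refine ⟨x, ?_⟩
  simpa [Polynomial.IsRoot.def, sub_eq_zero] using hx

/-- The product of the first `i` generators of the tower. -/
noncomputable def towerT : ℕ → K
  | 0 => 1
  | i + 1 => towerT i * Classical.choose (exists_artinSchreier K (towerT i))

/-- The generators of the tower. -/
noncomputable def towerX (i : ℕ) : K := Classical.choose (exists_artinSchreier K (towerT K i))

theorem towerX_sq_add (i : ℕ) : towerX K i ^ 2 + towerX K i = towerT K i :=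
  Classical.choose_spec (exists_artinSchreier K (towerT K i))

theorem towerT_succ (i : ℕ) : towerT K (i + 1) = towerT K i * towerX K i := rfl

theorem char_two_add_self (x : K) : x + x = 0 := CharTwo.add_self_eq_zero x

/-- The element of the tower with digits `n`. -/
noncomputable def word (n : ℕ) : K := bsum (bprod (towerX K)) n

theorem word_xor (a b : ℕ) : word K (a ^^^ b) = word K a + word K b :=
  bsum_xor (fun x => CharTwo.add_self_eq_zero x) _ a b

theorem word_zero : word K 0 = 0 := rfl

theorem word_one : word K 1 = 1 := by
  have := bsum_two_pow (bprod (towerX K)) 0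
  simpa [word] using this

theorem bprod_two_pow_sub_one (i : ℕ) : bprod (towerX K) (2 ^ i - 1) = towerT K i := by
  induction i with
  | zero => simp [towerT]
  | succ i ih =>
    rw [towerT_succ, ← ih, ← bprod_add_two_pow _ (show 2 ^ i - 1 < 2 ^ i by
      have := Nat.one_le_two_pow (n := i); omega)]
    congr 1
    have := Nat.one_le_two_pow (n := i)
    rw [pow_succ]; omega

theorem word_top (i : ℕ) : word K (2 ^ (2 ^ i - 1)) = towerT K i := by
  rw [word, bsum_two_pow, bprod_two_pow_sub_one]

/-- Digit positions below `2 ^ i` use only the generators below `i`; a shift by `2 ^ i` adjoins the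
generator `i` to each of their products. -/
theorem word_mul_pow {i a : ℕ} (ha : a < 2 ^ 2 ^ i) :
    word K (a * 2 ^ 2 ^ i) = towerX K i * word K a := by
  rw [word, bsum_shiftLeft, bsum_eq _ ha, word, bsum_eq _ ha, Finset.mul_sum]
  refine Finset.sum_congr rfl fun l hl => ?_
  rw [bprod_add_two_pow _ (Finset.mem_range.1 hl)]
  split_ifs <;> ring

theorem xor_mul_two_pow {a b n : ℕ} (ha : a < 2 ^ n) : a ^^^ (b * 2 ^ n) = a + b * 2 ^ n := by
  rw [mul_comm, Nat.add_comm, Nat.two_pow_add_eq_or_of_lt ha]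
  refine Nat.eq_of_testBit_eq fun i => ?_
  rw [Nat.testBit_xor, Nat.testBit_or, Nat.testBit_two_pow_mul]
  by_cases h : i < n
  · simp [Nat.not_le.2 h]
  · rw [Nat.testBit_lt_two_pow (ha.trans_le (Nat.pow_le_pow_right (by norm_num) (not_lt.1 h)))]
    simp

theorem word_split {i : ℕ} (a : ℕ) (ha : a < 2 ^ 2 ^ (i + 1)) :
    word K a = word K (a % 2 ^ 2 ^ i) + towerX K i * word K (a / 2 ^ 2 ^ i) := by
  have h1 : a / 2 ^ 2 ^ i < 2 ^ 2 ^ i := by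
    rw [Nat.div_lt_iff_lt_mul (by positivity), ← pow_add, ← two_mul, ← pow_succ']
    exact ha
  rw [← word_mul_pow K h1, ← word_xor, xor_mul_two_pow (Nat.mod_lt _ (by positivity))]
  congr 1
  rw [mul_comm]
  exact (Nat.mod_add_div _ _).symm

theorem sq_pow_add (y : K) (a b : ℕ) : y ^ 2 ^ (a + b) = (y ^ 2 ^ a) ^ 2 ^ b := by
  rw [pow_add, pow_mul]

/-- Iterate `x ^ 2 = x + T`, using that squaring is additive. -/
theorem towerX_pow (i k : ℕ) :
    towerX K i ^ 2 ^ k = towerX K i + ∑ l ∈ Finset.range k, towerT K i ^ 2 ^ l := by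
  induction k with
  | zero => simp
  | succ k ih =>
    have h : towerX K i ^ 2 = towerX K i + towerT K i := by
      rw [← towerX_sq_add, add_left_comm, CharTwo.add_self_eq_zero, add_zero]
    rw [add_comm k 1, sq_pow_add, pow_one, h, add_pow_char_pow, ih, add_comm 1 k,
      Finset.sum_range_succ, add_assoc]

/-- Write `T i`, `x i` for `towerT K i`, `towerX K i`. The third part says that `T i` has trace one,
so the `2 ^ i`-fold Frobenius moves `x i` to the other root of its equation: the extension is truly
quadratic. Trace one is inherited, because this Frobenius sends `T (i + 1)` to `T (i + 1) + T i`, so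
that the trace of `T (i + 1)` pairs up into that of `T i`. -/
theorem tower_frobenius (i : ℕ) : towerT K i ^ 2 ^ 2 ^ i = towerT K i ∧
    towerX K i ^ 2 ^ 2 ^ i = towerX K i + 1 ∧
    ∑ l ∈ Finset.range (2 ^ i), towerT K i ^ 2 ^ l = 1 := by
  have step : ∀ i, ∑ l ∈ Finset.range (2 ^ i), towerT K i ^ 2 ^ l = 1 →
      towerX K i ^ 2 ^ 2 ^ i = towerX K i + 1 := fun i h => by rw [towerX_pow, h]
  induction i with
  | zero =>
    have h : ∑ l ∈ Finset.range (2 ^ 0), towerT K 0 ^ 2 ^ l = 1 := by simp [towerT]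
    exact ⟨by simp [towerT], step 0 h, h⟩
  | succ i ih =>
    obtain ⟨h1, h2, h3⟩ := ih
    have hT : towerT K (i + 1) ^ 2 ^ 2 ^ i = towerT K (i + 1) + towerT K i := by
      rw [towerT_succ, mul_pow, h1, h2]; ring
    have h : ∑ l ∈ Finset.range (2 ^ (i + 1)), towerT K (i + 1) ^ 2 ^ l = 1 := by
      rw [pow_succ, mul_two, Finset.sum_range_add, ← Finset.sum_add_distrib, ← h3]
      refine Finset.sum_congr rfl fun l _ => ?_
      rw [sq_pow_add, hT, add_pow_char_pow, ← add_assoc, CharTwo.add_self_eq_zero, zero_add]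
    refine ⟨?_, step _ h, h⟩
    rw [pow_succ 2 i, mul_two, sq_pow_add, hT, add_pow_char_pow, hT, h1, add_assoc,
      CharTwo.add_self_eq_zero, add_zero]

theorem word_pow_card {i a : ℕ} (ha : a < 2 ^ 2 ^ i) : word K a ^ 2 ^ 2 ^ i = word K a := by
  induction i generalizing a with
  | zero =>
    have : a = 0 ∨ a = 1 := by norm_num at ha; omega
    rcases this with rfl | rfl
    · simp [word_zero]
    · simp [word_one]
  | succ i ih =>
    have h1 : a / 2 ^ 2 ^ i < 2 ^ 2 ^ i := by
      rw [Nat.div_lt_iff_lt_mul (by positivity), ← pow_add, ← two_mul, ← pow_succ']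
      exact ha
    have h0 : a % 2 ^ 2 ^ i < 2 ^ 2 ^ i := Nat.mod_lt _ (by positivity)
    have hX := (tower_frobenius K i).2.1
    rw [word_split K a ha, pow_succ 2 i, mul_two, sq_pow_add, add_pow_char_pow, mul_pow, ih h0,
      ih h1, hX, add_pow_char_pow, mul_pow, add_pow_char_pow, ih h0, ih h1, hX, one_pow, add_assoc,
      CharTwo.add_self_eq_zero, add_zero]

/-- If the upper half were nonzero, the generator would be a quotient of elements fixed by the `2 ^
i`-fold Frobenius, which however adds 1 to it. -/
theorem word_eq_zero {i a : ℕ} (ha : a < 2 ^ 2 ^ i) (h : word K a = 0) : a = 0 := by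
  induction i generalizing a with
  | zero =>
    have : a = 0 ∨ a = 1 := by norm_num at ha; omega
    rcases this with rfl | rfl
    · rfl
    · simp [word_one] at h
  | succ i ih =>
    have h1 : a / 2 ^ 2 ^ i < 2 ^ 2 ^ i := by
      rw [Nat.div_lt_iff_lt_mul (by positivity), ← pow_add, ← two_mul, ← pow_succ']
      exact ha
    have h0 : a % 2 ^ 2 ^ i < 2 ^ 2 ^ i := Nat.mod_lt _ (by positivity)
    rw [word_split K a ha] at h
    have hw1 : word K (a / 2 ^ 2 ^ i) = 0 := by
      by_contra hne
      have hx : towerX K i = word K (a % 2 ^ 2 ^ i) / word K (a / 2 ^ 2 ^ i) := by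
        rw [eq_div_iff hne]
        exact (CharTwo.add_eq_zero.1 h).symm
      have hf := (tower_frobenius K i).2.1
      rw [hx, div_pow, word_pow_card K h0, word_pow_card K h1] at hf
      exact one_ne_zero (left_eq_add.1 hf)
    rw [hw1, mul_zero, add_zero] at h
    have e1 := ih h1 hw1
    have e0 := ih h0 h
    have := Nat.mod_add_div a (2 ^ 2 ^ i)
    rw [e0, e1] at this
    simpa using this.symm

theorem word_injOn {i a b : ℕ} (ha : a < 2 ^ 2 ^ i) (hb : b < 2 ^ 2 ^ i)
    (h : word K a = word K b) : a = b := by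
  have h1 : word K (a ^^^ b) = 0 := by rw [word_xor, h, CharTwo.add_self_eq_zero]
  exact Nat.xor_eq_zero_iff.1 (word_eq_zero K (Nat.xor_lt_two_pow ha hb) h1)

/-- One step of the recursive multiplication of words, with halves of size `sz`. -/
def nimStep (m : ℕ → ℕ → ℕ) (sz a b : ℕ) : ℕ :=
  (m (a % sz) (b % sz) ^^^ m (m (a / sz) (b / sz)) (sz / 2)) ^^^
    ((m (a % sz) (b / sz) ^^^ m (a / sz) (b % sz)) ^^^ m (a / sz) (b / sz)) * sz

/-- `m` multiplies words of `2 ^ i` bits. -/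
def IsWordMul (i : ℕ) (m : ℕ → ℕ → ℕ) : Prop :=
  ∀ a < 2 ^ 2 ^ i, ∀ b < 2 ^ 2 ^ i, m a b < 2 ^ 2 ^ i ∧ word K (m a b) = word K a * word K b

/-- Multiply `a₀ + a₁ x` and `b₀ + b₁ x` with `x ^ 2 = x + T`. The word of `T` has the single digit
`2 ^ i - 1`, so it is half of the block size: hence `sz / 2`. -/
theorem IsWordMul.nimStep {i : ℕ} {m : ℕ → ℕ → ℕ} (hm : IsWordMul K i m) :
    IsWordMul K (i + 1) (nimStep m (2 ^ 2 ^ i)) := by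
  intro a ha b hb
  have a1 : a / 2 ^ 2 ^ i < 2 ^ 2 ^ i := by
    rw [Nat.div_lt_iff_lt_mul (by positivity), ← pow_add, ← two_mul, ← pow_succ']
    exact ha
  have a0 : a % 2 ^ 2 ^ i < 2 ^ 2 ^ i := Nat.mod_lt _ (by positivity)
  have b1 : b / 2 ^ 2 ^ i < 2 ^ 2 ^ i := by
    rw [Nat.div_lt_iff_lt_mul (by positivity), ← pow_add, ← two_mul, ← pow_succ']
    exact hb
  have b0 : b % 2 ^ 2 ^ i < 2 ^ 2 ^ i := Nat.mod_lt _ (by positivity)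
  have ht : 2 ^ 2 ^ i / 2 = 2 ^ (2 ^ i - 1) := by
    obtain ⟨e, he⟩ := Nat.exists_eq_succ_of_ne_zero (Nat.two_pow_pos i).ne'
    rw [he, Nat.succ_eq_add_one, pow_succ]; simp
  have ht' : 2 ^ 2 ^ i / 2 < 2 ^ 2 ^ i := Nat.div_lt_self (by positivity) (by norm_num)
  obtain ⟨lp, vp⟩ := hm _ a1 _ b1
  obtain ⟨lt, vt⟩ := hm _ lp _ ht'
  obtain ⟨l00, v00⟩ := hm _ a0 _ b0
  obtain ⟨l01, v01⟩ := hm _ a0 _ b1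
  obtain ⟨l10, v10⟩ := hm _ a1 _ b0
  have hlo := Nat.xor_lt_two_pow l00 lt
  have hhi := Nat.xor_lt_two_pow (Nat.xor_lt_two_pow l01 l10) lp
  constructor
  · rw [RazExtractor.nimStep]
    rw [xor_mul_two_pow hlo, pow_succ 2 i, mul_two, pow_add]
    nlinarith
  · rw [RazExtractor.nimStep, word_xor, word_mul_pow K hhi]
    simp only [word_xor, vp, vt, v00, v01, v10]
    rw [ht, word_top, word_split K a ha, word_split K b hb, ← towerX_sq_add]
    have h2 := char_two_add_self K
      (towerX K i * word K (a / 2 ^ 2 ^ i) * word K (b / 2 ^ 2 ^ i))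
    linear_combination h2

/-- The map `x ↦ x ^ 2 + x`. -/
def wp (x : K) : K := x ^ 2 + x

/-- The map is `φ + 1` with `φ` the Frobenius, and `(φ + 1) ^ 2 ^ i = φ ^ 2 ^ i + 1` in
characteristic two. -/
theorem wp_iterate_two_pow (i : ℕ) (y : K) : (wp K)^[2 ^ i] y = y ^ 2 ^ 2 ^ i + y := by
  induction i generalizing y with
  | zero => simp [wp]
  | succ i ih =>
    have h : (y ^ 2 ^ 2 ^ i + y) ^ 2 ^ 2 ^ i = y ^ 2 ^ (2 ^ i + 2 ^ i) + y ^ 2 ^ 2 ^ i := by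
      rw [add_pow_char_pow, ← sq_pow_add]
    rw [pow_succ, mul_two, Function.iterate_add_apply, ih, ih, h, add_assoc,
      ← add_assoc (y ^ 2 ^ 2 ^ i), CharTwo.add_self_eq_zero (y ^ 2 ^ 2 ^ i), zero_add]

/-- The Cantor basis below `towerT K j`. -/
noncomputable def cantor (j i : ℕ) : K := (wp K)^[2 ^ j - 1 - i] (towerT K j)

theorem cantor_top (j : ℕ) : cantor K j (2 ^ j - 1) = towerT K j := by simp [cantor]

/-- By `tower_frobenius`, `2 ^ j` applications of the map lead from `towerT K (j + 1)` to `towerT K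
j`; descending through all levels ends at 1. -/
theorem cantor_zero (j : ℕ) : cantor K j 0 = 1 := by
  rw [cantor, Nat.sub_zero]
  induction j with
  | zero => simp [towerT]
  | succ j ih =>
    have h : 2 ^ (j + 1) - 1 = (2 ^ j - 1) + 2 ^ j := by
      have := Nat.one_le_two_pow (n := j); rw [pow_succ]; omega
    rw [h, Function.iterate_add_apply, wp_iterate_two_pow, towerT_succ, mul_pow,
      (tower_frobenius K j).1, (tower_frobenius K j).2.1, mul_add, mul_one, add_right_comm,
      CharTwo.add_self_eq_zero, zero_add, ih]

theorem cantor_succ {j i : ℕ} (h : i + 1 < 2 ^ j) :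
    cantor K j (i + 1) ^ 2 + cantor K j (i + 1) = cantor K j i := by
  have : 2 ^ j - 1 - i = (2 ^ j - 1 - (i + 1)) + 1 := by omega
  rw [cantor, cantor, this, Function.iterate_succ_apply']
  rfl

end Tower
end RazExtractor

namespace RazExtractor

/-! ### The additive Fourier transform over a Cantor basis -/

section FFT
set_option linter.unusedSectionVars false
open Polynomial
variable (K : Type) [Field K] [CharP K 2] [Algebra (ZMod 2) K]

/-- Iterates of `X ^ 2 + X`. -/
noncomputable def sub : ℕ → (ZMod 2)[X]
  | 0 => X
  | i + 1 => sub i ^ 2 + sub i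

/-- The novel polynomial basis. -/
noncomputable def novel (k : ℕ) : (ZMod 2)[X] := bprod sub k

theorem novel_zero : novel 0 = 1 := rfl

theorem novel_add {k i : ℕ} (h : k < 2 ^ i) : novel (k + 2 ^ i) = novel k * sub i :=
  bprod_add_two_pow _ h

theorem sub_monic_natDegree (i : ℕ) : (sub i).Monic ∧ (sub i).natDegree = 2 ^ i := by
  induction i with
  | zero => exact ⟨monic_X, natDegree_X⟩
  | succ i ih =>
    obtain ⟨h1, h2⟩ := ih
    have hm : (sub i ^ 2).Monic := h1.pow 2
    have hd : (sub i ^ 2).natDegree = 2 ^ (i + 1) := by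
      rw [h1.natDegree_pow, h2, pow_succ']
    have hlt : (sub i).degree < (sub i ^ 2).degree := by
      rw [degree_eq_natDegree h1.ne_zero, degree_eq_natDegree hm.ne_zero, hd, h2]
      exact_mod_cast Nat.pow_lt_pow_right (by norm_num) (Nat.lt_succ_self i)
    exact ⟨hm.add_of_left hlt, by
      rw [sub, natDegree_add_eq_left_of_degree_lt hlt, hd]⟩

/-- The degrees `2 ^ i` of the factors add up to `k` along its binary digits. -/
theorem novel_monic_natDegree (k : ℕ) : (novel k).Monic ∧ (novel k).natDegree = k := by
  induction k using Nat.strong_induction_on with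
  | _ k ih =>
    rcases Nat.eq_zero_or_pos k with rfl | hk
    · exact ⟨monic_one, natDegree_one⟩
    · set i := Nat.log 2 k with hi
      have h1 : 2 ^ i ≤ k := Nat.pow_log_le_self 2 hk.ne'
      have h2 : k < 2 ^ (i + 1) := Nat.lt_pow_succ_log_self (by norm_num) k
      have h3 : k - 2 ^ i < 2 ^ i := by rw [pow_succ] at h2; omega
      have h4 : k = (k - 2 ^ i) + 2 ^ i := by omega
      obtain ⟨m1, d1⟩ := ih (k - 2 ^ i) (by have := Nat.two_pow_pos i; omega)
      obtain ⟨m2, d2⟩ := sub_monic_natDegree i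
      rw [h4, novel_add h3]
      exact ⟨m1.mul m2, by rw [m1.natDegree_mul m2, d1, d2]⟩

/-- Every polynomial of degree `< n` is a combination of the first `n` basis polynomials. -/
theorem exists_novel_coeffs (n : ℕ) (R : (ZMod 2)[X]) (hR : R.degree < n) :
    ∃ c : ℕ → ZMod 2, (∀ t, n ≤ t → c t = 0) ∧ ∀ N, n ≤ N → R = ∑ t ∈ Finset.range N, C (c t) * novel t := by
  induction n generalizing R with
  | zero =>
    have : R = 0 := by
      rw [← degree_eq_bot]; exact (Nat.WithBot.lt_zero_iff).1 (by simpa using hR)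
    exact ⟨0, fun _ _ => rfl, fun N _ => by simp [this]⟩
  | succ n ih =>
    obtain ⟨m, d⟩ := novel_monic_natDegree n
    have h1 : (R - C (R.coeff n) * novel n).degree < n := by
      rw [degree_lt_iff_coeff_zero]
      intro k hk
      rcases hk.eq_or_lt with rfl | hk
      · have : (novel n).coeff n = 1 := by rw [Monic, leadingCoeff, d] at m; exact m
        simp [this]
      · rw [coeff_sub, coeff_C_mul, (degree_lt_iff_coeff_zero _ _).1 hR k hk,
          coeff_eq_zero_of_natDegree_lt (p := novel n) (by rw [d]; exact hk)]
        simp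
    obtain ⟨c, hc, hs⟩ := ih _ h1
    refine ⟨Function.update c n (R.coeff n), fun t ht => ?_, fun N hN => ?_⟩
    · rw [Function.update_of_ne (by omega), hc t (by omega)]
    · have h2 := hs N (by omega)
      rw [← Finset.add_sum_erase _ _ (Finset.mem_range.2 (show n < N by omega))] at h2 ⊢
      rw [hc n le_rfl, C_0, zero_mul, zero_add] at h2
      rw [Function.update_self]
      have h3 : ∑ t ∈ (Finset.range N).erase n, C (Function.update c n (R.coeff n) t) * novel t =
          ∑ t ∈ (Finset.range N).erase n, C (c t) * novel t :=
        Finset.sum_congr rfl fun t ht => by rw [Function.update_of_ne (Finset.ne_of_mem_erase ht)]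
      rw [h3, ← h2]
      ring

theorem novel_sum_degree_lt {n : ℕ} (c : ℕ → ZMod 2) :
    (∑ t ∈ Finset.range n, C (c t) * novel t).degree < n := by
  refine (degree_lt_iff_coeff_zero _ _).2 fun k hk => ?_
  rw [finsetSum_coeff]
  refine Finset.sum_eq_zero fun t ht => ?_
  rw [Finset.mem_range] at ht
  rw [coeff_C_mul, coeff_eq_zero_of_natDegree_lt (by rw [(novel_monic_natDegree t).2]; omega),
    mul_zero]

theorem aeval_sub (i : ℕ) (u : K) : aeval u (sub i) = (wp K)^[i] u := by
  induction i with
  | zero => simp [sub]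
  | succ i ih => rw [Function.iterate_succ_apply', ← ih, sub, map_add, map_pow]; rfl

theorem wp_add (x y : K) : wp K (x + y) = wp K x + wp K y := by
  rw [wp, wp, wp, CharTwo.add_sq]; ring

variable {K}
variable {β : ℕ → K} {L : ℕ}

/-- The points of the transform. -/
def pt (β : ℕ → K) (k : ℕ) : K := bsum β k

/-- `wp` is additive, kills `β 0 = 1` and lowers every other index by one: on the indices of points
it is division by two. -/
theorem wp_pt (h0 : β 0 = 1) (hβ : ∀ i < L, β (i + 1) ^ 2 + β (i + 1) = β i) {k : ℕ}
    (hk : k < 2 ^ (L + 1)) : wp K (pt β k) = pt β (k / 2) := by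
  have hk2 : k / 2 < 2 ^ L := by rw [pow_succ] at hk; omega
  rw [pt, pt, bsum_eq β hk, bsum_eq β hk2, Finset.sum_range_succ']
  have hw : ∀ (f : ℕ → K) (n : ℕ), wp K (∑ l ∈ Finset.range n, f l) =
      ∑ l ∈ Finset.range n, wp K (f l) := by
    intro f n
    induction n with
    | zero => simp [wp]
    | succ n ih => rw [Finset.sum_range_succ, wp_add, ih, Finset.sum_range_succ]
  rw [wp_add, hw]
  have : wp K (if k.testBit 0 then β 0 else 0) = 0 := by
    split_ifs
    · rw [h0, wp, one_pow, CharTwo.add_self_eq_zero]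
    · simp [wp]
  rw [this, add_zero]
  refine Finset.sum_congr rfl fun l hl => ?_
  rw [Nat.testBit_succ]
  split_ifs
  · exact hβ l (Finset.mem_range.1 hl)
  · simp [wp]

/-- The twiddle factors are therefore again points, and one table of points serves all levels. -/
theorem aeval_pt_sub (h0 : β 0 = 1) (hβ : ∀ i < L, β (i + 1) ^ 2 + β (i + 1) = β i) {k : ℕ}
    (hk : k < 2 ^ (L + 1)) (i : ℕ) : aeval (pt β k) (sub i) = pt β (k / 2 ^ i) := by
  rw [aeval_sub]
  induction i with
  | zero => simp
  | succ i ih =>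
    rw [Function.iterate_succ_apply', ih, wp_pt h0 hβ ((Nat.div_le_self _ _).trans_lt hk),
      Nat.div_div_eq_div_mul, pow_succ]

theorem pt_two_mul_add_one (h0 : β 0 = 1) (b : ℕ) : pt β (2 * b + 1) = pt β (2 * b) + 1 := by
  have h : 2 * b + 1 = (2 * b) ^^^ 1 := by
    have := xor_mul_two_pow (a := 1) (b := b) (n := 1) (by norm_num)
    rw [pow_one] at this
    rw [Nat.xor_comm, mul_comm 2 b]
    omega
  rw [h, pt, bsum_xor (fun x => CharTwo.add_self_eq_zero x)]
  congr 1
  have := bsum_two_pow β 0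
  rw [pow_zero] at this
  rw [this, h0]

/-- The lower index of the butterfly containing `k` at level `i`. -/
def lowIdx (i k : ℕ) : ℕ := k / 2 ^ (i + 1) * 2 ^ (i + 1) + k % 2 ^ i

theorem block_div {i b t : ℕ} (ht : t < 2 ^ i) :
    (b * 2 ^ (i + 1) + t) / 2 ^ i = 2 * b ∧ (b * 2 ^ (i + 1) + t + 2 ^ i) / 2 ^ i = 2 * b + 1 ∧
    (b * 2 ^ (i + 1) + t) / 2 ^ (i + 1) = b ∧ (b * 2 ^ (i + 1) + t + 2 ^ i) / 2 ^ (i + 1) = b ∧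
    (b * 2 ^ (i + 1) + t) % 2 ^ i = t ∧ (b * 2 ^ (i + 1) + t + 2 ^ i) % 2 ^ i = t := by
  have hp := Nat.two_pow_pos i
  have e : b * 2 ^ (i + 1) = 2 * b * 2 ^ i := by rw [pow_succ]; ring
  have e' : 2 ^ (i + 1) = 2 * 2 ^ i := by rw [pow_succ]; ring
  have h1 : (2 * b * 2 ^ i + t) / 2 ^ i = 2 * b := by
    rw [Nat.add_comm, Nat.add_mul_div_right _ _ hp, Nat.div_eq_of_lt ht, zero_add]
  have h2 : (2 * b * 2 ^ i + t + 2 ^ i) / 2 ^ i = 2 * b + 1 := by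
    rw [Nat.add_div_right _ hp, h1]
  refine ⟨by rw [e, h1], by rw [e, h2], ?_, ?_, ?_, ?_⟩
  · rw [pow_succ, ← Nat.div_div_eq_div_mul, ← pow_succ, e, h1]; omega
  · rw [pow_succ, ← Nat.div_div_eq_div_mul, ← pow_succ, e, h2]; omega
  · rw [e, Nat.mul_add_mod_of_lt ht]
  · rw [Nat.add_mod_right, e, Nat.mul_add_mod_of_lt ht]

theorem mod_two_pow_succ_cases (i k : ℕ) :
    (k / 2 ^ i % 2 = 0 ∧ k = lowIdx i k) ∨ (k / 2 ^ i % 2 = 1 ∧ k = lowIdx i k + 2 ^ i) := by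
  have h1 : k / 2 ^ (i + 1) = k / 2 ^ i / 2 := by rw [pow_succ, Nat.div_div_eq_div_mul]
  have h2 := Nat.div_add_mod k (2 ^ i)
  have h3 := Nat.div_add_mod (k / 2 ^ i) 2
  have h4 : lowIdx i k = 2 ^ i * (2 * (k / 2 ^ i / 2)) + k % 2 ^ i := by
    rw [lowIdx, h1, pow_succ]; ring
  rcases Nat.mod_two_eq_zero_or_one (k / 2 ^ i) with h | h
  · left
    refine ⟨h, ?_⟩
    rw [h4, show 2 * (k / 2 ^ i / 2) = k / 2 ^ i by omega, h2]
  · right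
    refine ⟨h, ?_⟩
    have h5 : k / 2 ^ i = 2 * (k / 2 ^ i / 2) + 1 := by omega
    have h6 : 2 ^ i * (k / 2 ^ i) = 2 ^ i * (2 * (k / 2 ^ i / 2)) + 2 ^ i := by
      conv_lhs => rw [h5]
      ring
    omega

/-- One level of the forward transform. -/
def fwdStep (β : ℕ → K) (i : ℕ) (g : ℕ → K) (k : ℕ) : K :=
  g (lowIdx i k) + pt β (k / 2 ^ i) * g (lowIdx i k + 2 ^ i)

/-- One level of the inverse transform. -/
def invStep (β : ℕ → K) (i : ℕ) (g : ℕ → K) (k : ℕ) : K :=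
  if k / 2 ^ i % 2 = 0 then
    g (lowIdx i k) + pt β (k / 2 ^ i) * (g (lowIdx i k) + g (lowIdx i k + 2 ^ i))
  else g (lowIdx i k) + g (lowIdx i k + 2 ^ i)

theorem lowIdx_low {i b t : ℕ} (ht : t < 2 ^ i) :
    lowIdx i (b * 2 ^ (i + 1) + t) = b * 2 ^ (i + 1) + t := by
  obtain ⟨-, -, h, -, h', -⟩ := block_div (b := b) ht
  rw [lowIdx, h, h']

theorem lowIdx_high {i b t : ℕ} (ht : t < 2 ^ i) :
    lowIdx i (b * 2 ^ (i + 1) + t + 2 ^ i) = b * 2 ^ (i + 1) + t := by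
  obtain ⟨-, -, -, h, -, h'⟩ := block_div (b := b) ht
  rw [lowIdx, h, h']

/-- The two twiddle factors of a butterfly differ by 1, so it needs a single multiplication. -/
theorem fwdStep_pair (h0 : β 0 = 1) (g : ℕ → K) {i b t : ℕ} (ht : t < 2 ^ i) :
    fwdStep β i g (b * 2 ^ (i + 1) + t) =
      g (b * 2 ^ (i + 1) + t) + pt β (2 * b) * g (b * 2 ^ (i + 1) + t + 2 ^ i) ∧
    fwdStep β i g (b * 2 ^ (i + 1) + t + 2 ^ i) =
      fwdStep β i g (b * 2 ^ (i + 1) + t) + g (b * 2 ^ (i + 1) + t + 2 ^ i) := by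
  obtain ⟨h1, h2, -⟩ := block_div (b := b) ht
  simp only [fwdStep, lowIdx_low ht, lowIdx_high ht, h1, h2, pt_two_mul_add_one h0, true_and]
  ring

theorem invStep_pair (g : ℕ → K) {i b t : ℕ} (ht : t < 2 ^ i) :
    invStep β i g (b * 2 ^ (i + 1) + t) = g (b * 2 ^ (i + 1) + t) +
      pt β (2 * b) * (g (b * 2 ^ (i + 1) + t) + g (b * 2 ^ (i + 1) + t + 2 ^ i)) ∧
    invStep β i g (b * 2 ^ (i + 1) + t + 2 ^ i) =
      g (b * 2 ^ (i + 1) + t) + g (b * 2 ^ (i + 1) + t + 2 ^ i) := by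
  obtain ⟨h1, h2, -⟩ := block_div (b := b) ht
  simp only [invStep, lowIdx_low ht, lowIdx_high ht, h1, h2]
  simp

theorem exists_block (i k : ℕ) : ∃ b t, t < 2 ^ i ∧
    (k = b * 2 ^ (i + 1) + t ∨ k = b * 2 ^ (i + 1) + t + 2 ^ i) := by
  refine ⟨k / 2 ^ (i + 1), k % 2 ^ i, Nat.mod_lt _ (Nat.two_pow_pos i), ?_⟩
  rcases mod_two_pow_succ_cases i k with ⟨-, h⟩ | ⟨-, h⟩
  · exact Or.inl h
  · exact Or.inr h

theorem invStep_fwdStep (h0 : β 0 = 1) (i : ℕ) (g : ℕ → K) :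
    invStep β i (fwdStep β i g) = g := by
  funext k
  obtain ⟨b, t, ht, rfl | rfl⟩ := exists_block i k
  · rw [(invStep_pair _ ht).1, (fwdStep_pair h0 g ht).2, (fwdStep_pair h0 g ht).1]
    have := CharTwo.add_self_eq_zero (pt β (2 * b) * g (b * 2 ^ (i + 1) + t + 2 ^ i))
    have h2 := CharTwo.add_self_eq_zero
      (g (b * 2 ^ (i + 1) + t) + pt β (2 * b) * g (b * 2 ^ (i + 1) + t + 2 ^ i))
    linear_combination this + pt β (2 * b) * h2
  · rw [(invStep_pair _ ht).2, (fwdStep_pair h0 g ht).2, ← add_assoc, CharTwo.add_self_eq_zero,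
      zero_add]

/-- The first `n` levels of the forward transform of size `2 ^ L`. -/
def fwdIter (β : ℕ → K) (L : ℕ) (g : ℕ → K) : ℕ → ℕ → K
  | 0 => g
  | n + 1 => fwdStep β (L - 1 - n) (fwdIter β L g n)

/-- The first `n` levels of the inverse transform. -/
def invIter (β : ℕ → K) (g : ℕ → K) : ℕ → ℕ → K
  | 0 => g
  | n + 1 => invStep β n (invIter β g n)

theorem invIter_fwdIter (h0 : β 0 = 1) (g : ℕ → K) {n : ℕ} (hn : n ≤ L) :
    invIter β (fwdIter β L g L) n = fwdIter β L g (L - n) := by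
  induction n with
  | zero => rfl
  | succ n ih =>
    rw [invIter, ih (by omega), show L - n = (L - (n + 1)) + 1 by omega, fwdIter,
      show L - 1 - (L - (n + 1)) = n by omega, invStep_fwdStep h0]

theorem lowIdx_div {i L k : ℕ} (h : i < L) :
    lowIdx i k / 2 ^ L = k / 2 ^ L ∧ (lowIdx i k + 2 ^ i) / 2 ^ L = k / 2 ^ L := by
  obtain ⟨e, rfl⟩ := Nat.exists_eq_add_of_le (Nat.succ_le_of_lt h)
  obtain ⟨-, -, h3, h4, -⟩ := block_div (b := k / 2 ^ (i + 1)) (Nat.mod_lt k (Nat.two_pow_pos i))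
  rw [Nat.succ_eq_add_one, pow_add, ← Nat.div_div_eq_div_mul, ← Nat.div_div_eq_div_mul,
    ← Nat.div_div_eq_div_mul, lowIdx, h3, h4]
  exact ⟨rfl, rfl⟩

/-- Levels below `L` never mix blocks of length `2 ^ L`, so each half of the work array is
transformed on its own. -/
theorem invIter_congr {g g' : ℕ → K} {B : ℕ} (h : ∀ k, k / 2 ^ L = B → g k = g' k) {n : ℕ}
    (hn : n ≤ L) : ∀ k, k / 2 ^ L = B → invIter β g n k = invIter β g' n k := by
  induction n with
  | zero => exact h
  | succ n ih =>
    intro k hk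
    obtain ⟨h1, h2⟩ := lowIdx_div (k := k) (show n < L by omega)
    simp only [invIter, invStep]
    rw [ih (by omega) _ (h1.trans hk), ih (by omega) _ (h2.trans hk)]

/-- Invariant of the levels: the value at the point `k` is a combination of the first `2 ^ (L - n)`
basis polynomials with coefficients from the block of `k`. A level evaluates the top factor `sub i`,
whose value there is `pt β (k / 2 ^ i)`. -/
theorem fwdIter_eq_sum (h0 : β 0 = 1) (hβ : ∀ i < L, β (i + 1) ^ 2 + β (i + 1) = β i)
    (g : ℕ → K) {n : ℕ} (hn : n ≤ L) {k : ℕ} (hk : k < 2 ^ (L + 1)) :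
    ∑ t ∈ Finset.range (2 ^ (L - n)), fwdIter β L g n (k / 2 ^ (L - n) * 2 ^ (L - n) + t) *
        aeval (pt β k) (novel t) =
      ∑ t ∈ Finset.range (2 ^ L), g (k / 2 ^ L * 2 ^ L + t) * aeval (pt β k) (novel t) := by
  induction n with
  | zero => rfl
  | succ n ih =>
    rw [← ih (by omega)]
    obtain ⟨i, hi⟩ : ∃ i, L - n = i + 1 := ⟨L - n - 1, by omega⟩
    have hi' : L - (n + 1) = i := by omega
    rw [hi, hi', pow_succ 2 i, mul_two, Finset.sum_range_add, ← mul_two, ← pow_succ,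
      ← Finset.sum_add_distrib]
    refine Finset.sum_congr rfl fun t ht => ?_
    rw [Finset.mem_range] at ht
    rw [fwdIter, show L - 1 - n = i by omega, Nat.add_comm (2 ^ i) t, novel_add ht, map_mul,
      aeval_pt_sub h0 hβ hk]
    have hk1 : k / 2 ^ (i + 1) = k / 2 ^ i / 2 := by rw [pow_succ, Nat.div_div_eq_div_mul]
    rcases Nat.mod_two_eq_zero_or_one (k / 2 ^ i) with h | h
    · have e : k / 2 ^ i * 2 ^ i = k / 2 ^ (i + 1) * 2 ^ (i + 1) := by
        rw [hk1, pow_succ, mul_comm (2 ^ i) 2, ← mul_assoc]; congr 1; omega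
      rw [e, (fwdStep_pair h0 _ ht).1, show 2 * (k / 2 ^ (i + 1)) = k / 2 ^ i by omega, add_assoc]
      ring
    · have e : k / 2 ^ i * 2 ^ i + t = k / 2 ^ (i + 1) * 2 ^ (i + 1) + t + 2 ^ i := by
        have : k / 2 ^ i = 2 * (k / 2 ^ (i + 1)) + 1 := by omega
        rw [this, pow_succ]; ring
      rw [e, (fwdStep_pair h0 _ ht).2, (fwdStep_pair h0 _ ht).1,
          ← add_assoc (k / 2 ^ (i + 1) * 2 ^ (i + 1))]
      have : k / 2 ^ i = 2 * (k / 2 ^ (i + 1)) + 1 := by omega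
      rw [this, pt_two_mul_add_one h0]
      ring

/-- The transform of a coefficient array computes the values at the points. -/
theorem fwdIter_eval (h0 : β 0 = 1) (hβ : ∀ i < L, β (i + 1) ^ 2 + β (i + 1) = β i)
    {g : ℕ → K} {c : ℕ → ZMod 2} {R : (ZMod 2)[X]}
    (hR : R = ∑ t ∈ Finset.range (2 ^ L), C (c t) * novel t) {k : ℕ} (hk : k < 2 ^ (L + 1))
    (hg : ∀ j, j / 2 ^ L = k / 2 ^ L → g j = algebraMap (ZMod 2) K (c (j % 2 ^ L))) :
    fwdIter β L g L k = aeval (pt β k) R := by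
  have h := fwdIter_eq_sum h0 hβ g le_rfl hk
  simp only [Nat.sub_self, pow_zero, Finset.range_one, Finset.sum_singleton, Nat.div_one, mul_one,
    add_zero, novel_zero, map_one] at h
  rw [h, hR, map_sum]
  refine Finset.sum_congr rfl fun t ht => ?_
  rw [Finset.mem_range] at ht
  have hp := Nat.two_pow_pos L
  rw [hg, map_mul, aeval_C, Nat.mul_add_mod_of_lt ht]
  rw [Nat.add_comm, Nat.add_mul_div_right _ _ hp, Nat.div_eq_of_lt ht, zero_add]

/-- The inverse transform recovers the coefficients from the values on one half. -/
theorem invIter_eval (h0 : β 0 = 1) (hβ : ∀ i < L, β (i + 1) ^ 2 + β (i + 1) = β i)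
    {g : ℕ → K} {c : ℕ → ZMod 2} {R : (ZMod 2)[X]}
    (hR : R = ∑ t ∈ Finset.range (2 ^ L), C (c t) * novel t) {B : ℕ} (hB : B < 2)
    (hg : ∀ k, k / 2 ^ L = B → g k = aeval (pt β k) R) {k : ℕ} (hk : k / 2 ^ L = B) :
    invIter β g L k = algebraMap (ZMod 2) K (c (k % 2 ^ L)) := by
  set g' : ℕ → K := fun k => algebraMap (ZMod 2) K (c (k % 2 ^ L)) with hg'
  have h1 : ∀ k, k / 2 ^ L = B → g k = fwdIter β L g' L k := by
    intro k hk
    rw [hg k hk, fwdIter_eval h0 hβ hR _ fun j _ => rfl]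
    rw [pow_succ, mul_comm, ← Nat.div_lt_iff_lt_mul (Nat.two_pow_pos L), hk]
    exact hB
  rw [invIter_congr h1 le_rfl k hk, invIter_fwdIter h0 g' le_rfl, Nat.sub_self, fwdIter]

end FFT

/-! ### Montgomery reduction -/

section Montgomery
open Polynomial

/-- Montgomery reduction modulo `P` with respect to a monic polynomial `s`. -/
theorem montgomery {P s : (ZMod 2)[X]} (hs : s.Monic) (hcop : IsCoprime P s)
    (hP : P ≠ 0) {T : (ZMod 2)[X]} (hT : T.degree < P.degree + s.degree) :
    ∃ q R : (ZMod 2)[X], q.degree < s.degree ∧ R * s = T + q * P ∧ R.degree < P.degree := by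
  obtain ⟨a, b, hab⟩ := hcop
  -- `a` inverts `P` modulo `s`, so with `q = T a mod s` the sum `T + q P` is congruent to `T (1 + a
  -- P)`, which is `T b s` up to multiples of 2, hence to zero modulo `s`.
  have hq : (T * a %ₘ s).degree < s.degree := degree_modByMonic_lt _ hs
  have hdiv := modByMonic_add_div (T * a) s
  have h2 : T * b * s + T + T * a * P = 0 := by
    have := CharTwo.add_self_eq_zero T
    linear_combination this + T * hab
  have hR : (T * b + (T * a /ₘ s) * P) * s = T + (T * a %ₘ s) * P := by
    have := CharTwo.add_self_eq_zero T
    have h3 := CharTwo.add_self_eq_zero (T * a * P)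
    have h4 := CharTwo.add_self_eq_zero ((T * a %ₘ s) * P)
    linear_combination P * hdiv + h2 - this - h4
  refine ⟨_, _, hq, hR, ?_⟩
  have h5 : (T + (T * a %ₘ s) * P).degree < P.degree + s.degree := by
    refine (degree_add_le _ _).trans_lt (max_lt hT ?_)
    rw [degree_mul, add_comm P.degree]
    exact WithBot.add_lt_add_right (degree_ne_bot.2 hP) hq
  rw [← hR, degree_mul] at h5
  exact lt_of_add_lt_add_right h5

/-- Such a `u` lies in the field with `2 ^ e` elements, where the degree of a minimal polynomial
divides `e`. -/
theorem aeval_ne_zero_of_natDegree {K : Type} [Field K] [Algebra (ZMod 2) K] {P : (ZMod 2)[X]}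
    (hP : Irreducible P) {e : ℕ} (he : 0 < e) (hd : e < P.natDegree) {u : K}
    (hu : u ^ 2 ^ e = u) : aeval u P ≠ 0 := by
  intro h
  have h1 : P ∣ X ^ (Nat.card (ZMod 2)) ^ e - X := by
    refine (hP.dvd_iff_aeval_eq_zero h).1 ?_
    simp [hu]
  exact absurd (Nat.le_of_dvd he (hP.natDegree_dvd_of_dvd_X_pow_card_pow_sub_X h1)) (not_le.2 hd)

/-- A root of `sub L` is killed by `2 ^ j` iterates of `wp`, so it lies in the field with `2 ^ 2 ^
j` elements, too small for a root of `P`. -/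
theorem isCoprime_sub {P : (ZMod 2)[X]} (hP : Irreducible P) {j L : ℕ} (hL : L ≤ 2 ^ j)
    (hd : 2 ^ j < P.natDegree) : IsCoprime P (sub L) := by
  refine (hP.coprime_iff_not_dvd).2 fun h => ?_
  let K := AlgebraicClosure (ZMod 2)
  have : CharP K 2 := charP_of_injective_algebraMap (algebraMap (ZMod 2) K).injective 2
  obtain ⟨u, hu⟩ := IsAlgClosed.exists_aeval_eq_zero K P
    (by rw [degree_eq_natDegree hP.ne_zero]; exact_mod_cast (Nat.zero_lt_of_lt hd).ne')
  refine aeval_ne_zero_of_natDegree hP (Nat.two_pow_pos j) hd (u := u) ?_ hu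
  have h1 : aeval u (sub L) = 0 := by
    obtain ⟨Q, hQ⟩ := h
    rw [hQ, map_mul, hu, zero_mul]
  rw [aeval_sub] at h1
  have hz : ∀ n, (wp K)^[n] 0 = 0 := fun n => by
    induction n with
    | zero => rfl
    | succ n ih => rw [Function.iterate_succ_apply', ih]; simp [wp]
  have h2 : (wp K)^[2 ^ j] u = 0 := by
    obtain ⟨e, he⟩ := Nat.exists_eq_add_of_le hL
    rw [he, Nat.add_comm, Function.iterate_add_apply, h1, hz]
  rw [wp_iterate_two_pow] at h2
  exact CharTwo.add_eq_zero.1 h2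

end Montgomery

/-- Irreducible polynomials over `ZMod 2` exist in every positive degree. -/
theorem exists_irreducible_natDegree {d : ℕ} (hd : 0 < d) :
    ∃ P : Polynomial (ZMod 2), Irreducible P ∧ P.natDegree = d := by
  obtain ⟨α, hα⟩ := Field.exists_primitive_element (ZMod 2) (GaloisField 2 d)
  have hint : IsIntegral (ZMod 2) α := Algebra.IsIntegral.isIntegral α
  refine ⟨minpoly (ZMod 2) α, minpoly.irreducible hint, ?_⟩
  rw [← IntermediateField.adjoin.finrank hint, hα, IntermediateField.finrank_top',
    GaloisField.finrank 2 hd.ne']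

end RazExtractor

namespace RazExtractor

/-! ### The program -/

namespace Ex

instance : Add Ex := ⟨op .add⟩
instance : Sub Ex := ⟨op .sub⟩
instance : Mul Ex := ⟨op .mul⟩
instance : Div Ex := ⟨op .div⟩
instance : Mod Ex := ⟨op .mod⟩
instance : AndOp Ex := ⟨op .and⟩
instance : XorOp Ex := ⟨op .xor⟩
instance : ShiftLeft Ex := ⟨op .shl⟩
instance : ShiftRight Ex := ⟨op .shr⟩
instance (n : ℕ) : OfNat Ex n := ⟨lit n⟩

section
variable (w : ℕ) (ρ μ : ℕ → ℕ) (a b : Ex) (n K : ℕ)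
theorem ev_add : (a + b).ev w ρ μ = WordOp.add.eval w (a.ev w ρ μ) (b.ev w ρ μ) := rfl
theorem ev_mul : (a * b).ev w ρ μ = WordOp.mul.eval w (a.ev w ρ μ) (b.ev w ρ μ) := rfl
theorem ev_div : (a / b).ev w ρ μ = a.ev w ρ μ / b.ev w ρ μ := rfl
theorem ev_mod : (a % b).ev w ρ μ = a.ev w ρ μ % b.ev w ρ μ := rfl
theorem ev_xor : (a ^^^ b).ev w ρ μ = a.ev w ρ μ ^^^ b.ev w ρ μ := rfl
theorem ev_shl : (a <<< b).ev w ρ μ = WordOp.shl.eval w (a.ev w ρ μ) (b.ev w ρ μ) := rfl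
theorem ev_var (i : ℕ) : (var i).ev w ρ μ = ρ i := rfl
theorem ev_ld : (ld a).ev w ρ μ = μ (a.ev w ρ μ) := rfl
theorem ev_lt : (op .lt a b).ev w ρ μ = if a.ev w ρ μ < b.ev w ρ μ then 1 else 0 := rfl
theorem wf_add : (a + b).wf K ↔ a.wf K ∧ b.wf K := Iff.rfl
theorem wf_sub : (a - b).wf K ↔ a.wf K ∧ b.wf K := Iff.rfl
theorem wf_mul : (a * b).wf K ↔ a.wf K ∧ b.wf K := Iff.rfl
theorem wf_div : (a / b).wf K ↔ a.wf K ∧ b.wf K := Iff.rfl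
theorem wf_mod : (a % b).wf K ↔ a.wf K ∧ b.wf K := Iff.rfl
theorem wf_and : (a &&& b).wf K ↔ a.wf K ∧ b.wf K := Iff.rfl
theorem wf_xor : (a ^^^ b).wf K ↔ a.wf K ∧ b.wf K := Iff.rfl
theorem wf_shl : (a <<< b).wf K ↔ a.wf K ∧ b.wf K := Iff.rfl
theorem wf_shr : (a >>> b).wf K ↔ a.wf K ∧ b.wf K := Iff.rfl
theorem wf_ofNat : (no_index (OfNat.ofNat n) : Ex).wf K ↔ True := Iff.rfl
theorem wf_var (i : ℕ) : (var i).wf K ↔ i < K := Iff.rfl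
theorem wf_ld : (ld a).wf K ↔ a.wf K := Iff.rfl
theorem wf_op (o : WordOp) : (op o a b).wf K ↔ a.wf K ∧ b.wf K := Iff.rfl
end

end Ex

theorem eval_add {w a b : ℕ} (h : a + b < 2 ^ w) : WordOp.add.eval w a b = a + b :=
  Nat.mod_eq_of_lt h

theorem eval_mul {w a b : ℕ} (h : a * b < 2 ^ w) : WordOp.mul.eval w a b = a * b :=
  Nat.mod_eq_of_lt h

theorem eval_sub {w a b : ℕ} (h : b ≤ a) (ha : a < 2 ^ w) : WordOp.sub.eval w a b = a - b := by
  rw [WordOp.eval, show a + (2 ^ w - b) = (a - b) + 2 ^ w by omega, Nat.add_mod_right]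
  exact Nat.mod_eq_of_lt (by omega)

theorem eval_shl {w a b : ℕ} (h : a * 2 ^ b < 2 ^ w) : WordOp.shl.eval w a b = a * 2 ^ b := by
  rw [WordOp.eval, Nat.shiftLeft_eq]; exact Nat.mod_eq_of_lt h

section Program
open Ex

/-- Table lookup of a product of short words. -/
def tabE (a b : Ex) : Ex := ld (var 13 + (a * var 22 + b))

/-- One level of the recursive multiplication of words. -/
def nimE (M : Ex → Ex → Ex) (sz a b : Ex) : Ex :=
  (M (a % sz) (b % sz) ^^^ M (M (a / sz) (b / sz)) (sz / 2)) ^^^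
    ((M (a % sz) (b / sz) ^^^ M (a / sz) (b % sz)) ^^^ M (a / sz) (b / sz)) * sz

/-- The product of two words. -/
def kmulE (a b : Ex) : Ex := nimE (nimE tabE (var 22)) (var 21) a b

/-- Fill the multiplication table of short words. -/
def tableP : St :=
  .seq (.store (var 13 + (var 22 + 1)) 1)
    (.loop (var 19 - 2) (.bind ((1 : Ex) <<< ((1 : Ex) <<< var 26)) (.bind (var 29 * var 29)
      (.loop (var 30) (.loop (var 30)
        (.store (var 13 + (var 31 * var 22 + var 34)) (nimE tabE (var 29) (var 31) (var 34))))))))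

/-- Compute the Cantor basis. -/
def cantorP : St :=
  .seq (.store (var 14 + (var 20 - 1)) ((1 : Ex) <<< (var 20 - 1)))
    (.loop (var 20 - 1) (.bind (var 14 + (var 20 - 2 - var 26)) (.bind (ld (var 29 + 1))
      (.store (var 29) (kmulE (var 30) (var 30) ^^^ var 30)))))

/-- Compute the points of the transform. -/
def pointsP : St :=
  .seq (.store (var 8) 0)
    (.loop (var 17 + 1) (.bind ((1 : Ex) <<< var 26) (.bind (ld (var 14 + var 26))
      (.loop (var 29) (.store (var 8 + (var 29 + var 31)) (ld (var 8 + var 31) ^^^ var 30))))))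

/-- Compute the coefficients of the iterates of `X ^ 2 + X`. -/
def coeffsP : St :=
  .seq (.store (var 15) 1)
    (.loop (var 17 - 1) (.bind (ld (var 15 + var 26))
      (.store (var 15 + (var 26 + 1)) ((var 29 <<< 1) ^^^ var 29))))

/-- Loop over all butterflies of all levels. -/
def pairLoop (ie : Ex) (body : St) : St :=
  .loop (var 17) (.bind ie (.bind ((1 : Ex) <<< var 29) (.loop (var 18)
    (.bind (var 31 / var 30)
      (.bind (var 5 + (var 34 * (var 30 + var 30) + var 31 % var 30))
        (.bind (var 35 + var 30) (.bind (ld (var 8 + (var 34 + var 34))) body)))))))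

/-- The forward transform of the work array. -/
def fwdP : St :=
  pairLoop (var 17 - 1 - var 26) (.bind (ld (var 36))
    (.seq (.store (var 35) (ld (var 35) ^^^ kmulE (var 37) (var 38)))
      (.store (var 36) (ld (var 35) ^^^ var 38))))

/-- The inverse transform of the work array. -/
def invP : St :=
  pairLoop (var 26) (.bind (ld (var 35) ^^^ ld (var 36))
    (.seq (.store (var 36) (var 38))
      (.store (var 35) (ld (var 35) ^^^ kmulE (var 37) (var 38)))))

/-- Pass from the monomial to the novel basis in the work array. -/
def convP : St :=
  .loop (var 17) (.bind (var 17 - 1 - var 26) (.bind ((1 : Ex) <<< var 29) (.bind (ld (var 15 + var 29))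
    (.loop (var 18 / 2)
      (.bind (var 5 + ((var 32 / var 30) * (var 30 + var 30) + (var 30 - 1 - var 32 % var 30)))
        (.bind (ld (var 35 + var 30))
          (.loop (var 29) (.bind (var 35 + ((1 : Ex) <<< var 37))
            (.store (var 40) (ld (var 40) ^^^ (((var 31 >>> var 37) &&& 1) * var 36)))))))))))

/-- `dst[off + k] = src k` for `k < n`. -/
def fillP (n dst src : Ex) : St := .loop n (.store (dst + var 26) src)

/-- An inverse transform is used for the coefficients in one half only; with a copy in both halves
the next forward transform evaluates the same polynomial at all `2 * D` points. -/
def dupUpP : St := fillP (var 18) (var 5 + var 18) (ld (var 5 + var 26))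

def dupDownP : St := fillP (var 18) (var 5) (ld (var 5 + (var 18 + var 26)))

def clearP : St := fillP (var 18) (var 5) 0

def saveP (dst : ℕ) : St := fillP (var 18 + var 18) (var dst) (ld (var 5 + var 26))

/-- Turn the coefficients in the lower half of the work array into values, stored at `dst`. -/
def evalP (dst : ℕ) : St := .seq dupUpP (.seq fwdP (saveP dst))

def loadPolyP : St :=
  .seq clearP (.seq (fillP (var 7 + 1) (var 5) (ld (var 0 + (var 2 + var 26)))) convP)

/-- Source bits are taken as coefficients in the novel basis directly, with no conversion. The
second pass adds `y` in place. -/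
def loadAP : St :=
  .seq clearP (.seq (fillP (var 6) (var 5) (ld (var 26)))
    (fillP (var 2) (var 5) (ld (var 5 + var 26) ^^^ ld (var 0 + var 26))))

def loadBP : St := .seq clearP (fillP (var 7) (var 5) (ld (var 6 + var 26)))

/-- Invert the values of the modulus. -/
def invertP : St :=
  .loop (var 18 + var 18) (.seq (.store (var 10 + var 26) 1)
    (.seq (.store (var 16 + 2) (ld (var 9 + var 26)))
      (.loop (var 20 - 1) (.bind (ld (var 16 + 2)) (.bind (kmulE (var 32) (var 32))
        (.seq (.store (var 16 + 2) (var 33)) (.bind (ld (var 10 + var 26))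
          (.store (var 10 + var 26) (kmulE (var 34) (var 33))))))))))

/-- Montgomery multiplication of the value arrays `x` and `y` into `dst`. -/
def mmP (x y dst : ℕ) : St :=
  .seq (.loop (var 18 + var 18) (.bind (ld (var x + var 26)) (.bind (ld (var y + var 26))
      (.bind (kmulE (var 29) (var 30)) (.bind (ld (var 10 + var 26))
        (.store (var 5 + var 26) (kmulE (var 31) (var 32))))))))
  (.seq invP (.seq dupUpP (.seq fwdP
  (.seq (.loop (var 18 + var 18) (.bind (ld (var x + var 26)) (.bind (ld (var y + var 26))
      (.bind (ld (var 9 + var 26)) (.bind (ld (var 5 + var 26))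
        (.store (var 5 + var 26) (kmulE (var 29) (var 30) ^^^ kmulE (var 31) (var 32))))))))
  (.seq invP (.seq dupDownP (.seq fwdP (saveP dst))))))))

/-- All precomputation. -/
def setupP : St :=
  .seq tableP (.seq cantorP (.seq pointsP (.seq coeffsP
    (.seq (.seq loadPolyP (evalP 9)) (.seq invertP
      (.seq (.seq loadAP (evalP 11)) (.seq loadBP (evalP 12))))))))

/-- The coefficients overwrite the input, which is no longer needed. All `d` of them are written
although only `m` are asked for. -/
def outputP : St :=
  .seq (fillP (var 18 + var 18) (var 5) (ld (var 12 + var 26)))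
    (.seq invP (fillP (var 7) 0 (ld (var 5 + var 26))))

/-- The loops of length one only shift the next free variable from 23 to 26: the pieces refer to
their variables by number and are also used inside the genuine loop. -/
def mainP : St :=
  .seq (.loop 1 setupP) (.seq (.loop (var 17) (.seq (mmP 12 11 12) (mmP 11 11 11)))
    (.loop 1 outputP))

/-- Bind the parameters that depend on `L`. -/
def paramsP : St :=
  .bind (ld (var 16)) (.bind ((1 : Ex) <<< var 17)
    (.seq (.loop (var 17) (.store (var 16 + 1) (ld (var 16 + 1) +
        op .lt ((1 : Ex) <<< ld (var 16 + 1)) (var 17 + 1))))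
      (.bind (ld (var 16 + 1)) (.bind ((1 : Ex) <<< var 19) (.bind ((1 : Ex) <<< (var 20 / 2))
        (.bind ((1 : Ex) <<< (var 20 / 4)) mainP))))))

/-- The whole program. -/
def razSt : St :=
  -- Memory is cut into regions of length `B = 4 n₁`, starting at multiples of `B`. The multipliers
  -- 1 to 10 are: work array (variable 5), points (8), values of `P` (9), their inverses (10),
  -- values of the two running powers (11, 12), multiplication table (13), Cantor basis (14),
  -- coefficients of `sub i` (15), scratch (16). Variables 6 and 7 hold the lengths of the halves;
  -- 17 to 22 hold `L`, `D`, `j`, `κ`, `Q`, `S`.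
  .bind (var 0 * 4) (.bind (var 0 / 2) (.bind (var 0 - var 6)
    (.bind (var 5 * 2) (.bind (var 5 * 3) (.bind (var 5 * 4) (.bind (var 5 * 5) (.bind (var 5 * 6)
    (.bind (var 5 * 7) (.bind (var 5 * 8) (.bind (var 5 * 9) (.bind (var 5 * 10)
      -- The cell grows by one as long as `2 ^ c < d + 1`, so it ends as the rounded-up logarithm of
      -- `d + 1`.
      (.seq (.loop (var 7) (.store (var 16) (ld (var 16) +
          op .lt ((1 : Ex) <<< ld (var 16)) (var 7 + 1))))
        paramsP))))))))))))

def razProg : Prog := razSt.code 5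

theorem razSt_wf : razSt.wf 5 := by
  simp [razSt, paramsP, mainP, outputP, setupP, mmP, invertP, loadBP, loadAP, loadPolyP, evalP,
    saveP, clearP, dupDownP, dupUpP, fillP, convP, invP, fwdP, pairLoop, coeffsP, pointsP, cantorP,
    tableP, kmulE, nimE, tabE, St.wf, wf_add, wf_sub, wf_mul, wf_div, wf_mod, wf_and, wf_xor,
    wf_shl, wf_shr, wf_ofNat, wf_var, wf_ld, wf_op]

end Program

end RazExtractor

namespace RazExtractor

/-! ### Reasoning about runs of the program -/

theorem iter_induction {f : ℕ → (ℕ → ℕ) → (ℕ → ℕ)} {μ : ℕ → ℕ} {n : ℕ}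
    (I : ℕ → (ℕ → ℕ) → Prop) (h0 : I 0 μ) (hs : ∀ i < n, ∀ m, I i m → I (i + 1) (f i m)) :
    I n (iter f μ n) := by
  induction n with
  | zero => exact h0
  | succ n ih => exact hs n (by omega) _ (ih fun i hi => hs i (by omega))

/-- Rules for the evaluation of expressions, to be used with a discharger for the bounds. -/
theorem evs :
    (∀ (a b : ℕ) [Decidable True], (if True then a else b) = a) ∧
    (∀ (a b : ℕ) [Decidable False], (if False then a else b) = b) ∧
    (∀ w ρ μ (a b : Ex), (a + b).ev w ρ μ = WordOp.add.eval w (a.ev w ρ μ) (b.ev w ρ μ)) ∧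
    (∀ w ρ μ (a b : Ex), (a - b).ev w ρ μ = WordOp.sub.eval w (a.ev w ρ μ) (b.ev w ρ μ)) ∧
    (∀ w ρ μ (a b : Ex), (a * b).ev w ρ μ = WordOp.mul.eval w (a.ev w ρ μ) (b.ev w ρ μ)) ∧
    (∀ w ρ μ (a b : Ex), (a / b).ev w ρ μ = a.ev w ρ μ / b.ev w ρ μ) ∧
    (∀ w ρ μ (a b : Ex), (a % b).ev w ρ μ = a.ev w ρ μ % b.ev w ρ μ) ∧
    (∀ w ρ μ (a b : Ex), (a &&& b).ev w ρ μ = a.ev w ρ μ &&& b.ev w ρ μ) ∧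
    (∀ w ρ μ (a b : Ex), (a ^^^ b).ev w ρ μ = a.ev w ρ μ ^^^ b.ev w ρ μ) ∧
    (∀ w ρ μ (a b : Ex), (a <<< b).ev w ρ μ = WordOp.shl.eval w (a.ev w ρ μ) (b.ev w ρ μ)) ∧
    (∀ w ρ μ (a b : Ex), (a >>> b).ev w ρ μ = a.ev w ρ μ >>> b.ev w ρ μ) ∧
    (∀ w ρ μ (a b : Ex), (Ex.op .lt a b).ev w ρ μ =
      if a.ev w ρ μ < b.ev w ρ μ then 1 else 0) ∧
    (∀ w ρ μ (a : Ex), (Ex.ld a).ev w ρ μ = μ (a.ev w ρ μ)) ∧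
    (∀ w ρ μ i, (Ex.var i).ev w ρ μ = ρ i) ∧
    (∀ w ρ μ, 0 < 2 ^ w → (0 : Ex).ev w ρ μ = 0) ∧
    (∀ w ρ μ, 1 < 2 ^ w → (1 : Ex).ev w ρ μ = 1) ∧
    (∀ w ρ μ, 2 < 2 ^ w → (2 : Ex).ev w ρ μ = 2) ∧
    (∀ w ρ μ, 3 < 2 ^ w → (3 : Ex).ev w ρ μ = 3) ∧
    (∀ w ρ μ, 4 < 2 ^ w → (4 : Ex).ev w ρ μ = 4) ∧
    (∀ w ρ μ, 5 < 2 ^ w → (5 : Ex).ev w ρ μ = 5) ∧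
    (∀ w ρ μ, 6 < 2 ^ w → (6 : Ex).ev w ρ μ = 6) ∧
    (∀ w ρ μ, 7 < 2 ^ w → (7 : Ex).ev w ρ μ = 7) ∧
    (∀ w ρ μ, 8 < 2 ^ w → (8 : Ex).ev w ρ μ = 8) ∧
    (∀ w ρ μ, 9 < 2 ^ w → (9 : Ex).ev w ρ μ = 9) ∧
    (∀ w ρ μ, 10 < 2 ^ w → (10 : Ex).ev w ρ μ = 10) ∧
    (∀ w a b, a + b < 2 ^ w → WordOp.add.eval w a b = a + b) ∧
    (∀ w a b, b ≤ a → a < 2 ^ w → WordOp.sub.eval w a b = a - b) ∧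
    (∀ w a b, a * b < 2 ^ w → WordOp.mul.eval w a b = a * b) ∧
    (∀ w a b, a * 2 ^ b < 2 ^ w → WordOp.shl.eval w a b = a * 2 ^ b) ∧
    (∀ K ρ n i x, loopEnv K ρ n i x =
      if x = K + 2 then 1 else if x = K + 1 then n else if x = K then i else ρ x) ∧
    ∀ (ρ : ℕ → ℕ) i v x, Function.update ρ i v x = if x = i then v else ρ x := by
  refine ⟨fun _ _ _ => if_pos trivial, fun _ _ _ => if_neg not_false,
    fun _ _ _ _ _ => rfl, fun _ _ _ _ _ => rfl, fun _ _ _ _ _ => rfl,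
    fun _ _ _ _ _ => rfl, fun _ _ _ _ _ => rfl, fun _ _ _ _ _ => rfl, fun _ _ _ _ _ => rfl,
    fun _ _ _ _ _ => rfl, fun _ _ _ _ _ => rfl, fun _ _ _ _ _ => rfl, fun _ _ _ _ => rfl,
    fun _ _ _ _ => rfl, fun _ _ _ => Nat.mod_eq_of_lt, fun _ _ _ => Nat.mod_eq_of_lt,
    fun _ _ _ => Nat.mod_eq_of_lt, fun _ _ _ => Nat.mod_eq_of_lt, fun _ _ _ => Nat.mod_eq_of_lt,
    fun _ _ _ => Nat.mod_eq_of_lt, fun _ _ _ => Nat.mod_eq_of_lt, fun _ _ _ => Nat.mod_eq_of_lt,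
    fun _ _ _ => Nat.mod_eq_of_lt, fun _ _ _ => Nat.mod_eq_of_lt, fun _ _ _ => Nat.mod_eq_of_lt,
    fun _ _ _ => eval_add, fun _ _ _ => eval_sub, fun _ _ _ => eval_mul, fun _ _ _ => eval_shl,
    fun K ρ n i x => ?_, fun _ _ _ _ => Function.update_apply _ _ _ _⟩
  simp only [loopEnv, Function.update_apply]

namespace St
variable {w K : ℕ} {ρ μ : ℕ → ℕ}

theorem run_seq (p q : St) : (seq p q).run w K ρ μ = q.run w K ρ (p.run w K ρ μ) := rfl

theorem run_store {a v : Ex} {x y : ℕ} (ha : a.ev w ρ μ = x) (hv : v.ev w ρ μ = y) :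
    (store a v).run w K ρ μ = Function.update μ x y := by rw [run, ha, hv]

theorem run_bind {e : Ex} {v : ℕ} (he : e.ev w ρ μ = v) (b : St) :
    (bind e b).run w K ρ μ = b.run w (K + 1) (Function.update ρ K v) μ := by rw [run, he]

theorem run_loop {e : Ex} {n : ℕ} (he : e.ev w ρ μ = n) (hn : n < 2 ^ w) {b : St}
    (I : ℕ → (ℕ → ℕ) → Prop) (h0 : I 0 μ)
    (hs : ∀ i < n, ∀ m, I i m → I (i + 1) (b.run w (K + 3) (loopEnv K ρ n i) m)) :
    I n ((loop e b).run w K ρ μ) := by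
  rw [run, he, Nat.mod_eq_of_lt hn]
  exact iter_induction I h0 hs

end St

/-- The quantities a run depends on. -/
structure Par where
  (w n₁ n₂ B d L D j κ Q S : ℕ)
  hB : B = 4 * n₁
  hd : d = n₁ - n₁ / 2
  hn₂ : 2 * n₂ ≤ n₁
  hn₁ : 1 ≤ n₁
  hw : 64 * n₁ < 2 ^ w
  hD : D = 2 ^ L
  hdD : d < D
  hDn : D ≤ n₁ + 1
  hκ : κ = 2 ^ j
  hj : 3 ≤ j
  hLκ : L + 1 ≤ κ
  hκL : κ ≤ 2 * L
  hκw : 2 ^ κ ≤ 2 ^ w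
  hQ : Q = 2 ^ 2 ^ (j - 1)
  hS : S = 2 ^ 2 ^ (j - 2)

namespace Par
variable (p : Par)

theorem S_mul_S : p.S * p.S = p.Q := by
  rw [p.hQ, p.hS, ← pow_add, ← two_mul, ← pow_succ']
  congr 2
  have := p.hj
  omega

/-- The multiplication table for words of `κ / 4` bits has `S * S = Q = 2 ^ (κ / 2)` entries; `κ ≤ 2
L` makes this at most `2 ^ L`. -/
theorem Q_le_D : p.Q ≤ p.D := by
  rw [p.hD, p.hQ]
  refine Nat.pow_le_pow_right (by norm_num) ?_
  have h := p.hκL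
  have : 2 ^ p.j = 2 * 2 ^ (p.j - 1) := by
    rw [← pow_succ']; congr 1; have := p.hj; omega
  rw [p.hκ, this] at h
  omega

/-- Linear facts collected for `omega`. The bound `16 * B < 2 ^ w` leaves room for addresses, the
last region starting at `10 * B`. -/
theorem lin : p.B = 4 * p.n₁ ∧ p.d = p.n₁ - p.n₁ / 2 ∧ 2 * p.n₂ ≤ p.n₁ ∧ 1 ≤ p.n₁ ∧
    16 * p.B < 2 ^ p.w ∧ p.d < p.D ∧ p.D ≤ p.n₁ + 1 ∧ 2 * p.D ≤ p.B ∧ p.L < p.D ∧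
    p.L + 1 ≤ p.κ ∧ p.κ ≤ 2 * p.L ∧ p.Q ≤ p.D ∧ 2 ^ p.κ ≤ 2 ^ p.w ∧ p.κ ≤ p.w := by
  have h1 := p.hB
  have h2 := p.hw
  have h3 := p.hn₁
  have h4 := p.hDn
  have h5 : p.L < p.D := by rw [p.hD]; exact Nat.lt_two_pow_self
  exact ⟨h1, p.hd, p.hn₂, h3, by omega, p.hdD, h4, by omega, h5, p.hLκ, p.hκL, p.Q_le_D, p.hκw,
    (Nat.pow_le_pow_iff_right (by norm_num)).1 p.hκw⟩

/-- The values of the global variables. -/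
abbrev Env (ρ : ℕ → ℕ) : Prop :=
  ρ 0 = p.n₁ ∧ ρ 2 = p.n₂ ∧ ρ 5 = p.B ∧ ρ 6 = p.n₁ / 2 ∧ ρ 7 = p.d ∧ ρ 8 = 2 * p.B ∧
  ρ 9 = 3 * p.B ∧ ρ 10 = 4 * p.B ∧ ρ 11 = 5 * p.B ∧ ρ 12 = 6 * p.B ∧ ρ 13 = 7 * p.B ∧
  ρ 14 = 8 * p.B ∧ ρ 15 = 9 * p.B ∧ ρ 16 = 10 * p.B ∧ ρ 17 = p.L ∧ ρ 18 = p.D ∧ ρ 19 = p.j ∧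
  ρ 20 = p.κ ∧ ρ 21 = p.Q ∧ ρ 22 = p.S

variable {p}

theorem Env.update {ρ : ℕ → ℕ} (h : p.Env ρ) {i v : ℕ} (hi : 23 ≤ i) :
    p.Env (Function.update ρ i v) := by
  unfold Env at h ⊢
  have : ∀ k, k < 23 → Function.update ρ i v k = ρ k := fun k hk =>
    Function.update_of_ne (by omega) _ _
  simpa [this] using h

theorem Env.loopEnv {ρ : ℕ → ℕ} (h : p.Env ρ) {k v i : ℕ} (hk : 23 ≤ k) :
    p.Env (loopEnv k ρ v i) :=
  ((h.update hk).update (by omega)).update (by omega)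

end Par

/-- The memories agree outside an interval. -/
def Off (lo hi : ℕ) (μ' μ : ℕ → ℕ) : Prop := ∀ a, a < lo ∨ hi ≤ a → μ' a = μ a

theorem Off.refl (lo hi : ℕ) (μ : ℕ → ℕ) : Off lo hi μ μ := fun _ _ => rfl

theorem Off.trans {lo hi : ℕ} {μ μ' μ'' : ℕ → ℕ} (h : Off lo hi μ'' μ') (h' : Off lo hi μ' μ) :
    Off lo hi μ'' μ := fun a ha => (h a ha).trans (h' a ha)

theorem Off.mono {lo hi lo' hi' : ℕ} {μ μ' : ℕ → ℕ} (h : Off lo hi μ' μ) (h1 : lo' ≤ lo)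
    (h2 : hi ≤ hi') : Off lo' hi' μ' μ := fun a ha => h a (by omega)

theorem Off.store {lo hi : ℕ} {μ μ' : ℕ → ℕ} (h : Off lo hi μ' μ) {a v : ℕ} (h1 : lo ≤ a)
    (h2 : a < hi) : Off lo hi (Function.update μ' a v) μ := fun b hb => by
  rw [Function.update_of_ne (by omega), h b hb]

section Fill
variable {w : ℕ} {ρ μ : ℕ → ℕ}

/-- The source expression may still read the cells from `a₀ + i` on, which covers updating an array
in place. -/
theorem fillP_run {n dst src : Ex} {N a₀ : ℕ} {s : ℕ → ℕ} (hn : n.ev w ρ μ = N)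
    (hN : a₀ + N < 2 ^ w)
    (hd : ∀ i m, dst.ev w (loopEnv 26 ρ N i) m = a₀)
    (hs : ∀ i < N, ∀ m, (∀ a, a < a₀ ∨ a₀ + i ≤ a → m a = μ a) →
      src.ev w (loopEnv 26 ρ N i) m = s i) :
    (∀ i < N, (fillP n dst src).run w 26 ρ μ (a₀ + i) = s i) ∧
      Off a₀ (a₀ + N) ((fillP n dst src).run w 26 ρ μ) μ := by
  refine St.run_loop hn (by omega)
    (fun i m => (∀ k < i, m (a₀ + k) = s k) ∧ Off a₀ (a₀ + i) m μ)
    ⟨by simp, Off.refl _ _ _⟩ ?_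
  rintro i hi m ⟨h1, h2⟩
  have e : (dst + .var 26).ev w (loopEnv 26 ρ N i) m = a₀ + i := by
    rw [Ex.ev_add, hd, eval_add] <;> simp [Ex.ev_var, loopEnv]
    omega
  rw [St.run_store e (hs i hi m h2)]
  refine ⟨fun k hk => ?_, (h2.mono le_rfl (by omega)).store (by omega) (by omega)⟩
  rcases Nat.lt_succ_iff_lt_or_eq.1 hk with h | rfl
  · rw [Function.update_of_ne (by omega), h1 k h]
  · rw [Function.update_self]

end Fill

/-! ### Arrays of field elements and multiplication of words -/

section Field
set_option linter.unusedSectionVars false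
open Polynomial
variable (K : Type) [Field K] [CharP K 2] [IsAlgClosed K] (p : Par)

/-- An array of words representing field elements. -/
def Rep (μ : ℕ → ℕ) (a₀ N : ℕ) (f : ℕ → K) : Prop :=
  ∀ k < N, μ (a₀ + k) < 2 ^ p.κ ∧ word K (μ (a₀ + k)) = f k

variable {K p}

theorem Rep.off {μ μ' : ℕ → ℕ} {a₀ N lo hi : ℕ} {f : ℕ → K} (h : Rep K p μ a₀ N f)
    (h' : Off lo hi μ' μ) (hd : a₀ + N ≤ lo ∨ hi ≤ a₀) : Rep K p μ' a₀ N f := fun k hk => by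
  rw [h' _ (by omega)]
  exact h k hk

theorem Rep.congr {μ : ℕ → ℕ} {a₀ N : ℕ} {f g : ℕ → K} (h : Rep K p μ a₀ N f)
    (hfg : ∀ k < N, f k = g k) : Rep K p μ a₀ N g := fun k hk => by
  rw [← hfg k hk]; exact h k hk

theorem Rep.mono {μ : ℕ → ℕ} {a₀ N M : ℕ} {f : ℕ → K} (h : Rep K p μ a₀ N f) (hM : M ≤ N) :
    Rep K p μ a₀ M f := fun k hk => h k (by omega)

variable (K p)

/-- The multiplication table is filled. -/
def Tab (μ : ℕ → ℕ) : Prop := IsWordMul K (p.j - 2) fun a b => μ (7 * p.B + (a * p.S + b))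

variable {K p}

theorem Tab.of_eq {μ μ' : ℕ → ℕ} (h : Tab K p μ)
    (h' : ∀ a, 7 * p.B ≤ a → a < 8 * p.B → μ' a = μ a) : Tab K p μ' := by
  intro a ha b hb
  have := p.lin
  have hSQ := p.S_mul_S
  rw [← p.hS] at ha hb
  have h2 : a * p.S + b < p.Q := by rw [← hSQ]; nlinarith
  beta_reduce
  rw [h' _ (by omega) (by omega)]
  rw [p.hS] at ha hb
  exact h a ha b hb

theorem Tab.off {μ μ' : ℕ → ℕ} {lo hi : ℕ} (h : Tab K p μ) (h' : Off lo hi μ' μ)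
    (hd : 8 * p.B ≤ lo ∨ hi ≤ 7 * p.B) : Tab K p μ' :=
  h.of_eq fun a _ _ => h' a (by omega)

theorem nimE_ev {w i : ℕ} {ρ μ : ℕ → ℕ} {M : Ex → Ex → Ex} {m : ℕ → ℕ → ℕ}
    (hM : ∀ a b : Ex, a.ev w ρ μ < 2 ^ 2 ^ i → b.ev w ρ μ < 2 ^ 2 ^ i →
      (M a b).ev w ρ μ = m (a.ev w ρ μ) (b.ev w ρ μ)) (hm : IsWordMul K i m)
    {sz a b : Ex} (hsz : sz.ev w ρ μ = 2 ^ 2 ^ i) (hw : 2 ^ 2 ^ (i + 1) ≤ 2 ^ w)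
    (ha : a.ev w ρ μ < 2 ^ 2 ^ (i + 1)) (hb : b.ev w ρ μ < 2 ^ 2 ^ (i + 1)) :
    (nimE M sz a b).ev w ρ μ = nimStep m (2 ^ 2 ^ i) (a.ev w ρ μ) (b.ev w ρ μ) := by
  have hp : 0 < 2 ^ 2 ^ i := by positivity
  have hsq : 2 ^ 2 ^ (i + 1) = 2 ^ 2 ^ i * 2 ^ 2 ^ i := by rw [← pow_add, ← two_mul, ← pow_succ']
  have h2 : 2 ≤ 2 ^ 2 ^ i := by
    calc 2 = 2 ^ 1 := rfl
      _ ≤ _ := Nat.pow_le_pow_right (by norm_num) Nat.one_le_two_pow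
  have h2w : 2 < 2 ^ w := by nlinarith
  have h2e : (2 : Ex).ev w ρ μ = 2 := Nat.mod_eq_of_lt h2w
  have a1 : (a / sz).ev w ρ μ = a.ev w ρ μ / 2 ^ 2 ^ i := by rw [Ex.ev_div, hsz]
  have a0 : (a % sz).ev w ρ μ = a.ev w ρ μ % 2 ^ 2 ^ i := by rw [Ex.ev_mod, hsz]
  have b1 : (b / sz).ev w ρ μ = b.ev w ρ μ / 2 ^ 2 ^ i := by rw [Ex.ev_div, hsz]
  have b0 : (b % sz).ev w ρ μ = b.ev w ρ μ % 2 ^ 2 ^ i := by rw [Ex.ev_mod, hsz]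
  have sh : (sz / 2).ev w ρ μ = 2 ^ 2 ^ i / 2 := by
    rw [Ex.ev_div, hsz, h2e]
  have la1 : a.ev w ρ μ / 2 ^ 2 ^ i < 2 ^ 2 ^ i := (Nat.div_lt_iff_lt_mul hp).2 (hsq ▸ ha)
  have lb1 : b.ev w ρ μ / 2 ^ 2 ^ i < 2 ^ 2 ^ i := (Nat.div_lt_iff_lt_mul hp).2 (hsq ▸ hb)
  have la0 : a.ev w ρ μ % 2 ^ 2 ^ i < 2 ^ 2 ^ i := Nat.mod_lt _ hp
  have lb0 : b.ev w ρ μ % 2 ^ 2 ^ i < 2 ^ 2 ^ i := Nat.mod_lt _ hp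
  have lsh : 2 ^ 2 ^ i / 2 < 2 ^ 2 ^ i := Nat.div_lt_self hp (by norm_num)
  have e11 : (M (a / sz) (b / sz)).ev w ρ μ = m (a.ev w ρ μ / 2 ^ 2 ^ i) (b.ev w ρ μ / 2 ^ 2 ^ i) := by
    rw [hM _ _ (by rwa [a1]) (by rwa [b1]), a1, b1]
  have e00 : (M (a % sz) (b % sz)).ev w ρ μ = m (a.ev w ρ μ % 2 ^ 2 ^ i) (b.ev w ρ μ % 2 ^ 2 ^ i) := by
    rw [hM _ _ (by rwa [a0]) (by rwa [b0]), a0, b0]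
  have e01 : (M (a % sz) (b / sz)).ev w ρ μ = m (a.ev w ρ μ % 2 ^ 2 ^ i) (b.ev w ρ μ / 2 ^ 2 ^ i) := by
    rw [hM _ _ (by rwa [a0]) (by rwa [b1]), a0, b1]
  have e10 : (M (a / sz) (b % sz)).ev w ρ μ = m (a.ev w ρ μ / 2 ^ 2 ^ i) (b.ev w ρ μ % 2 ^ 2 ^ i) := by
    rw [hM _ _ (by rwa [a1]) (by rwa [b0]), a1, b0]
  have l11 := (hm _ la1 _ lb1).1
  have l01 := (hm _ la0 _ lb1).1
  have l10 := (hm _ la1 _ lb0).1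
  have et : (M (M (a / sz) (b / sz)) (sz / 2)).ev w ρ μ =
      m (m (a.ev w ρ μ / 2 ^ 2 ^ i) (b.ev w ρ μ / 2 ^ 2 ^ i)) (2 ^ 2 ^ i / 2) := by
    rw [hM _ _ (by rwa [e11]) (by rwa [sh]), e11, sh]
  have hhi := Nat.xor_lt_two_pow (Nat.xor_lt_two_pow l01 l10) l11
  rw [nimE, Ex.ev_xor, Ex.ev_xor, Ex.ev_mul, Ex.ev_xor, Ex.ev_xor, e00, et, e01, e10, e11, hsz,
    eval_mul, nimStep]
  calc _ < 2 ^ 2 ^ i * 2 ^ 2 ^ i := Nat.mul_lt_mul_of_pos_right hhi hp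
    _ ≤ _ := hsq ▸ hw

/-- Two recursion steps over the table lead from `κ / 4` to `κ / 2` to `κ` bits. -/
theorem kmulE_ev {ρ μ : ℕ → ℕ} (hρ : p.Env ρ) (hT : Tab K p μ) {a b : Ex} {x y : ℕ}
    (ha : a.ev p.w ρ μ = x) (hb : b.ev p.w ρ μ = y) (hx : x < 2 ^ p.κ) (hy : y < 2 ^ p.κ) :
    (kmulE a b).ev p.w ρ μ < 2 ^ p.κ ∧ word K ((kmulE a b).ev p.w ρ μ) = word K x * word K y := by
  have hlin := p.lin
  have hSQ := p.S_mul_S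
  have hj := p.hj
  have hκ := p.hκ
  have j1 : p.j - 2 + 1 = p.j - 1 := by omega
  have j2 : p.j - 1 + 1 = p.j := by omega
  have h21 : ρ 21 = 2 ^ 2 ^ (p.j - 1) := by rw [← p.hQ]; simp only [hρ]
  have h22 : ρ 22 = 2 ^ 2 ^ (p.j - 2) := by rw [← p.hS]; simp only [hρ]
  have h13 : ρ 13 = 7 * p.B := by simp only [hρ]
  have hQw : 2 ^ 2 ^ (p.j - 1) ≤ 2 ^ p.w := by rw [← p.hQ]; omega
  have htab : ∀ a b : Ex, a.ev p.w ρ μ < 2 ^ 2 ^ (p.j - 2) → b.ev p.w ρ μ < 2 ^ 2 ^ (p.j - 2) →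
      (tabE a b).ev p.w ρ μ =
        (fun a b => μ (7 * p.B + (a * p.S + b))) (a.ev p.w ρ μ) (b.ev p.w ρ μ) := by
    intro a b ha hb
    rw [← p.hS] at ha hb
    have h2 : a.ev p.w ρ μ * p.S + b.ev p.w ρ μ < p.Q := by rw [← hSQ]; nlinarith
    simp only [tabE, Ex.ev_ld, Ex.ev_add, Ex.ev_mul, Ex.ev_var, h13, h22, ← p.hS]
    rw [eval_mul (by omega), eval_add (a := a.ev p.w ρ μ * p.S) (by omega), eval_add (by omega)]
  have h1 : ∀ a b : Ex, a.ev p.w ρ μ < 2 ^ 2 ^ (p.j - 1) → b.ev p.w ρ μ < 2 ^ 2 ^ (p.j - 1) →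
      (nimE tabE (.var 22) a b).ev p.w ρ μ =
        nimStep (fun a b => μ (7 * p.B + (a * p.S + b))) (2 ^ 2 ^ (p.j - 2))
          (a.ev p.w ρ μ) (b.ev p.w ρ μ) := by
    intro a b ha hb
    exact nimE_ev htab hT h22 (by rw [j1]; exact hQw) (by rwa [j1]) (by rwa [j1])
  have hm := IsWordMul.nimStep K hT
  rw [j1] at hm
  have hm2 := IsWordMul.nimStep K hm
  rw [j2] at hm2
  have e := nimE_ev h1 hm (a := a) (b := b) (sz := .var 21) h21 (by rw [j2, ← hκ]; exact p.hκw)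
    (by rw [j2, ← hκ, ha]; exact hx) (by rw [j2, ← hκ, hb]; exact hy)
  rw [kmulE, e, ha, hb, hκ]
  rw [hκ] at hx hy
  exact hm2 x hx y hy

end Field
end RazExtractor

namespace RazExtractor

/-! ### Correctness of the multiplication table and the Cantor basis -/

section Precomputation
set_option linter.unusedSectionVars false
set_option linter.unusedSimpArgs false
open Polynomial
variable {K : Type} [Field K] [CharP K 2] [IsAlgClosed K] {p : Par} {ρ μ : ℕ → ℕ}

theorem mul_add_inj {S a b c d : ℕ} (hb : b < S) (hd : d < S) (h : a * S + b = c * S + d) :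
    a = c ∧ b = d := by
  have hS : 0 < S := by omega
  have h1 : (a * S + b) / S = a := by
    rw [mul_comm, Nat.mul_add_div hS, Nat.div_eq_of_lt hb, add_zero]
  have h2 : (c * S + d) / S = c := by
    rw [mul_comm, Nat.mul_add_div hS, Nat.div_eq_of_lt hd, add_zero]
  rw [h, h2] at h1
  subst h1
  exact ⟨rfl, by omega⟩

/-- The table multiplies words of `2 ^ t` bits. -/
def TabAt (K : Type) [Field K] [CharP K 2] [IsAlgClosed K] (p : Par) (t : ℕ) (μ : ℕ → ℕ) : Prop :=
  IsWordMul K t fun a b => μ (7 * p.B + (a * p.S + b))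

theorem tab_store_run (hρ : p.Env ρ) {t i k : ℕ} (ht : 2 ^ 2 ^ (t + 1) ≤ p.S)
    (h29 : ρ 29 = 2 ^ 2 ^ t) (h31 : ρ 31 = i) (h34 : ρ 34 = k) (hi : i < 2 ^ 2 ^ (t + 1))
    (hk : k < 2 ^ 2 ^ (t + 1)) (hm : TabAt K p t μ) {l : ℕ} :
    ∃ v, (St.store (.var 13 + (.var 31 * .var 22 + .var 34))
        (nimE tabE (.var 29) (.var 31) (.var 34))).run p.w l ρ μ =
          Function.update μ (7 * p.B + (i * p.S + k)) v ∧
      v < 2 ^ 2 ^ (t + 1) ∧ word K v = word K i * word K k := by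
  have hlin := p.lin
  have hSQ := p.S_mul_S
  have hSQ' : p.S ≤ p.Q := by nlinarith
  have hzle : 2 ^ 2 ^ t ≤ 2 ^ 2 ^ (t + 1) :=
    Nat.pow_le_pow_right (by norm_num) (Nat.pow_le_pow_right (by norm_num) (by omega))
  have hik : i * p.S + k < p.Q := by rw [← hSQ]; nlinarith
  have htab : ∀ a b : Ex, a.ev p.w ρ μ < 2 ^ 2 ^ t → b.ev p.w ρ μ < 2 ^ 2 ^ t →
      (tabE a b).ev p.w ρ μ = (fun a b => μ (7 * p.B + (a * p.S + b)))
        (a.ev p.w ρ μ) (b.ev p.w ρ μ) := by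
    intro a b ha hb
    have h2 : a.ev p.w ρ μ * p.S + b.ev p.w ρ μ < p.Q := by rw [← hSQ]; nlinarith
    simp (disch := omega) only [tabE, evs, hρ]
  have hv := nimE_ev htab hm (sz := .var 29) (a := .var 31) (b := .var 34) h29
    (by omega) (by rw [Ex.ev_var, h31]; exact hi) (by rw [Ex.ev_var, h34]; exact hk)
  rw [Ex.ev_var, Ex.ev_var, h31, h34] at hv
  refine ⟨_, St.run_store ?_ hv, IsWordMul.nimStep K hm i hi k hk⟩
  simp (disch := omega) only [evs, Nat.reduceAdd, Nat.reduceEqDiff, hρ, h31, h34]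

theorem tab_update {m : ℕ → ℕ} {i k v : ℕ} (hk : k < p.S) (a : ℕ) {b : ℕ} (hb : b < p.S) :
    Function.update m (7 * p.B + (i * p.S + k)) v (7 * p.B + (a * p.S + b)) =
      if a = i ∧ b = k then v else m (7 * p.B + (a * p.S + b)) := by
  split_ifs with h
  · rw [h.1, h.2, Function.update_self]
  · rw [Function.update_of_ne]
    intro h'
    exact h (mul_add_inj hb hk (by omega))

/-- The table for words of `2 ^ (t + 1)` bits is built in place from the one for `2 ^ t` bits.
Initially one product, `1 * 1`, is stored, the other three being zero already. -/
theorem tableP_run (hρ : p.Env ρ) (h0 : ∀ a, 7 * p.B ≤ a → a < 8 * p.B → μ a = 0) :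
    Tab K p (tableP.run p.w 26 ρ μ) ∧ Off (7 * p.B) (8 * p.B) (tableP.run p.w 26 ρ μ) μ := by
  have hlin := p.lin
  have hSQ := p.S_mul_S
  have hj := p.hj
  have hS4 : 4 ≤ p.S := by
    rw [p.hS]
    calc 4 = 2 ^ 2 ^ 1 := rfl
      _ ≤ _ := Nat.pow_le_pow_right (by norm_num) (Nat.pow_le_pow_right (by norm_num) (by omega))
  have hSS : p.S + 1 < p.Q := by rw [← hSQ]; nlinarith
  have hjw : p.j < p.κ := by rw [p.hκ]; exact Nat.lt_two_pow_self
  have hjw2 : p.j < 2 ^ p.w := by omega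
  rw [tableP, St.run_seq, St.run_store (x := 7 * p.B + (p.S + 1)) (y := 1)
    (by simp (disch := omega) only [evs, Nat.reduceAdd, Nat.reduceEqDiff,
        hρ]) (by simp (disch := omega) only [evs, Nat.reduceAdd, Nat.reduceEqDiff])]
  refine St.run_loop (n := p.j - 2) (by simp (disch := omega) only [evs, Nat.reduceAdd,
      Nat.reduceEqDiff, hρ]) (by omega)
    (fun t m => TabAt K p t m ∧ Off (7 * p.B) (8 * p.B) m μ)
    ⟨?_, (Off.refl _ _ _).store (by omega) (by omega)⟩ ?_
  · intro a ha b hb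
    have h1 : a = 0 ∨ a = 1 := by norm_num at ha; omega
    have h2 : b = 0 ∨ b = 1 := by norm_num at hb; omega
    beta_reduce
    rw [show p.S + 1 = 1 * p.S + 1 by ring, tab_update (by omega) a (by omega)]
    split_ifs with h
    · rw [h.1, h.2]; simp [word_one]
    · have hle : a * p.S + b < p.B := by rcases h1 with rfl | rfl <;> omega
      rw [h0 _ (by omega) (by omega)]
      rcases h1 with rfl | rfl <;> rcases h2 with rfl | rfl <;> simp_all [word_zero]
  · rintro t ht m ⟨hm, hoff⟩
    have ht2 : 2 ^ t < p.κ := by rw [p.hκ]; exact Nat.pow_lt_pow_right (by norm_num) (by omega)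
    have hz2S : 2 ^ 2 ^ (t + 1) ≤ p.S := by
      rw [p.hS]
      exact Nat.pow_le_pow_right (by norm_num) (Nat.pow_le_pow_right (by norm_num) (by omega))
    have hzz : 2 ^ 2 ^ t * 2 ^ 2 ^ t = 2 ^ 2 ^ (t + 1) := by
      rw [← pow_add, ← two_mul, ← pow_succ']
    have hzle : 2 ^ 2 ^ t ≤ 2 ^ 2 ^ (t + 1) :=
      Nat.pow_le_pow_right (by norm_num) (Nat.pow_le_pow_right (by norm_num) (by omega))
    have hSQle : p.S ≤ p.Q := by omega
    rw [St.run_bind (v := 2 ^ 2 ^ t), St.run_bind (v := 2 ^ 2 ^ (t + 1))]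
    rotate_left
    · simp (disch := omega) only [evs, Nat.reduceAdd, Nat.reduceEqDiff, hzz]
    · simp (disch := omega) only [evs, Nat.reduceAdd, Nat.reduceEqDiff, one_mul]
    set z2 := 2 ^ 2 ^ (t + 1) with hz2
    let G : (ℕ → ℕ) → ℕ → ℕ → Prop := fun m a b =>
      m (7 * p.B + (a * p.S + b)) < z2 ∧
        word K (m (7 * p.B + (a * p.S + b))) = word K a * word K b
    have key : ∀ m', (TabAt K p t m' ∧ (∀ a < z2, ∀ b < z2, G m' a b) ∧
      Off (7 * p.B) (8 * p.B) m' μ) → TabAt K p (t + 1) m' ∧ Off (7 * p.B) (8 * p.B) m' μ :=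
      fun m' h => ⟨h.2.1, h.2.2⟩
    refine key _ ?_
    refine St.run_loop (n := z2) (by simp (disch := omega) only [evs, Nat.reduceAdd,
        Nat.reduceEqDiff]) (by omega)
      (fun i m => TabAt K p t m ∧
        (∀ a < i, ∀ b < z2, G m a b) ∧ Off (7 * p.B) (8 * p.B) m μ) ⟨hm, by simp, hoff⟩ ?_
    rintro i hi m₁ ⟨hm₁, hG₁, hoff₁⟩
    have key : ∀ m', (TabAt K p t m' ∧ (∀ a < i, ∀ b < z2, G m' a b) ∧ (∀ b < z2, G m' i b) ∧
      Off (7 * p.B) (8 * p.B) m' μ) → TabAt K p t m' ∧ (∀ a < i + 1, ∀ b < z2, G m' a b) ∧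
        Off (7 * p.B) (8 * p.B) m' μ := by
      intro m' h
      refine ⟨h.1, fun a ha b hb => ?_, h.2.2.2⟩
      rcases Nat.lt_succ_iff_lt_or_eq.1 ha with h' | rfl
      · exact h.2.1 a h' b hb
      · exact h.2.2.1 b hb
    refine key _ ?_
    refine St.run_loop (n := z2) (by simp (disch := omega) only [evs, Nat.reduceAdd,
        Nat.reduceEqDiff]) (by omega)
      (fun k m => TabAt K p t m ∧ (∀ a < i, ∀ b < z2, G m a b) ∧ (∀ b < k, G m i b) ∧
        Off (7 * p.B) (8 * p.B) m μ) ⟨hm₁, hG₁, by simp, hoff₁⟩ ?_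
    rintro k hk m₂ ⟨hm₂, hG₂, hk₂, hoff₂⟩
    have hik : i * p.S + k < p.Q := by rw [← hSQ]; nlinarith
    obtain ⟨v, hv, v1, v2⟩ := tab_store_run (K := K) (p := p) (t := t) (i := i) (k := k) (μ := m₂)
      (l := 37) (ρ := loopEnv 34 (loopEnv 31 (Function.update (Function.update
        (loopEnv 26 ρ (p.j - 2) t) 29 (2 ^ 2 ^ t)) 30 z2) z2 i) z2 k)
      ((((hρ.loopEnv (by norm_num)).update (by norm_num)).update
        (by norm_num)).loopEnv (by norm_num) |>.loopEnv (by norm_num)) hz2S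
      (by simp only [evs, Nat.reduceAdd, Nat.reduceEqDiff]) (by simp only [evs, Nat.reduceAdd,
          Nat.reduceEqDiff]) (by simp only [evs, Nat.reduceAdd, Nat.reduceEqDiff]) hi hk hm₂
    rw [hv]
    refine ⟨fun a ha b hb => ?_, fun a ha b hb => ?_, fun b hb => ?_,
      hoff₂.store (by omega) (by omega)⟩
    · beta_reduce
      rw [tab_update (by omega) a (by omega)]
      split_ifs with h
      · obtain ⟨rfl, rfl⟩ := h
        obtain ⟨o1, o2⟩ := hm₂ a ha b hb
        -- An entry of the smaller table is overwritten by itself, because words represent field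
        -- elements uniquely; so the smaller table stays valid during the filling.
        have : v = m₂ (7 * p.B + (a * p.S + b)) := word_injOn K (i := t + 1) v1
          (o1.trans_le hzle) (v2.trans o2.symm)
        rw [this]
        exact ⟨o1, o2⟩
      · exact hm₂ a ha b hb
    · simp only [G]
      rw [tab_update (by omega) a (by omega), if_neg (by omega)]
      exact hG₂ a ha b hb
    · simp only [G]
      rw [tab_update (by omega) i (by omega)]
      split_ifs with h
      · rw [h.2]; exact ⟨v1, v2⟩
      · exact hk₂ b (by omega)

/-- The top element is the word `2 ^ (κ - 1)`, by `word_top` and `cantor_top`; each lower one is the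
image of the next under `x ↦ x ^ 2 + x`. -/
theorem cantorP_run (hρ : p.Env ρ) (hT : Tab K p μ) :
    Rep K p (cantorP.run p.w 26 ρ μ) (8 * p.B) p.κ (cantor K p.j) ∧
      Off (8 * p.B) (9 * p.B) (cantorP.run p.w 26 ρ μ) μ := by
  have hlin := p.lin
  have hκ8 : 8 ≤ p.κ := by
    rw [p.hκ]; calc 8 = 2 ^ 3 := rfl
      _ ≤ _ := Nat.pow_le_pow_right (by norm_num) p.hj
  have hlt : 2 ^ (p.κ - 1) < 2 ^ p.κ := Nat.pow_lt_pow_right (by norm_num) (by omega)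
  rw [cantorP, St.run_seq, St.run_store (x := 8 * p.B + (p.κ - 1)) (y := 2 ^ (p.κ - 1))
    (by simp (disch := omega) only [evs, Nat.reduceAdd, Nat.reduceEqDiff,
        hρ]) (by simp (disch := omega) only [evs, Nat.reduceAdd, Nat.reduceEqDiff, hρ, one_mul])]
  have key : ∀ m, ((∀ k, p.κ - 1 - (p.κ - 1) ≤ k → k < p.κ → m (8 * p.B + k) < 2 ^ p.κ ∧
      word K (m (8 * p.B + k)) = cantor K p.j k) ∧ Off (8 * p.B) (9 * p.B) m μ) →
      Rep K p m (8 * p.B) p.κ (cantor K p.j) ∧ Off (8 * p.B) (9 * p.B) m μ :=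
    fun m h => ⟨fun k hk => h.1 k (by omega) hk, h.2⟩
  refine key _ ?_
  refine St.run_loop (n := p.κ - 1) (by simp (disch := omega) only [evs, Nat.reduceAdd,
      Nat.reduceEqDiff, hρ]) (by omega)
    (fun t m => (∀ k, p.κ - 1 - t ≤ k → k < p.κ → m (8 * p.B + k) < 2 ^ p.κ ∧
      word K (m (8 * p.B + k)) = cantor K p.j k) ∧ Off (8 * p.B) (9 * p.B) m μ)
    ⟨fun k h1 h2 => ?_, (Off.refl _ _ _).store (by omega) (by omega)⟩ ?_
  · obtain rfl : k = p.κ - 1 := by omega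
    rw [Function.update_self]
    refine ⟨hlt, ?_⟩
    rw [p.hκ, word_top, cantor_top]
  · rintro t ht m ⟨hm, hoff⟩
    have hT' := hT.off hoff (Or.inl le_rfl)
    set v := m (8 * p.B + (p.κ - 2 - t + 1)) with hv
    rw [St.run_bind (v := 8 * p.B + (p.κ - 2 - t)) (by simp (disch := omega) only [evs,
        Nat.reduceAdd, Nat.reduceEqDiff, hρ]),
      St.run_bind (v := v) (by simp (disch := omega) only [evs, Nat.reduceAdd, Nat.reduceEqDiff,
          hρ, hv, add_assoc])]
    have hv1 := hm (p.κ - 2 - t + 1) (by omega) (by omega)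
    rw [← hv] at hv1
    have hk := kmulE_ev (K := K) (p := p) (ρ := Function.update (Function.update
        (loopEnv 26 ρ (p.κ - 1) t) 29 (8 * p.B + (p.κ - 2 - t))) 30 v) (μ := m) (a := .var 30)
        (b := .var 30) (x := v) (y := v)
      (((hρ.loopEnv (by norm_num)).update (by norm_num)).update (by norm_num)) hT'
      (by simp only [evs, Nat.reduceAdd, Nat.reduceEqDiff]) (by simp only [evs, Nat.reduceAdd,
          Nat.reduceEqDiff]) hv1.1 hv1.1
    rw [St.run_store (x := 8 * p.B + (p.κ - 2 - t)) (by simp only [evs, Nat.reduceAdd,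
        Nat.reduceEqDiff])
      (by simp only [Ex.ev_xor, Ex.ev_var]; rfl)]
    refine ⟨fun k h1 h2 => ?_, hoff.store (by omega) (by omega)⟩
    by_cases h : k = p.κ - 2 - t
    · subst h
      rw [Function.update_self, Function.update_self]
      refine ⟨Nat.xor_lt_two_pow hk.1 hv1.1, ?_⟩
      have := cantor_succ K (j := p.j) (i := p.κ - 2 - t) (by rw [← p.hκ]; omega)
      rw [word_xor, hv1.2]
      refine Eq.trans ?_ this
      rw [sq, ← hv1.2]
      exact congrArg (· + _) hk.2
    · rw [Function.update_of_ne (by omega)]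
      exact hm k (by omega) h2

end Precomputation
end RazExtractor

namespace RazExtractor

/-! ### Points, coefficients of `sub i`, and the transforms as in-place loops -/

section Transform
set_option linter.unusedSectionVars false
set_option linter.unusedSimpArgs false
open Polynomial
variable {K : Type} [Field K] [CharP K 2] [IsAlgClosed K] {p : Par} {ρ μ : ℕ → ℕ}

/-- A loop computing an array entry by entry. -/
theorem rep_loop_run {e : Ex} {b : St} {l N a₀ : ℕ} {F : ℕ → K} (he : e.ev p.w ρ μ = N)
    (hN : N < 2 ^ p.w)
    (hb : ∀ i < N, ∀ m, Off a₀ (a₀ + i) m μ → ∃ v,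
      b.run p.w (l + 3) (loopEnv l ρ N i) m = Function.update m (a₀ + i) v ∧
        v < 2 ^ p.κ ∧ word K v = F i) :
    Rep K p ((St.loop e b).run p.w l ρ μ) a₀ N F ∧
      Off a₀ (a₀ + N) ((St.loop e b).run p.w l ρ μ) μ := by
  refine St.run_loop he hN (fun i m => Rep K p m a₀ i F ∧ Off a₀ (a₀ + i) m μ)
    ⟨fun k hk => absurd hk (by omega), Off.refl _ _ _⟩ ?_
  rintro i hi m ⟨hm, hoff⟩
  obtain ⟨v, hv, v1, v2⟩ := hb i hi m hoff
  rw [hv]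
  refine ⟨fun k hk => ?_, (hoff.mono le_rfl (by omega)).store (by omega) (by omega)⟩
  rcases Nat.lt_succ_iff_lt_or_eq.1 hk with h | rfl
  · rw [Function.update_of_ne (by omega)]; exact hm k h
  · rw [Function.update_self]; exact ⟨v1, v2⟩

/-- Doubling: `pt β (2 ^ i + t) = pt β t + β i` for `t < 2 ^ i`. -/
theorem pointsP_run (hρ : p.Env ρ) {β : ℕ → K} (hβ : Rep K p μ (8 * p.B) p.κ β) :
    Rep K p (pointsP.run p.w 26 ρ μ) (2 * p.B) (2 * p.D) (pt β) ∧
      Off (2 * p.B) (3 * p.B) (pointsP.run p.w 26 ρ μ) μ := by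
  have hlin := p.lin
  have hD := p.hD
  have h2D : 2 * p.D = 2 ^ (p.L + 1) := by rw [hD, pow_succ']
  rw [pointsP, St.run_seq, St.run_store (x := 2 * p.B) (y := 0)
    (by simp (disch := omega) only [evs, Nat.reduceAdd, Nat.reduceEqDiff,
        hρ]) (by simp (disch := omega) only [evs, Nat.reduceAdd, Nat.reduceEqDiff]), h2D]
  refine St.run_loop (n := p.L + 1) (by simp (disch := omega) only [evs, Nat.reduceAdd,
      Nat.reduceEqDiff, hρ]) (by omega)
    (fun i m => Rep K p m (2 * p.B) (2 ^ i) (pt β) ∧ Off (2 * p.B) (3 * p.B) m μ)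
    ⟨fun k hk => ?_, (Off.refl _ _ _).store (by omega) (by omega)⟩ ?_
  · obtain rfl : k = 0 := by simpa using hk
    rw [Nat.add_zero, Function.update_self]
    exact ⟨by positivity, by simp [word_zero, pt]⟩
  · rintro i hi m ⟨hm, hoff⟩
    have h2i : 2 ^ (i + 1) ≤ 2 * p.D := by
      rw [h2D]; exact Nat.pow_le_pow_right (by norm_num) (by omega)
    have h2i' : 2 ^ (i + 1) = 2 ^ i + 2 ^ i := by rw [pow_succ, mul_two]
    have hz0 : 0 < 2 ^ i := Nat.two_pow_pos i
    have hb := hβ i (by omega)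
    rw [← hoff _ (by omega)] at hb
    rw [St.run_bind (v := 2 ^ i) (by simp (disch := omega) only [evs, Nat.reduceAdd,
        Nat.reduceEqDiff, hρ, one_mul]),
      St.run_bind (v := m (8 * p.B + i)) (by simp (disch := omega) only [evs, Nat.reduceAdd,
          Nat.reduceEqDiff, hρ])]
    have h := rep_loop_run (K := K) (p := p) (μ := m) (e := .var 29)
      (b := .store (.var 8 + (.var 29 + .var 31)) (.ld (.var 8 + .var 31) ^^^ .var 30)) (l := 31)
      (ρ := Function.update (Function.update (loopEnv 26 ρ (p.L + 1) i) 29 (2 ^ i)) 30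
        (m (8 * p.B + i))) (N := 2 ^ i) (a₀ := 2 * p.B + 2 ^ i) (F := fun t => pt β (2 ^ i + t))
      (by simp only [evs, Nat.reduceAdd, Nat.reduceEqDiff]) (by omega)
      (by
        intro t ht m' hoff'
        have e := hoff' (2 * p.B + t) (by omega)
        refine ⟨m (2 * p.B + t) ^^^ m (8 * p.B + i), St.run_store
          (by simp (disch := omega) only [evs, Nat.reduceAdd, Nat.reduceEqDiff, hρ, add_assoc])
          (by simp (disch := omega) only [evs, Nat.reduceAdd, Nat.reduceEqDiff, hρ, e]),
          Nat.xor_lt_two_pow (hm t ht).1 hb.1, ?_⟩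
        rw [word_xor, (hm t ht).2, hb.2, Nat.add_comm (2 ^ i), pt, pt, bsum_add_two_pow _ ht])
    refine ⟨fun k hk => ?_, (h.2.mono (by omega) (by omega)).trans hoff⟩
    by_cases hk' : k < 2 ^ i
    · rw [h.2 _ (by omega)]; exact hm k hk'
    · have := h.1 (k - 2 ^ i) (by omega)
      beta_reduce at this
      rw [show 2 * p.B + 2 ^ i + (k - 2 ^ i) = 2 * p.B + k by omega,
        show 2 ^ i + (k - 2 ^ i) = k by omega] at this
      exact this

/-- A polynomial in the monomials `X ^ 2 ^ l` is stored as a bit mask, on which squaring is a shift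
by one. -/
theorem bsum_X_pow_sq (a : ℕ) : (bsum (fun l => (X : (ZMod 2)[X]) ^ 2 ^ l) a) ^ 2 =
    bsum (fun l => X ^ 2 ^ l) (a * 2) := by
  have h := bsum_shiftLeft (fun l => (X : (ZMod 2)[X]) ^ 2 ^ l) a 1
  rw [pow_one] at h
  rw [h, bsum, bsum, sum_pow_char]
  refine Finset.sum_congr rfl fun l _ => ?_
  split_ifs
  · rw [← pow_mul, pow_succ]
  · simp

/-- The array of coefficients of the polynomials `sub i`. -/
def SubCoeffs (p : Par) (μ : ℕ → ℕ) : Prop := ∀ i < p.L, μ (9 * p.B + i) < 2 ^ (i + 1) ∧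
  (μ (9 * p.B + i)).testBit i = true ∧
  bsum (fun l => (X : (ZMod 2)[X]) ^ 2 ^ l) (μ (9 * p.B + i)) = sub i

theorem coeffsP_run (hρ : p.Env ρ) :
    SubCoeffs p (coeffsP.run p.w 26 ρ μ) ∧
      Off (9 * p.B) (10 * p.B) (coeffsP.run p.w 26 ρ μ) μ := by
  have hlin := p.lin
  have hD := p.hD
  rw [coeffsP, St.run_seq, St.run_store (x := 9 * p.B) (y := 1)
    (by simp (disch := omega) only [evs, Nat.reduceAdd, Nat.reduceEqDiff,
        hρ]) (by simp (disch := omega) only [evs, Nat.reduceAdd, Nat.reduceEqDiff])]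
  have key : ∀ m, ((∀ i < p.L - 1 + 1, m (9 * p.B + i) < 2 ^ (i + 1) ∧
      (m (9 * p.B + i)).testBit i = true ∧
      bsum (fun l => (X : (ZMod 2)[X]) ^ 2 ^ l) (m (9 * p.B + i)) = sub i) ∧
      Off (9 * p.B) (10 * p.B) m μ) → SubCoeffs p m ∧ Off (9 * p.B) (10 * p.B) m μ :=
    fun m h => ⟨fun i hi => h.1 i (by omega), h.2⟩
  refine key _ ?_
  refine St.run_loop (n := p.L - 1) (by simp (disch := omega) only [evs, Nat.reduceAdd,
      Nat.reduceEqDiff, hρ]) (by omega)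
    (fun t m => (∀ i < t + 1, m (9 * p.B + i) < 2 ^ (i + 1) ∧
      (m (9 * p.B + i)).testBit i = true ∧
      bsum (fun l => (X : (ZMod 2)[X]) ^ 2 ^ l) (m (9 * p.B + i)) = sub i) ∧
      Off (9 * p.B) (10 * p.B) m μ) ⟨fun i hi => ?_, (Off.refl _ _ _).store (by omega) (by omega)⟩ ?_
  · obtain rfl : i = 0 := by omega
    rw [Nat.add_zero, Function.update_self]
    refine ⟨by norm_num, by simp, ?_⟩
    have := bsum_two_pow (fun l => (X : (ZMod 2)[X]) ^ 2 ^ l) 0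
    simpa [sub] using this
  · rintro t ht m ⟨hm, hoff⟩
    obtain ⟨h1, h2, h3⟩ := hm t (by omega)
    have hpow : 2 ^ (t + 1 + 1) ≤ p.D := by
      rw [hD]; exact Nat.pow_le_pow_right (by norm_num) (by omega)
    have hpow2 : 2 ^ (t + 1 + 1) = 2 * 2 ^ (t + 1) := by rw [pow_succ']
    set c := m (9 * p.B + t) with hc
    rw [St.run_bind (v := c) (by simp (disch := omega) only [evs, Nat.reduceAdd, Nat.reduceEqDiff,
        hρ, hc]),
      St.run_store (x := 9 * p.B + (t + 1)) (y := (c * 2) ^^^ c)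
        (by simp (disch := omega) only [evs, Nat.reduceAdd, Nat.reduceEqDiff,
            hρ]) (by simp (disch := omega) only [evs, Nat.reduceAdd, Nat.reduceEqDiff, pow_one])]
    refine ⟨fun i hi => ?_, hoff.store (by omega) (by omega)⟩
    by_cases h : i = t + 1
    · subst h
      rw [Function.update_self]
      refine ⟨Nat.xor_lt_two_pow (by omega) (by omega), ?_, ?_⟩
      · have e := Nat.testBit_mul_two_pow c (t + 1) 1
        rw [pow_one] at e
        rw [Nat.testBit_xor, e, Nat.testBit_lt_two_pow h1]
        simp [h2]
      · rw [bsum_xor (fun x => CharTwo.add_self_eq_zero x), ← bsum_X_pow_sq, h3]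
        rfl
    · rw [Function.update_of_ne (by omega)]
      exact hm i (by omega)

-- Common to both transforms: `F₁` and `F₂` give the outputs of a butterfly from the twiddle factor
-- and its two inputs. Butterflies of one level are disjoint, so they may be done in place; step `r
-- = b * 2 ^ i + t` treats the pair with offset `t` in block `b`.
set_option maxHeartbeats 1000000 in
theorem pairLoop_run (hρ : p.Env ρ) {ie : Ex} {body : St} {lev : ℕ → ℕ} {β : ℕ → K}
    {step : ℕ → (ℕ → K) → ℕ → K} {F₁ F₂ : K → K → K → K} {G : ℕ → ℕ → K}
    (hlev : ∀ n < p.L, lev n < p.L)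
    (hie : ∀ n < p.L, ∀ m, ie.ev p.w (loopEnv 26 ρ p.L n) m = lev n)
    (hE : Rep K p μ (2 * p.B) (2 * p.D) (pt β)) (hT : Tab K p μ)
    (hbody : ∀ ρ' m lo hi, p.Env ρ' → ρ' 35 = lo → ρ' 36 = hi → ρ' 37 < 2 ^ p.κ → Tab K p m →
      m lo < 2 ^ p.κ → m hi < 2 ^ p.κ → lo ≠ hi → hi < 2 * p.B →
      ∃ x y, body.run p.w 38 ρ' m = Function.update (Function.update m lo x) hi y ∧
        x < 2 ^ p.κ ∧ y < 2 ^ p.κ ∧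
        word K x = F₁ (word K (ρ' 37)) (word K (m lo)) (word K (m hi)) ∧
        word K y = F₂ (word K (ρ' 37)) (word K (m lo)) (word K (m hi)))
    (hstep : ∀ i g b t, t < 2 ^ i →
      step i g (2 * b * 2 ^ i + t) =
        F₁ (pt β (2 * b)) (g (2 * b * 2 ^ i + t)) (g ((2 * b + 1) * 2 ^ i + t)) ∧
      step i g ((2 * b + 1) * 2 ^ i + t) =
        F₂ (pt β (2 * b)) (g (2 * b * 2 ^ i + t)) (g ((2 * b + 1) * 2 ^ i + t)))
    (hG : ∀ n, G (n + 1) = step (lev n) (G n)) (h0 : Rep K p μ p.B (2 * p.D) (G 0)) :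
    Rep K p ((pairLoop ie body).run p.w 26 ρ μ) p.B (2 * p.D) (G p.L) ∧
      Off p.B (2 * p.B) ((pairLoop ie body).run p.w 26 ρ μ) μ := by
  have hlin := p.lin
  have hD := p.hD
  refine St.run_loop (n := p.L) (by simp (disch := omega) only [evs, Nat.reduceAdd,
      Nat.reduceEqDiff, hρ]) (by omega)
    (fun n m => Rep K p m p.B (2 * p.D) (G n) ∧ Off p.B (2 * p.B) m μ) ⟨h0, Off.refl _ _ _⟩ ?_
  rintro n hn m ⟨hm, hoff⟩
  set i := lev n with hi
  have hiL := hlev n hn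
  rw [← hi] at hiL
  have hz : 2 ^ i * 2 ≤ p.D := by
    rw [hD, ← pow_succ]; exact Nat.pow_le_pow_right (by norm_num) (by omega)
  have hz0 : 0 < 2 ^ i := Nat.two_pow_pos i
  rw [St.run_bind (hie n hn m), St.run_bind (v := 2 ^ i)
    (by simp (disch := omega) only [evs, Nat.reduceAdd, Nat.reduceEqDiff, hρ, ← hi, one_mul])]
  -- The array is described pair by pair, to say which pairs are done; by `exists_block` the pairs
  -- cover all indices.
  have key : ∀ m', ((∀ b t, t < 2 ^ i → (2 * b + 1) * 2 ^ i + t < 2 * p.D →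
      (m' (p.B + (2 * b * 2 ^ i + t)) < 2 ^ p.κ ∧ word K (m' (p.B + (2 * b * 2 ^ i + t))) =
        if b * 2 ^ i + t < p.D then G (n + 1) (2 * b * 2 ^ i + t) else G n (2 * b * 2 ^ i + t)) ∧
      (m' (p.B + ((2 * b + 1) * 2 ^ i + t)) < 2 ^ p.κ ∧
        word K (m' (p.B + ((2 * b + 1) * 2 ^ i + t))) =
        if b * 2 ^ i + t < p.D then G (n + 1) ((2 * b + 1) * 2 ^ i + t)
          else G n ((2 * b + 1) * 2 ^ i + t))) ∧
      Off p.B (2 * p.B) m' μ) → Rep K p m' p.B (2 * p.D) (G (n + 1)) ∧ Off p.B (2 * p.B) m' μ := by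
    rintro m' ⟨h, h'⟩
    refine ⟨fun k hk => ?_, h'⟩
    obtain ⟨e, he⟩ : ∃ e, p.L = i + 1 + e := ⟨p.L - (i + 1), by omega⟩
    have hDe : 2 * p.D = 2 * 2 ^ e * (2 * 2 ^ i) := by rw [hD, he, pow_add, pow_succ]; ring
    obtain ⟨b, t, ht, hbt⟩ := exists_block i k
    have e1 : b * 2 ^ (i + 1) + t = 2 * b * 2 ^ i + t := by rw [pow_succ]; ring
    have e2 : b * 2 ^ (i + 1) + t + 2 ^ i = (2 * b + 1) * 2 ^ i + t := by rw [pow_succ]; ring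
    have hb : b < 2 * 2 ^ e := by
      by_contra hcon
      have : 2 * 2 ^ e * (2 * 2 ^ i) ≤ b * (2 * 2 ^ i) := Nat.mul_le_mul_right _ (by omega)
      have : b * 2 ^ (i + 1) = b * (2 * 2 ^ i) := by rw [pow_succ']
      omega
    have hb' : (b + 1) * (2 * 2 ^ i) ≤ 2 * 2 ^ e * (2 * 2 ^ i) :=
      Nat.mul_le_mul_right _ (by omega)
    have hhi : (2 * b + 1) * 2 ^ i + t < 2 * p.D := by rw [hDe]; nlinarith
    have hlt : b * 2 ^ i + t < p.D := by nlinarith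
    have := h b t ht hhi
    rw [if_pos hlt, if_pos hlt] at this
    rcases hbt with rfl | rfl
    · rw [e1]; exact this.1
    · rw [e2]; exact this.2
  refine key _ ?_
  refine St.run_loop (n := p.D) (by simp (disch := omega) only [evs, Nat.reduceAdd,
      Nat.reduceEqDiff, hρ]) (by omega)
    (fun r m' => (∀ b t, t < 2 ^ i → (2 * b + 1) * 2 ^ i + t < 2 * p.D →
      (m' (p.B + (2 * b * 2 ^ i + t)) < 2 ^ p.κ ∧ word K (m' (p.B + (2 * b * 2 ^ i + t))) =
        if b * 2 ^ i + t < r then G (n + 1) (2 * b * 2 ^ i + t) else G n (2 * b * 2 ^ i + t)) ∧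
      (m' (p.B + ((2 * b + 1) * 2 ^ i + t)) < 2 ^ p.κ ∧
        word K (m' (p.B + ((2 * b + 1) * 2 ^ i + t))) =
        if b * 2 ^ i + t < r then G (n + 1) ((2 * b + 1) * 2 ^ i + t)
          else G n ((2 * b + 1) * 2 ^ i + t))) ∧
      Off p.B (2 * p.B) m' μ) ⟨fun b t ht hbt => ?_, hoff⟩ ?_
  · simp only [Nat.not_lt_zero, if_false]
    exact ⟨hm _ (by nlinarith), hm _ hbt⟩
  rintro r hr m' ⟨hI, hoff'⟩
  set b := r / 2 ^ i with hb
  set t := r % 2 ^ i with ht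
  have htlt : t < 2 ^ i := Nat.mod_lt _ hz0
  have hrbt : b * 2 ^ i + t = r := by rw [mul_comm]; exact Nat.div_add_mod r (2 ^ i)
  have hble : b ≤ r := Nat.div_le_self _ _
  have hhi : (2 * b + 1) * 2 ^ i + t < 2 * p.D := by
    obtain ⟨e, he⟩ : ∃ e, p.L = i + e := ⟨p.L - i, by omega⟩
    have hDe : p.D = 2 ^ e * 2 ^ i := by rw [hD, he, pow_add, mul_comm]
    have hb2 : b < 2 ^ e := by rw [hb, Nat.div_lt_iff_lt_mul hz0, ← hDe]; exact hr
    have : (b + 1) * 2 ^ i ≤ 2 ^ e * 2 ^ i := Nat.mul_le_mul_right _ (by omega)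
    nlinarith
  have hlo : b * (2 ^ i + 2 ^ i) = 2 * b * 2 ^ i := by ring
  have hhi' : 2 * b * 2 ^ i + t + 2 ^ i = (2 * b + 1) * 2 ^ i + t := by ring
  have hEb := hE (2 * b) (by omega)
  rw [← hoff' _ (by omega)] at hEb
  have h2b : b + b = 2 * b := by ring
  rw [St.run_bind (v := b) (by simp (disch := omega) only [evs, Nat.reduceAdd, Nat.reduceEqDiff, hρ]; rfl),
    St.run_bind (v := p.B + (2 * b * 2 ^ i + t))
      (by simp (disch := omega) only [evs, Nat.reduceAdd, Nat.reduceEqDiff, hρ, hlo, ← ht]),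
    St.run_bind (v := p.B + ((2 * b + 1) * 2 ^ i + t))
      (by simp (disch := omega) only [evs, Nat.reduceAdd, Nat.reduceEqDiff, hρ]; omega),
    St.run_bind (v := m' (2 * p.B + 2 * b))
      (by simp (disch := omega) only [evs, Nat.reduceAdd, Nat.reduceEqDiff, hρ, h2b])]
  obtain ⟨⟨c1, c2⟩, c3, c4⟩ := hI b t htlt hhi
  rw [if_neg (by omega)] at c2 c4
  obtain ⟨x, y, hxy, x1, y1, x2, y2⟩ := hbody
    (Function.update (Function.update (Function.update (Function.update
      (loopEnv 31 (Function.update (Function.update (loopEnv 26 ρ p.L n) 29 i) 30 (2 ^ i)) p.D r)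
        34 b) 35 (p.B + (2 * b * 2 ^ i + t))) 36 (p.B + ((2 * b + 1) * 2 ^ i + t)))
      37 (m' (2 * p.B + 2 * b))) m' (p.B + (2 * b * 2 ^ i + t)) (p.B + ((2 * b + 1) * 2 ^ i + t))
    ((((((((hρ.loopEnv (by norm_num)).update (by norm_num)).update (by norm_num)).loopEnv
      (by norm_num)).update (by norm_num)).update (by norm_num)).update (by norm_num)).update
        (by norm_num))
    (by simp only [evs, Nat.reduceAdd, Nat.reduceEqDiff]) (by simp only [evs, Nat.reduceAdd,
        Nat.reduceEqDiff]) (by simp only [evs, Nat.reduceAdd, Nat.reduceEqDiff]; exact hEb.1)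
    (hT.off hoff' (Or.inr (by omega))) c1 c3 (by omega) (by omega)
  have e37 : ∀ (ρ' : ℕ → ℕ) v, Function.update ρ' 37 v 37 = v := fun _ _ => Function.update_self _ _ _
  rw [e37, hEb.2, c2, c4] at x2 y2
  rw [hxy]
  obtain ⟨s1, s2⟩ := hstep i (G n) b t htlt
  rw [hi, ← hG] at s1 s2
  rw [← hi] at s1 s2
  refine ⟨fun b' t' ht' hbt' => ?_, (hoff'.store (by omega) (by omega)).store (by omega) (by omega)⟩
  by_cases h : b' * 2 ^ i + t' = r
  · obtain ⟨rfl, rfl⟩ := mul_add_inj ht' htlt (h.trans hrbt.symm)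
    rw [Function.update_self, Function.update_of_ne (by omega), Function.update_self,
      if_pos (by omega), if_pos (by omega)]
    exact ⟨⟨x1, x2.trans s1.symm⟩, y1, y2.trans s2.symm⟩
  · have hne : ¬ (b' = b ∧ t' = t) := by rintro ⟨rfl, rfl⟩; exact h hrbt
    have n1 : 2 * b' * 2 ^ i + t' ≠ 2 * b * 2 ^ i + t := fun h' => by
      have := mul_add_inj ht' htlt h'; omega
    have n2 : 2 * b' * 2 ^ i + t' ≠ (2 * b + 1) * 2 ^ i + t := fun h' => by
      have := mul_add_inj ht' htlt h'; omega
    have n3 : (2 * b' + 1) * 2 ^ i + t' ≠ 2 * b * 2 ^ i + t := fun h' => by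
      have := mul_add_inj ht' htlt h'; omega
    have n4 : (2 * b' + 1) * 2 ^ i + t' ≠ (2 * b + 1) * 2 ^ i + t := fun h' => by
      have := mul_add_inj ht' htlt h'; omega
    have hiff : b' * 2 ^ i + t' < r + 1 ↔ b' * 2 ^ i + t' < r := by omega
    rw [Function.update_of_ne (by omega), Function.update_of_ne (by omega),
      Function.update_of_ne (by omega), Function.update_of_ne (by omega)]
    simp only [hiff]
    exact hI b' t' ht' hbt'

theorem block_eq (b i t : ℕ) : b * 2 ^ (i + 1) + t = 2 * b * 2 ^ i + t ∧
    b * 2 ^ (i + 1) + t + 2 ^ i = (2 * b + 1) * 2 ^ i + t := by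
  constructor <;> rw [pow_succ] <;> ring

theorem fwdP_run (hρ : p.Env ρ) {β g : ℕ → K} [Algebra (ZMod 2) K] (hβ : β 0 = 1)
    (hE : Rep K p μ (2 * p.B) (2 * p.D) (pt β)) (hT : Tab K p μ)
    (hg : Rep K p μ p.B (2 * p.D) g) :
    Rep K p (fwdP.run p.w 26 ρ μ) p.B (2 * p.D) (fwdIter β p.L g p.L) ∧
      Off p.B (2 * p.B) (fwdP.run p.w 26 ρ μ) μ := by
  have hlin := p.lin
  refine pairLoop_run hρ (lev := fun n => p.L - 1 - n) (step := fwdStep β)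
    (F₁ := fun e x y => x + e * y) (F₂ := fun e x y => (x + e * y) + y) (G := fwdIter β p.L g)
    (fun n hn => by omega) (fun n hn m => by simp (disch := omega) only [evs, Nat.reduceAdd,
        Nat.reduceEqDiff, hρ]) hE hT ?_ ?_
    (fun n => rfl) hg
  · intro ρ' m lo hi hρ' hlo hhi he hT' h1 h2 hne hlt
    rw [St.run_bind (v := m hi) (by simp only [evs, Nat.reduceAdd, Nat.reduceEqDiff,
        hhi]), St.run_seq]
    have hk := kmulE_ev (K := K) (p := p) (ρ := Function.update ρ' 38 (m hi)) (μ := m)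
      (a := .var 37) (b := .var 38) (x := ρ' 37) (y := m hi) (hρ'.update (by norm_num)) hT'
      (by simp only [evs, Nat.reduceAdd, Nat.reduceEqDiff]) (by simp only [evs, Nat.reduceAdd,
          Nat.reduceEqDiff]) he h2
    set v := (kmulE (.var 37) (.var 38)).ev p.w (Function.update ρ' 38 (m hi)) m with hv
    rw [St.run_store (a := .var 35) (x := lo) (y := m lo ^^^ v) (by simp only [evs, Nat.reduceAdd,
        Nat.reduceEqDiff, hlo])
      (by simp only [evs, Nat.reduceAdd, Nat.reduceEqDiff, hlo,
          hv]), St.run_store (x := hi) (y := (m lo ^^^ v) ^^^ m hi)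
      (by simp only [evs, Nat.reduceAdd, Nat.reduceEqDiff, hhi]) (by simp only [evs, Nat.reduceAdd,
          Nat.reduceEqDiff, hlo])]
    have l1 := Nat.xor_lt_two_pow h1 hk.1
    refine ⟨_, _, rfl, l1, Nat.xor_lt_two_pow l1 h2, ?_, ?_⟩
    · rw [word_xor, hk.2]
    · rw [word_xor, word_xor, hk.2]
  · intro i g b t ht
    obtain ⟨e1, e2⟩ := block_eq b i t
    have := fwdStep_pair hβ g (b := b) ht
    rw [e2, e1] at this
    exact ⟨this.1, by rw [this.2, this.1]⟩

theorem invP_run (hρ : p.Env ρ) {β g : ℕ → K} [Algebra (ZMod 2) K]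
    (hE : Rep K p μ (2 * p.B) (2 * p.D) (pt β)) (hT : Tab K p μ)
    (hg : Rep K p μ p.B (2 * p.D) g) :
    Rep K p (invP.run p.w 26 ρ μ) p.B (2 * p.D) (invIter β g p.L) ∧
      Off p.B (2 * p.B) (invP.run p.w 26 ρ μ) μ := by
  have hlin := p.lin
  refine pairLoop_run hρ (lev := fun n => n) (step := invStep β)
    (F₁ := fun e x y => x + e * (x + y)) (F₂ := fun e x y => x + y) (G := invIter β g)
    (fun n hn => hn) (fun n hn m => by simp (disch := omega) only [evs, Nat.reduceAdd,
        Nat.reduceEqDiff, hρ]) hE hT ?_ ?_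
    (fun n => rfl) hg
  · intro ρ' m lo hi hρ' hlo hhi he hT' h1 h2 hne hlt
    rw [St.run_bind (v := m lo ^^^ m hi) (by simp only [evs, Nat.reduceAdd, Nat.reduceEqDiff, hlo,
        hhi]), St.run_seq]
    have l1 := Nat.xor_lt_two_pow h1 h2
    have hTm : Tab K p (Function.update m hi (m lo ^^^ m hi)) :=
      hT'.off (lo := hi) (hi := hi + 1) ((Off.refl _ _ _).store le_rfl (by omega))
        (Or.inr (by omega))
    have hk := kmulE_ev (K := K) (p := p) (ρ := Function.update ρ' 38 (m lo ^^^ m hi))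
      (μ := Function.update m hi (m lo ^^^ m hi))
      (a := .var 37) (b := .var 38) (x := ρ' 37) (y := m lo ^^^ m hi) (hρ'.update (by norm_num)) hTm
      (by simp only [evs, Nat.reduceAdd, Nat.reduceEqDiff]) (by simp only [evs, Nat.reduceAdd,
          Nat.reduceEqDiff]) he l1
    rw [St.run_store (a := .var 36) (x := hi) (y := m lo ^^^ m hi) (by simp only [evs,
        Nat.reduceAdd, Nat.reduceEqDiff, hhi])
      (by simp only [evs, Nat.reduceAdd, Nat.reduceEqDiff])]
    set v := (kmulE (.var 37) (.var 38)).ev p.w (Function.update ρ' 38 (m lo ^^^ m hi))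
      (Function.update m hi (m lo ^^^ m hi)) with hv
    rw [St.run_store (a := .var 35) (x := lo) (y := m lo ^^^ v) (by simp only [evs, Nat.reduceAdd,
        Nat.reduceEqDiff, hlo])
      (by simp only [evs, Nat.reduceAdd, Nat.reduceEqDiff, hlo, hv, hne])]
    -- The inverse butterfly stores its upper output first, opposite to the order in `pairLoop_run`.
    refine ⟨_, _, Function.update_comm (Ne.symm hne) _ _ _, Nat.xor_lt_two_pow h1 hk.1, l1, ?_, ?_⟩
    · rw [word_xor, hk.2, word_xor]
    · rw [word_xor]
  · intro i g b t ht
    obtain ⟨e1, e2⟩ := block_eq b i t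
    have := invStep_pair (β := β) g (b := b) ht
    rw [e2, e1] at this
    exact this

end Transform
end RazExtractor

namespace RazExtractor

/-! ### From the monomial basis to the novel basis -/

section Conversion
set_option linter.unusedSectionVars false
set_option linter.unusedSimpArgs false
open Polynomial

theorem bsum_two_mul_add_one {M : Type} [AddCommMonoid M] (f : ℕ → M) (b : ℕ) :
    bsum f (2 * b + 1) = bsum f (2 * b) + f 0 := by
  obtain ⟨N, hN⟩ : ∃ N, 2 * b + 1 < 2 ^ N := ⟨_, Nat.lt_two_pow_self⟩
  have hN' : 2 * b + 1 < 2 ^ (N + 1) := by rw [pow_succ]; omega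
  rw [bsum_eq f hN', bsum_eq f (show 2 * b < 2 ^ (N + 1) by omega), Finset.sum_range_succ',
    Finset.sum_range_succ']
  have h0 : (2 * b + 1).testBit 0 = true := by simp
  have h1 : (2 * b).testBit 0 = false := by simp
  rw [h0, h1, if_pos rfl, if_neg (by simp), add_zero]
  congr 1
  refine Finset.sum_congr rfl fun l _ => ?_
  rw [Nat.testBit_succ, Nat.testBit_succ, show (2 * b + 1) / 2 = 2 * b / 2 by omega]

theorem novel_odd (b i : ℕ) : novel ((2 * b + 1) * 2 ^ i) = novel (2 * b * 2 ^ i) * sub i := by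
  have h1 : ∀ k, novel (k * 2 ^ i) = bprod (fun l => sub (l + i)) k := fun k =>
    bsum_shiftLeft (M := Additive (ZMod 2)[X]) sub k i
  have h2 : bprod (fun l => sub (l + i)) (2 * b + 1) =
      bprod (fun l => sub (l + i)) (2 * b) * sub (0 + i) :=
    bsum_two_mul_add_one (M := Additive (ZMod 2)[X]) (fun l => sub (l + i)) b
  rw [h1, h1, h2, zero_add]

/-- The basis intermediate between monomials and the novel basis. -/
noncomputable def mixed (n k : ℕ) : (ZMod 2)[X] := X ^ (k % 2 ^ n) * novel (k / 2 ^ n * 2 ^ n)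

theorem mixed_zero (k : ℕ) : mixed 0 k = novel k := by simp [mixed, Nat.mod_one]

theorem mixed_top {n k : ℕ} (h : k < 2 ^ n) : mixed n k = X ^ k := by
  rw [mixed, Nat.mod_eq_of_lt h, Nat.div_eq_of_lt h, zero_mul, novel_zero, mul_one]

/-- Consecutive bases differ only in the upper halves of the blocks of length `2 ^ (i + 1)`. -/
theorem mixed_low {i t : ℕ} (b : ℕ) (ht : t < 2 ^ i) :
    mixed i (2 * b * 2 ^ i + t) = mixed (i + 1) (2 * b * 2 ^ i + t) := by
  obtain ⟨h1, -, h2, -, h3, -⟩ := block_div (b := b) ht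
  have e := (block_eq b i t).1
  have h4 : (b * 2 ^ (i + 1) + t) % 2 ^ (i + 1) = t := by
    rw [Nat.mul_add_mod_of_lt]; rw [pow_succ]; omega
  rw [e] at h1 h2 h3 h4
  rw [mixed, mixed, h1, h2, h3, h4]
  have := (block_eq b i 0).1
  rw [add_zero, add_zero] at this
  rw [this]

theorem mixed_high {i t : ℕ} (b : ℕ) (ht : t < 2 ^ i) :
    mixed i ((2 * b + 1) * 2 ^ i + t) = X ^ t * (novel (2 * b * 2 ^ i) * sub i) := by
  obtain ⟨-, h1, -, -, -, h3⟩ := block_div (b := b) ht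
  rw [(block_eq b i t).2] at h1 h3
  rw [mixed, h1, h3, novel_odd]

theorem mixed_succ {i t : ℕ} (b : ℕ) (ht : t < 2 ^ (i + 1)) :
    mixed (i + 1) (2 * b * 2 ^ i + t) = X ^ t * novel (2 * b * 2 ^ i) := by
  have e : 2 * b * 2 ^ i = b * 2 ^ (i + 1) := by rw [pow_succ]; ring
  have hp := Nat.two_pow_pos (i + 1)
  rw [mixed, e, Nat.mul_add_mod_of_lt ht, Nat.add_comm, Nat.add_mul_div_right _ _ hp,
    Nat.div_eq_of_lt ht, zero_add]

theorem sum_change {M : Type} [AddCommGroup M] {D k₀ : ℕ} (hk : k₀ < D) {a b : ℕ → M}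
    (h : ∀ k, k ≠ k₀ → a k = b k) :
    ∑ k ∈ Finset.range D, a k = ∑ k ∈ Finset.range D, b k + (a k₀ - b k₀) := by
  rw [← sub_eq_iff_eq_add', ← Finset.sum_sub_distrib]
  exact Finset.sum_eq_single_of_mem k₀ (Finset.mem_range.2 hk)
    fun k _ hne => sub_eq_zero.2 (h k hne)

theorem cast_xor_zmod_two (a b : ℕ) : ((a ^^^ b : ℕ) : ZMod 2) = a + b := by
  have h : (a ^^^ b) % 2 = (a + b) % 2 := by
    have := Nat.xor_mod_two_pow (a := a) (b := b) (n := 1)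
    rw [pow_one] at this
    rw [this, Nat.add_mod]
    rcases Nat.mod_two_eq_zero_or_one a with h1 | h1 <;>
      rcases Nat.mod_two_eq_zero_or_one b with h2 | h2 <;> rw [h1, h2] <;> rfl
  rw [← Nat.cast_add]
  exact (ZMod.natCast_eq_natCast_iff' _ _ _).2 h

/-- The position of the quotient coefficient treated at step `r` of level `i`. -/
def quotIdx (i r : ℕ) : ℕ := (2 * (r / 2 ^ i) + 1) * 2 ^ i + (2 ^ i - 1 - r % 2 ^ i)

theorem quotIdx_inj {i r b t : ℕ} (ht : t < 2 ^ i)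
    (h : quotIdx i r = (2 * b + 1) * 2 ^ i + t) : r / 2 ^ i = b ∧ r % 2 ^ i + t = 2 ^ i - 1 := by
  have hm := Nat.mod_lt r (Nat.two_pow_pos i)
  obtain ⟨h1, h2⟩ := mul_add_inj (by omega) ht h
  omega

open Classical in
/-- The basis in use after `r` steps of level `i`. -/
noncomputable def partBasis (i r k : ℕ) : (ZMod 2)[X] :=
  if ∃ r' < r, k = quotIdx i r' then mixed i k else mixed (i + 1) k

theorem partBasis_succ_of_ne {i r k : ℕ} (h : k ≠ quotIdx i r) :
    partBasis i (r + 1) k = partBasis i r k := by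
  have : (∃ r' < r + 1, k = quotIdx i r') ↔ ∃ r' < r, k = quotIdx i r' := by
    constructor
    · rintro ⟨r', h1, h2⟩
      refine ⟨r', ?_, h2⟩
      rcases Nat.lt_succ_iff_lt_or_eq.1 h1 with h3 | rfl
      · exact h3
      · exact absurd h2 h
    · rintro ⟨r', h1, h2⟩
      exact ⟨r', by omega, h2⟩
  simp only [partBasis, this]

/-- Within a block the quotient positions are treated from the top downwards, so everything up to
the current one still refers to the old basis. -/
theorem partBasis_unprocessed {i r s : ℕ} (hs : r % 2 ^ i + s ≤ 2 * 2 ^ i - 1) :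
    partBasis i r (2 * (r / 2 ^ i) * 2 ^ i + s) = X ^ s * novel (2 * (r / 2 ^ i) * 2 ^ i) := by
  have hz := Nat.two_pow_pos i
  have hs2 : s < 2 ^ (i + 1) := by rw [pow_succ]; omega
  rw [partBasis, if_neg, mixed_succ _ hs2]
  rintro ⟨r', h1, h2⟩
  by_cases hsz : s < 2 ^ i
  · have := (mul_add_inj hsz (by omega) h2).1
    omega
  · obtain ⟨t', rfl⟩ : ∃ t', s = 2 ^ i + t' := ⟨s - 2 ^ i, by omega⟩
    have e : 2 * (r / 2 ^ i) * 2 ^ i + (2 ^ i + t') = (2 * (r / 2 ^ i) + 1) * 2 ^ i + t' := by ring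
    obtain ⟨h3, h4⟩ := quotIdx_inj (by omega) (h2.symm.trans e)
    have h5 := Nat.div_add_mod r (2 ^ i)
    have h6 := Nat.div_add_mod r' (2 ^ i)
    rw [h3] at h6
    omega

theorem partBasis_processed {i r : ℕ} : partBasis i (r + 1) (quotIdx i r) =
    X ^ (2 ^ i - 1 - r % 2 ^ i) * (novel (2 * (r / 2 ^ i) * 2 ^ i) * sub i) := by
  have hz := Nat.two_pow_pos i
  rw [partBasis, if_pos ⟨r, by omega, rfl⟩, quotIdx, mixed_high _ (by omega)]

/-- The `2 ^ L / 2` steps visit every upper half of a block; on the lower halves the two bases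
agree. -/
theorem partBasis_end {i L k : ℕ} (hi : i < L) (hk : k < 2 ^ L) :
    partBasis i (2 ^ L / 2) k = mixed i k := by
  have hz := Nat.two_pow_pos i
  rw [partBasis]
  split_ifs with h
  · rfl
  obtain ⟨b, t, ht, hbt⟩ := exists_block i k
  obtain ⟨e1, e2⟩ := block_eq b i t
  rcases hbt with rfl | rfl
  · rw [e1, mixed_low b ht]
  · refine absurd ⟨b * 2 ^ i + (2 ^ i - 1 - t), ?_, ?_⟩ h
    · obtain ⟨e, rfl⟩ := Nat.exists_eq_add_of_le (Nat.succ_le_of_lt hi)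
      have h1 : 2 ^ (i.succ + e) = 2 * (2 ^ e * 2 ^ i) := by
        rw [Nat.succ_eq_add_one, pow_add, pow_succ]; ring
      have hb : b < 2 ^ e := by
        by_contra hcon
        have h2 : 2 ^ e * 2 ^ i ≤ b * 2 ^ i := Nat.mul_le_mul_right _ (by omega)
        have h3 : b * 2 ^ (i + 1) = 2 * (b * 2 ^ i) := by rw [pow_succ]; ring
        omega
      have h4 : (b + 1) * 2 ^ i ≤ 2 ^ e * 2 ^ i := Nat.mul_le_mul_right _ hb
      have h5 : (b + 1) * 2 ^ i = b * 2 ^ i + 2 ^ i := by ring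
      omega
    · rw [e2, quotIdx, Nat.mul_add_mod_of_lt (by omega), mul_comm b, Nat.mul_add_div hz,
        Nat.div_eq_of_lt (show 2 ^ i - 1 - t < 2 ^ i by omega), add_zero]
      congr 1
      omega

theorem partBasis_start (i k : ℕ) : partBasis i 0 k = mixed (i + 1) k := by
  rw [partBasis, if_neg]
  rintro ⟨r', h, -⟩
  omega

theorem sub_eq_sum {i c : ℕ} (hc : c < 2 ^ (i + 1)) (hi : c.testBit i = true)
    (hs : bsum (fun l => (X : (ZMod 2)[X]) ^ 2 ^ l) c = sub i) :
    sub i = ∑ l ∈ Finset.range i, (if c.testBit l then X ^ 2 ^ l else 0) + X ^ 2 ^ i := by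
  rw [← hs, bsum_eq _ hc, Finset.sum_range_succ, hi, if_pos rfl]

variable {p : Par} {ρ μ : ℕ → ℕ}

/-- The work array holds bits, the coefficients of `f` with respect to `m`. -/
def BitRep (p : Par) (μ : ℕ → ℕ) (m : ℕ → (ZMod 2)[X]) (f : (ZMod 2)[X]) : Prop :=
  (∀ k < p.D, μ (p.B + k) < 2) ∧
    ∑ k ∈ Finset.range p.D, C ((μ (p.B + k) : ℕ) : ZMod 2) * m k = f

theorem BitRep.congr {m m' : ℕ → (ZMod 2)[X]} {f : (ZMod 2)[X]} (h : BitRep p μ m f)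
    (hm : ∀ k < p.D, m k = m' k) : BitRep p μ m' f := by
  refine ⟨h.1, h.2 ▸ Finset.sum_congr rfl fun k hk => ?_⟩
  rw [hm k (Finset.mem_range.1 hk)]

theorem BitRep.xor {m : ℕ → (ZMod 2)[X]} {f : (ZMod 2)[X]} (h : BitRep p μ m f) {k c : ℕ}
    (hk : k < p.D) (hc : c < 2) :
    BitRep p (Function.update μ (p.B + k) (μ (p.B + k) ^^^ c)) m (f + C (c : ZMod 2) * m k) := by
  refine ⟨fun k' hk' => ?_, ?_⟩
  · by_cases h' : k' = k
    · subst h'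
      rw [Function.update_self]
      exact Nat.xor_lt_two_pow (n := 1) (h.1 _ hk) hc
    · rw [Function.update_of_ne (by omega)]; exact h.1 _ hk'
  · rw [sum_change (b := fun k => C ((μ (p.B + k) : ℕ) : ZMod 2) * m k) hk]
    · rw [h.2, Function.update_self, cast_xor_zmod_two, C_add]
      ring
    · intro k' h'
      rw [Function.update_of_ne (by omega)]

-- Each level divides all blocks by `sub i` in place. This polynomial has at most `i + 1` terms,
-- with exponents `2 ^ l`, so a quotient coefficient is treated with at most `i` additions.
set_option maxHeartbeats 1000000 in
theorem convP_run (hρ : p.Env ρ) (hC : SubCoeffs p μ) {f : (ZMod 2)[X]}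
    (hf : BitRep p μ (fun k => X ^ k) f) :
    BitRep p (convP.run p.w 26 ρ μ) novel f ∧
      Off p.B (2 * p.B) (convP.run p.w 26 ρ μ) μ := by
  have hlin := p.lin
  have hD := p.hD
  have key : ∀ m, (BitRep p m (mixed (p.L - p.L)) f ∧ Off p.B (2 * p.B) m μ) →
      BitRep p m novel f ∧ Off p.B (2 * p.B) m μ := fun m h =>
    ⟨h.1.congr fun k _ => by rw [Nat.sub_self, mixed_zero], h.2⟩
  refine key _ ?_
  refine St.run_loop (n := p.L) (by simp (disch := omega) only [evs, Nat.reduceAdd,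
      Nat.reduceEqDiff, hρ]) (by omega)
    (fun n m => BitRep p m (mixed (p.L - n)) f ∧ Off p.B (2 * p.B) m μ)
    ⟨hf.congr fun k hk => by rw [Nat.sub_zero, mixed_top (hD ▸ hk)], Off.refl _ _ _⟩ ?_
  rintro n hn m ⟨hm, hoff⟩
  set i := p.L - 1 - n with hi
  have hiL : i < p.L := by omega
  rw [show p.L - n = i + 1 by omega] at hm
  have hz : 2 ^ i * 2 ≤ p.D := by
    rw [hD, ← pow_succ]; exact Nat.pow_le_pow_right (by norm_num) (by omega)
  have hz0 : 0 < 2 ^ i := Nat.two_pow_pos i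
  obtain ⟨c1, c2, c3⟩ := hC i hiL
  rw [← hoff _ (by omega)] at c1 c2 c3
  set e := m (9 * p.B + i) with he
  rw [St.run_bind (v := i) (by simp (disch := omega) only [evs, Nat.reduceAdd, Nat.reduceEqDiff,
      hρ, ← hi]),
    St.run_bind (v := 2 ^ i) (by simp (disch := omega) only [evs, Nat.reduceAdd, Nat.reduceEqDiff,
        hρ, one_mul]),
    St.run_bind (v := e) (by simp (disch := omega) only [evs, Nat.reduceAdd, Nat.reduceEqDiff, hρ,
        ← he])]
  have key : ∀ m', (BitRep p m' (partBasis i (p.D / 2)) f ∧ Off p.B (2 * p.B) m' μ) →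
      BitRep p m' (mixed (p.L - (n + 1))) f ∧ Off p.B (2 * p.B) m' μ := fun m' h =>
    ⟨h.1.congr fun k hk => by
      rw [show p.L - (n + 1) = i by omega, hD, partBasis_end hiL (hD ▸ hk)], h.2⟩
  refine key _ ?_
  refine St.run_loop (n := p.D / 2) (by simp (disch := omega) only [evs, Nat.reduceAdd,
      Nat.reduceEqDiff, hρ]) (by omega)
    (fun r m' => BitRep p m' (partBasis i r) f ∧ Off p.B (2 * p.B) m' μ)
    ⟨hm.congr fun k _ => (partBasis_start i k).symm, hoff⟩ ?_
  rintro r hr m' ⟨hm', hoff'⟩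
  set b := r / 2 ^ i with hb
  have hrm := Nat.mod_lt r hz0
  have hrb : b * 2 ^ i + r % 2 ^ i = r := by rw [mul_comm]; exact Nat.div_add_mod r (2 ^ i)
  set t := 2 ^ i - 1 - r % 2 ^ i with ht
  have hq : quotIdx i r = 2 * b * 2 ^ i + (t + 2 ^ i) := by rw [quotIdx]; ring
  have hhi : 2 * b * 2 ^ i + 2 * 2 ^ i ≤ p.D := by
    obtain ⟨e, he⟩ : ∃ e, p.L = i + 1 + e := ⟨p.L - (i + 1), by omega⟩
    have hDe : p.D = 2 * (2 ^ e * 2 ^ i) := by rw [hD, he, pow_add, pow_succ]; ring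
    have hb2 : b < 2 ^ e := by rw [hb, Nat.div_lt_iff_lt_mul hz0]; omega
    have : (b + 1) * 2 ^ i ≤ 2 ^ e * 2 ^ i := Nat.mul_le_mul_right _ (by omega)
    nlinarith
  have hlo : b * (2 ^ i + 2 ^ i) = 2 * b * 2 ^ i := by ring
  have hble : b ≤ r := Nat.div_le_self _ _
  set v := m' (p.B + (2 * b * 2 ^ i + (t + 2 ^ i))) with hv
  have hv2 : v < 2 := hm'.1 _ (by omega)
  rw [St.run_bind (v := p.B + (2 * b * 2 ^ i + t))
      (by simp (disch := omega) only [evs, Nat.reduceAdd, Nat.reduceEqDiff, hρ, ← hb, hlo, ← ht]),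
    St.run_bind (v := v) (by simp (disch := omega) only [evs, Nat.reduceAdd, Nat.reduceEqDiff, hρ,
        hv, add_assoc])]
  set N := novel (2 * b * 2 ^ i) with hN
  have hpos : partBasis i r (2 * b * 2 ^ i + (t + 2 ^ i)) = X ^ (t + 2 ^ i) * N :=
    partBasis_unprocessed (by omega)
  have hpos' : partBasis i (r + 1) (2 * b * 2 ^ i + (t + 2 ^ i)) = X ^ t * (N * sub i) := by
    rw [← hq, partBasis_processed]
  -- The quotient coefficient `v` stays in its cell while its basis element changes from `X ^ (t + 2
  -- ^ i) * N` to `X ^ t * N * sub i`. The additions of `v` at the lower exponents of `sub i`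
  -- compensate for exactly this change.
  have key : ∀ m', (BitRep p m' (partBasis i r) (f + ∑ l ∈ Finset.range i,
      C ((if e.testBit l then v else 0 : ℕ) : ZMod 2) * (X ^ (t + 2 ^ l) * N)) ∧
      m' (p.B + (2 * b * 2 ^ i + (t + 2 ^ i))) = v ∧ Off p.B (2 * p.B) m' μ) →
      BitRep p m' (partBasis i (r + 1)) f ∧ Off p.B (2 * p.B) m' μ := by
    rintro m' ⟨⟨h1, h2⟩, h3, h4⟩
    refine ⟨⟨h1, ?_⟩, h4⟩
    rw [sum_change (k₀ := 2 * b * 2 ^ i + (t + 2 ^ i))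
      (b := fun k => C ((m' (p.B + k) : ℕ) : ZMod 2) * partBasis i r k) (by omega)
      (fun k hk => by rw [partBasis_succ_of_ne (hq ▸ hk)]), h2, h3, hpos, hpos', add_assoc]
    have hs := sub_eq_sum c1 c2 c3
    have hsum : ∑ l ∈ Finset.range i,
        C ((if e.testBit l then v else 0 : ℕ) : ZMod 2) * (X ^ (t + 2 ^ l) * N) =
        C (v : ZMod 2) * X ^ t * N *
          ∑ l ∈ Finset.range i, (if e.testBit l then X ^ 2 ^ l else 0) := by
      rw [Finset.mul_sum]
      refine Finset.sum_congr rfl fun l _ => ?_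
      split_ifs
      · ring
      · simp
    rw [hsum]
    have h5 := CharTwo.add_self_eq_zero (C (v : ZMod 2) * X ^ t * N * sub i)
    have h6 := CharTwo.add_self_eq_zero (C (v : ZMod 2) * (X ^ (t + 2 ^ i) * N))
    have h7 : ∑ l ∈ Finset.range i, (if e.testBit l then (X : (ZMod 2)[X]) ^ 2 ^ l else 0) =
        sub i - X ^ 2 ^ i := by rw [hs]; ring
    rw [h7]
    linear_combination h5 - h6
  refine key _ ?_
  refine St.run_loop (n := i) (by simp (disch := omega) only [evs, Nat.reduceAdd, Nat.reduceEqDiff,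
      hρ]) (by omega)
    (fun l m' => BitRep p m' (partBasis i r) (f + ∑ l ∈ Finset.range l,
      C ((if e.testBit l then v else 0 : ℕ) : ZMod 2) * (X ^ (t + 2 ^ l) * N)) ∧
      m' (p.B + (2 * b * 2 ^ i + (t + 2 ^ i))) = v ∧ Off p.B (2 * p.B) m' μ)
    ⟨by simpa using hm', hv.symm, hoff'⟩ ?_
  rintro l hl m'' ⟨h1, h2, h3⟩
  have hli : 2 ^ l < 2 ^ i := Nat.pow_lt_pow_right (by norm_num) hl
  have hl0 : 0 < 2 ^ l := Nat.two_pow_pos l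
  have hbit : (e >>> l &&& 1) * v = if e.testBit l then v else 0 := by
    rw [Nat.and_one_is_mod, Nat.shiftRight_eq_div_pow, Nat.testBit_eq_decide_div_mod_eq]
    rcases Nat.mod_two_eq_zero_or_one (e / 2 ^ l) with h | h <;> simp [h]
  have hbit2 : (if e.testBit l then v else 0) < 2 := by split_ifs <;> omega
  rw [St.run_bind (v := p.B + (2 * b * 2 ^ i + (t + 2 ^ l)))
      (by simp (disch := omega) only [evs, Nat.reduceAdd, Nat.reduceEqDiff, hρ, one_mul,
          add_assoc]),
    St.run_store (x := p.B + (2 * b * 2 ^ i + (t + 2 ^ l)))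
      (y := m'' (p.B + (2 * b * 2 ^ i + (t + 2 ^ l))) ^^^ (if e.testBit l then v else 0))
      (by simp (disch := omega) only [evs, Nat.reduceAdd, Nat.reduceEqDiff, hρ])
      (by
        simp (disch := omega) only [evs, Nat.reduceAdd, Nat.reduceEqDiff, hρ]
        rw [hbit])]
  refine ⟨?_, ?_, h3.store (by omega) (by omega)⟩
  · have := h1.xor (k := 2 * b * 2 ^ i + (t + 2 ^ l)) (by omega) hbit2
    rw [partBasis_unprocessed (by omega)] at this
    rw [Finset.sum_range_succ, ← add_assoc f]
    exact this
  · rw [Function.update_of_ne (by omega)]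
    exact h2

end Conversion
end RazExtractor

namespace RazExtractor

/-! ### Coefficients, values, and the loading of the modulus -/

section Arithmetic
set_option linter.unusedSectionVars false
set_option linter.unusedSimpArgs false
open Polynomial
variable {K : Type} [Field K] [CharP K 2] [IsAlgClosed K] [Algebra (ZMod 2) K] {p : Par}
  {ρ μ : ℕ → ℕ}

theorem Rep.of_eq {μ' : ℕ → ℕ} {a₀ N : ℕ} {f : ℕ → K} (h : Rep K p μ a₀ N f)
    (h' : ∀ k < N, μ' (a₀ + k) = μ (a₀ + k)) : Rep K p μ' a₀ N f := fun k hk => by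
  rw [h' k hk]; exact h k hk

theorem loopEnv_of_lt {k n i x : ℕ} (h : x < k) : loopEnv k ρ n i x = ρ x := by
  simp only [loopEnv, Function.update_apply]
  rw [if_neg (by omega), if_neg (by omega), if_neg (by omega)]

theorem kmulE_exists (hρ : p.Env ρ) (hT : Tab K p μ) {a b : Ex} {x y : ℕ} {f g : K}
    (ha : a.ev p.w ρ μ = x) (hb : b.ev p.w ρ μ = y) (hx : x < 2 ^ p.κ ∧ word K x = f)
    (hy : y < 2 ^ p.κ ∧ word K y = g) :
    ∃ v, (kmulE a b).ev p.w ρ μ = v ∧ v < 2 ^ p.κ ∧ word K v = f * g := by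
  have := kmulE_ev hρ hT ha hb hx.1 hy.1
  rw [hx.2, hy.2] at this
  exact ⟨_, rfl, this⟩

theorem word_bit {x : ℕ} (hx : x < 2) : word K x = algebraMap (ZMod 2) K (x : ZMod 2) := by
  interval_cases x
  · simp [word_zero]
  · simp [word_one]

variable (K p) in
/-- The array at `a₀` holds the values of `R` at the points of the transform. -/
def Vals (μ : ℕ → ℕ) (a₀ : ℕ) (R : (ZMod 2)[X]) : Prop :=
  Rep K p μ a₀ (2 * p.D) fun k => aeval (pt (cantor K p.j) k) R

variable (K p) in
/-- The multiplication table and the points of the transform are available. -/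
structure Ready (μ : ℕ → ℕ) : Prop where
  tab : Tab K p μ
  points : Rep K p μ (2 * p.B) (2 * p.D) (pt (cantor K p.j))

theorem Ready.of_eq {μ' : ℕ → ℕ} (h : Ready K p μ)
    (h2 : ∀ a, 2 * p.B ≤ a → a < 3 * p.B → μ' a = μ a)
    (h7 : ∀ a, 7 * p.B ≤ a → a < 8 * p.B → μ' a = μ a) : Ready K p μ' := by
  have := p.lin
  exact ⟨h.tab.of_eq h7, h.points.of_eq fun k hk => h2 _ (by omega) (by omega)⟩

theorem Ready.off {μ' : ℕ → ℕ} (h : Ready K p μ) (h' : Off p.B (2 * p.B) μ' μ) :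
    Ready K p μ' := by
  have := p.lin
  exact h.of_eq (fun a _ _ => h' a (by omega)) (fun a _ _ => h' a (by omega))

theorem cantor_step {i : ℕ} (hi : i < p.L) :
    cantor K p.j (i + 1) ^ 2 + cantor K p.j (i + 1) = cantor K p.j i :=
  cantor_succ K (by have := p.lin; rw [← p.hκ]; omega)

theorem fwdP_vals (hρ : p.Env ρ) (hr : Ready K p μ) {c : ℕ → ZMod 2} {R : (ZMod 2)[X]}
    (hR : R = ∑ t ∈ Finset.range p.D, C (c t) * novel t)
    (hU : Rep K p μ p.B (2 * p.D) fun k => algebraMap (ZMod 2) K (c (k % p.D))) :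
    Vals K p (fwdP.run p.w 26 ρ μ) p.B R ∧ Off p.B (2 * p.B) (fwdP.run p.w 26 ρ μ) μ := by
  obtain ⟨h1, h2⟩ := fwdP_run hρ (cantor_zero K p.j) hr.points hr.tab hU
  refine ⟨h1.congr fun k hk => ?_, h2⟩
  rw [p.hD] at hR hk
  refine fwdIter_eval (cantor_zero K p.j) (fun i hi => cantor_step hi) hR
    (by rw [pow_succ']; exact hk) fun j _ => ?_
  rw [p.hD]

/-- Only the half `s` has to hold values of a polynomial of degree below `D`; the other half may
hold anything. -/
theorem invP_coeffs (hρ : p.Env ρ) (hr : Ready K p μ) {c : ℕ → ZMod 2} {R : (ZMod 2)[X]}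
    (hR : R = ∑ t ∈ Finset.range p.D, C (c t) * novel t) {g : ℕ → K}
    (hU : Rep K p μ p.B (2 * p.D) g) {s : ℕ} (hs : s < 2)
    (hg : ∀ k, k / p.D = s → g k = aeval (pt (cantor K p.j) k) R) :
    Rep K p (invP.run p.w 26 ρ μ) (p.B + s * p.D) p.D (fun k => algebraMap (ZMod 2) K (c k)) ∧
      Off p.B (2 * p.B) (invP.run p.w 26 ρ μ) μ := by
  obtain ⟨h1, h2⟩ := invP_run hρ hr.points hr.tab hU
  refine ⟨?_, h2⟩
  have hs2 : s * p.D + p.D ≤ 2 * p.D := by interval_cases s <;> omega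
  have h3 : Rep K p (invP.run p.w 26 ρ μ) p.B (s * p.D + p.D) _ := h1.mono hs2
  refine Rep.congr (f := fun k => invIter (cantor K p.j) g p.L (s * p.D + k)) (fun k hk => by
    rw [add_assoc]; exact h3 _ (by omega)) fun k hk => ?_
  have hD0 : 0 < p.D := by omega
  have e1 : (s * p.D + k) / p.D = s := by
    rw [mul_comm, Nat.mul_add_div hD0, Nat.div_eq_of_lt hk, add_zero]
  have e2 : (s * p.D + k) % p.D = k := by rw [Nat.mul_add_mod_of_lt hk]
  rw [p.hD] at hR hg e1 e2 ⊢
  rw [invIter_eval (cantor_zero K p.j) (fun i hi => cantor_step hi) hR hs hg e1, e2]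

theorem dupUpP_run (hρ : p.Env ρ) {f : ℕ → K} (hf : Rep K p μ p.B p.D f) :
    Rep K p (dupUpP.run p.w 26 ρ μ) p.B (2 * p.D) (fun k => f (k % p.D)) ∧
      Off p.B (2 * p.B) (dupUpP.run p.w 26 ρ μ) μ := by
  have hlin := p.lin
  obtain ⟨h1, h2⟩ := fillP_run (w := p.w) (ρ := ρ) (μ := μ) (n := .var 18)
    (dst := .var 5 + .var 18) (src := .ld (.var 5 + .var 26)) (N := p.D) (a₀ := p.B + p.D)
    (s := fun i => μ (p.B + i)) (by simp only [evs, Nat.reduceAdd, Nat.reduceEqDiff, hρ]) (by omega)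
    (fun i m => by simp (disch := omega) only [evs, Nat.reduceAdd, Nat.reduceEqDiff, hρ])
    (fun i hi m hm => by simp (disch := omega) only [evs, Nat.reduceAdd, Nat.reduceEqDiff, hρ]; exact hm _ (by omega))
  refine ⟨fun k hk => ?_, h2.mono (by omega) (by omega)⟩
  by_cases hkD : k < p.D
  · beta_reduce
    rw [Nat.mod_eq_of_lt hkD, dupUpP, h2 _ (by omega)]
    exact hf k hkD
  · obtain ⟨i, rfl⟩ : ∃ i, k = p.D + i := ⟨k - p.D, by omega⟩
    beta_reduce
    rw [Nat.add_mod_left, Nat.mod_eq_of_lt (by omega), dupUpP, ← add_assoc, h1 _ (by omega)]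
    exact hf i (by omega)

theorem dupDownP_run (hρ : p.Env ρ) {f : ℕ → K} (hf : Rep K p μ (p.B + p.D) p.D f) :
    Rep K p (dupDownP.run p.w 26 ρ μ) p.B (2 * p.D) (fun k => f (k % p.D)) ∧
      Off p.B (2 * p.B) (dupDownP.run p.w 26 ρ μ) μ := by
  have hlin := p.lin
  obtain ⟨h1, h2⟩ := fillP_run (w := p.w) (ρ := ρ) (μ := μ) (n := .var 18)
    (dst := .var 5) (src := .ld (.var 5 + (.var 18 + .var 26))) (N := p.D) (a₀ := p.B)
    (s := fun i => μ (p.B + (p.D + i))) (by simp only [evs, Nat.reduceAdd, Nat.reduceEqDiff,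
        hρ]) (by omega)
    (fun i m => by simp (disch := omega) only [evs, Nat.reduceAdd, Nat.reduceEqDiff, hρ])
    (fun i hi m hm => by simp (disch := omega) only [evs, Nat.reduceAdd, Nat.reduceEqDiff, hρ]; exact hm _ (by omega))
  refine ⟨fun k hk => ?_, h2.mono (by omega) (by omega)⟩
  by_cases hkD : k < p.D
  · beta_reduce
    rw [Nat.mod_eq_of_lt hkD, dupDownP, h1 _ hkD, ← add_assoc]
    exact hf k hkD
  · obtain ⟨i, rfl⟩ : ∃ i, k = p.D + i := ⟨k - p.D, by omega⟩
    beta_reduce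
    rw [Nat.add_mod_left, Nat.mod_eq_of_lt (by omega), dupDownP, h2 _ (by omega), ← add_assoc]
    exact hf i (by omega)

theorem saveP_run (hρ : p.Env ρ) {dst a₀ : ℕ} (hdst : dst < 23) (ha : ρ dst = a₀)
    (h1 : 2 * p.B ≤ a₀) (h2 : a₀ ≤ 9 * p.B) {f : ℕ → K} (hf : Rep K p μ p.B (2 * p.D) f) :
    Rep K p ((saveP dst).run p.w 26 ρ μ) a₀ (2 * p.D) f ∧
      Off a₀ (a₀ + p.B) ((saveP dst).run p.w 26 ρ μ) μ := by
  have hlin := p.lin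
  obtain ⟨h3, h4⟩ := fillP_run (w := p.w) (ρ := ρ) (μ := μ) (n := .var 18 + .var 18)
    (dst := .var dst) (src := .ld (.var 5 + .var 26)) (N := 2 * p.D) (a₀ := a₀)
    (s := fun i => μ (p.B + i)) (by simp (disch := omega) only [evs, Nat.reduceAdd, Nat.reduceEqDiff, hρ]; omega) (by omega)
    (fun i m => by rw [Ex.ev_var, loopEnv_of_lt (by omega), ha])
    (fun i hi m hm => by simp (disch := omega) only [evs, Nat.reduceAdd, Nat.reduceEqDiff, hρ]; exact hm _ (by omega))
  refine ⟨fun k hk => ?_, h4.mono le_rfl (by omega)⟩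
  rw [saveP, h3 k hk]
  exact hf k hk

theorem evalP_run (hρ : p.Env ρ) (hr : Ready K p μ) {dst a₀ : ℕ} (hdst : dst < 23)
    (ha : ρ dst = a₀) (h1 : 2 * p.B ≤ a₀) (h2 : a₀ ≤ 9 * p.B) {R : (ZMod 2)[X]}
    (hR : BitRep p μ novel R) :
    Vals K p ((evalP dst).run p.w 26 ρ μ) a₀ R ∧
      ∀ a, (a < p.B ∨ 2 * p.B ≤ a) → (a < a₀ ∨ a₀ + p.B ≤ a) →
        (evalP dst).run p.w 26 ρ μ a = μ a := by
  have hlin := p.lin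
  rw [evalP, St.run_seq, St.run_seq]
  have h0 : Rep K p μ p.B p.D
      (fun k => algebraMap (ZMod 2) K ((μ (p.B + k) : ℕ) : ZMod 2)) := fun k hk => by
    have hb := hR.1 k hk
    refine ⟨hb.trans_le ?_, word_bit hb⟩
    exact Nat.le_self_pow (by omega) 2
  obtain ⟨d1, d2⟩ := dupUpP_run hρ h0
  obtain ⟨f1, f2⟩ := fwdP_vals hρ (hr.off d2) hR.2.symm d1
  obtain ⟨s1, s2⟩ := saveP_run hρ hdst ha h1 h2 f1
  exact ⟨s1, fun a h h' => (s2 a h').trans ((f2 a h).trans (d2 a h))⟩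

theorem clearP_run (hρ : p.Env ρ) : (∀ k < p.D, clearP.run p.w 26 ρ μ (p.B + k) = 0) ∧
    Off p.B (2 * p.B) (clearP.run p.w 26 ρ μ) μ := by
  have hlin := p.lin
  obtain ⟨h1, h2⟩ := fillP_run (w := p.w) (ρ := ρ) (μ := μ) (n := .var 18)
    (dst := .var 5) (src := 0) (N := p.D) (a₀ := p.B)
    (s := fun i => 0) (by simp only [evs, Nat.reduceAdd, Nat.reduceEqDiff, hρ]) (by omega)
    (fun i m => by simp (disch := omega) only [evs, Nat.reduceAdd, Nat.reduceEqDiff, hρ])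
    (fun i hi m hm => by simp (disch := omega) only [evs, Nat.reduceAdd, Nat.reduceEqDiff, hρ])
  exact ⟨h1, h2.mono le_rfl (by omega)⟩

theorem loadPolyP_run (hρ : p.Env ρ) (hC : SubCoeffs p μ) {P : (ZMod 2)[X]}
    (hP : P.natDegree = p.d)
    (hin : ∀ i ≤ p.d, μ (p.n₁ + (p.n₂ + i)) = (P.coeff i).val) :
    BitRep p (loadPolyP.run p.w 26 ρ μ) novel P ∧
      Off p.B (2 * p.B) (loadPolyP.run p.w 26 ρ μ) μ := by
  have hlin := p.lin
  rw [loadPolyP, St.run_seq, St.run_seq]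
  obtain ⟨c1, c2⟩ := clearP_run (μ := μ) hρ
  set m := clearP.run p.w 26 ρ μ with hm
  obtain ⟨h1, h2⟩ := fillP_run (w := p.w) (ρ := ρ) (μ := m) (n := .var 7 + 1)
    (dst := .var 5) (src := .ld (.var 0 + (.var 2 + .var 26))) (N := p.d + 1) (a₀ := p.B)
    (s := fun i => (P.coeff i).val) (by simp (disch := omega) only [evs, Nat.reduceAdd,
        Nat.reduceEqDiff, hρ]) (by omega)
    (fun i m => by simp (disch := omega) only [evs, Nat.reduceAdd, Nat.reduceEqDiff, hρ])
    (fun i hi m' hm' => by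
      simp (disch := omega) only [evs, Nat.reduceAdd, Nat.reduceEqDiff, hρ]
      rw [hm' _ (by omega), c2 _ (by omega), hin i (by omega)])
  set m' := (fillP (.var 7 + 1) (.var 5) (.ld (.var 0 + (.var 2 + .var 26)))).run p.w 26 ρ m
  have h2' : Off p.B (2 * p.B) m' m := h2.mono le_rfl (by omega)
  have hcell : ∀ k < p.D, m' (p.B + k) = (P.coeff k).val := by
    intro k hk
    by_cases hkd : k < p.d + 1
    · exact h1 k hkd
    · rw [h2 _ (by omega), c1 k hk, coeff_eq_zero_of_natDegree_lt (by omega)]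
      rfl
  have hb : BitRep p m' (fun k => X ^ k) P := by
    refine ⟨fun k hk => ?_, ?_⟩
    · rw [hcell k hk]; exact ZMod.val_lt _
    · rw [P.as_sum_range_C_mul_X_pow' (n := p.D) (by omega)]
      refine Finset.sum_congr rfl fun k hk => ?_
      rw [hcell k (Finset.mem_range.1 hk), ZMod.natCast_zmod_val]
  have hC' : SubCoeffs p m' := fun i hi => by
    rw [h2' _ (by omega), c2 _ (by omega)]; exact hC i hi
  obtain ⟨v1, v2⟩ := convP_run hρ hC' hb
  exact ⟨v1, v2.trans (h2'.trans c2)⟩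

end Arithmetic
end RazExtractor

namespace RazExtractor

/-! ### Loading the sources and inverting the values of the modulus -/

section Multiplication
set_option linter.unusedSectionVars false
set_option linter.unusedSimpArgs false
open Polynomial
variable {K : Type} [Field K] [CharP K 2] [IsAlgClosed K] [Algebra (ZMod 2) K] {p : Par}
  {ρ μ : ℕ → ℕ}

/-- The polynomial with given coefficients in the novel basis. -/
noncomputable def ofCoeffs (D : ℕ) (c : ℕ → ZMod 2) : (ZMod 2)[X] :=
  ∑ t ∈ Finset.range D, C (c t) * novel t

theorem loadAP_run (hρ : p.Env ρ) (ha : ∀ k < p.n₁ / 2, μ k < 2)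
    (hy : ∀ k < p.n₂, μ (p.n₁ + k) < 2) :
    BitRep p (loadAP.run p.w 26 ρ μ) novel (ofCoeffs p.D fun k =>
        ((if k < p.n₁ / 2 then μ k else 0 : ℕ) : ZMod 2) +
        ((if k < p.n₂ then μ (p.n₁ + k) else 0 : ℕ) : ZMod 2)) ∧
      Off p.B (2 * p.B) (loadAP.run p.w 26 ρ μ) μ := by
  have hlin := p.lin
  rw [loadAP, St.run_seq, St.run_seq]
  obtain ⟨c1, c2⟩ := clearP_run (μ := μ) hρ
  set m := clearP.run p.w 26 ρ μ with hm
  obtain ⟨h1, h2⟩ := fillP_run (w := p.w) (ρ := ρ) (μ := m) (n := .var 6)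
    (dst := .var 5) (src := .ld (.var 26)) (N := p.n₁ / 2) (a₀ := p.B)
    (s := fun i => μ i) (by simp only [evs, Nat.reduceAdd, Nat.reduceEqDiff, hρ]) (by omega)
    (fun i m => by simp (disch := omega) only [evs, Nat.reduceAdd, Nat.reduceEqDiff, hρ])
    (fun i hi m' hm' => by
      simp (disch := omega) only [evs, Nat.reduceAdd, Nat.reduceEqDiff, hρ]
      rw [hm' _ (by omega), c2 _ (by omega)])
  set m' := (fillP (.var 6) (.var 5) (.ld (.var 26))).run p.w 26 ρ m
  obtain ⟨h3, h4⟩ := fillP_run (w := p.w) (ρ := ρ) (μ := m') (n := .var 2)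
    (dst := .var 5) (src := .ld (.var 5 + .var 26) ^^^ .ld (.var 0 + .var 26)) (N := p.n₂)
    (a₀ := p.B) (s := fun i => μ i ^^^ μ (p.n₁ + i)) (by simp only [evs, Nat.reduceAdd,
        Nat.reduceEqDiff, hρ]) (by omega)
    (fun i m => by simp (disch := omega) only [evs, Nat.reduceAdd, Nat.reduceEqDiff, hρ])
    (fun i hi m'' hm'' => by
      simp (disch := omega) only [evs, Nat.reduceAdd, Nat.reduceEqDiff, hρ]
      rw [hm'' _ (by omega), h1 _ (by omega), hm'' _ (by omega), h2 _ (by omega),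
        c2 _ (by omega)])
  set m'' := (fillP (.var 2) (.var 5) (.ld (.var 5 + .var 26) ^^^ .ld (.var 0 + .var 26))).run
    p.w 26 ρ m'
  have hcell : ∀ k < p.D, m'' (p.B + k) = (if k < p.n₁ / 2 then μ k else 0) ^^^
      (if k < p.n₂ then μ (p.n₁ + k) else 0) := by
    intro k hk
    by_cases hk2 : k < p.n₂
    · rw [h3 k hk2, if_pos hk2, if_pos (by omega)]
    · rw [h4 _ (by omega), if_neg hk2, Nat.xor_zero]
      split_ifs with hk1
      · rw [h1 k hk1]
      · rw [h2 _ (by omega), c1 k hk]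
  refine ⟨⟨fun k hk => ?_, ?_⟩, (h4.mono le_rfl (by omega)).trans
    ((h2.mono le_rfl (by omega)).trans c2)⟩
  · rw [hcell k hk]
    refine Nat.xor_lt_two_pow (n := 1) ?_ ?_ <;> split_ifs with hlt
    · exact ha k hlt
    · norm_num
    · exact hy k hlt
    · norm_num
  · refine Finset.sum_congr rfl fun k hk => ?_
    rw [hcell k (Finset.mem_range.1 hk), cast_xor_zmod_two]

theorem loadBP_run (hρ : p.Env ρ) (hb : ∀ k < p.d, μ (p.n₁ / 2 + k) < 2) :
    BitRep p (loadBP.run p.w 26 ρ μ) novel (ofCoeffs p.D fun k =>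
        ((if k < p.d then μ (p.n₁ / 2 + k) else 0 : ℕ) : ZMod 2)) ∧
      Off p.B (2 * p.B) (loadBP.run p.w 26 ρ μ) μ := by
  have hlin := p.lin
  rw [loadBP, St.run_seq]
  obtain ⟨c1, c2⟩ := clearP_run (μ := μ) hρ
  set m := clearP.run p.w 26 ρ μ with hm
  obtain ⟨h1, h2⟩ := fillP_run (w := p.w) (ρ := ρ) (μ := m) (n := .var 7)
    (dst := .var 5) (src := .ld (.var 6 + .var 26)) (N := p.d) (a₀ := p.B)
    (s := fun i => μ (p.n₁ / 2 + i)) (by simp only [evs, Nat.reduceAdd, Nat.reduceEqDiff,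
        hρ]) (by omega)
    (fun i m => by simp (disch := omega) only [evs, Nat.reduceAdd, Nat.reduceEqDiff, hρ])
    (fun i hi m' hm' => by
      simp (disch := omega) only [evs, Nat.reduceAdd, Nat.reduceEqDiff, hρ]
      rw [hm' _ (by omega), c2 _ (by omega)])
  set m' := (fillP (.var 7) (.var 5) (.ld (.var 6 + .var 26))).run p.w 26 ρ m
  have hcell : ∀ k < p.D, m' (p.B + k) = if k < p.d then μ (p.n₁ / 2 + k) else 0 := by
    intro k hk
    split_ifs with hkd
    · exact h1 k hkd
    · rw [h2 _ (by omega), c1 k hk]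
  refine ⟨⟨fun k hk => ?_, ?_⟩, (h2.mono le_rfl (by omega)).trans c2⟩
  · rw [hcell k hk]
    split_ifs with hlt
    · exact hb k hlt
    · norm_num
  · refine Finset.sum_congr rfl fun k hk => ?_
    rw [hcell k (Finset.mem_range.1 hk)]

/-- Inversion as the power `2 ^ κ - 2`, the product of the repeated squares `f ^ 2 ^ t` for `1 ≤ t <
κ`. The scratch cell `10 * B + 2` holds the current square. -/
theorem invertP_run (hρ : p.Env ρ) (hr : Ready K p μ) {f : ℕ → K}
    (hf : Rep K p μ (3 * p.B) (2 * p.D) f) (hf0 : ∀ k < 2 * p.D, f k ≠ 0) :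
    Rep K p (invertP.run p.w 26 ρ μ) (4 * p.B) (2 * p.D) (fun k => (f k)⁻¹) ∧
      ∀ a, (a < 4 * p.B ∨ 5 * p.B ≤ a) → a ≠ 10 * p.B + 2 → invertP.run p.w 26 ρ μ a = μ a := by
  have hlin := p.lin
  refine St.run_loop (n := 2 * p.D) (by simp (disch := omega) only [evs, Nat.reduceAdd, Nat.reduceEqDiff, hρ]; omega) (by omega)
    (fun i m => Rep K p m (4 * p.B) i (fun k => (f k)⁻¹) ∧
      ∀ a, (a < 4 * p.B ∨ 5 * p.B ≤ a) → a ≠ 10 * p.B + 2 → m a = μ a)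
    ⟨fun k hk => absurd hk (by omega), fun _ _ _ => rfl⟩ ?_
  rintro i hi m ⟨hm, hoff⟩
  have hfi := hf i hi
  rw [← hoff _ (by omega) (by omega)] at hfi
  rw [St.run_seq, St.run_store (x := 4 * p.B + i) (y := 1)
    (by simp (disch := omega) only [evs, Nat.reduceAdd, Nat.reduceEqDiff,
        hρ]) (by simp (disch := omega) only [evs, Nat.reduceAdd, Nat.reduceEqDiff, hρ])]
  rw [St.run_seq, St.run_store (x := 10 * p.B + 2) (y := m (3 * p.B + i))
    (by simp (disch := omega) only [evs, Nat.reduceAdd, Nat.reduceEqDiff, hρ])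
    (by
      simp (disch := omega) only [evs, Nat.reduceAdd, Nat.reduceEqDiff, hρ]
      rw [if_neg (by omega)])]
  have key : ∀ m', ((m' (4 * p.B + i) < 2 ^ p.κ ∧
        word K (m' (4 * p.B + i)) = f i ^ (2 ^ (p.κ - 1 + 1) - 2)) ∧
      (m' (10 * p.B + 2) < 2 ^ p.κ ∧ word K (m' (10 * p.B + 2)) = f i ^ 2 ^ (p.κ - 1)) ∧
      ∀ a, a ≠ 4 * p.B + i → a ≠ 10 * p.B + 2 → m' a = m a) →
      Rep K p m' (4 * p.B) (i + 1) (fun k => (f k)⁻¹) ∧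
      ∀ a, (a < 4 * p.B ∨ 5 * p.B ≤ a) → a ≠ 10 * p.B + 2 → m' a = μ a := by
    rintro m' ⟨⟨h1, h2⟩, -, h3⟩
    refine ⟨fun k hk => ?_, fun a ha ha' => by rw [h3 a (by omega) ha', hoff a ha ha']⟩
    rcases Nat.lt_succ_iff_lt_or_eq.1 hk with hk' | rfl
    · rw [h3 _ (by omega) (by omega)]; exact hm k hk'
    · refine ⟨h1, h2.trans ?_⟩
      rw [Nat.sub_add_cancel (by omega)]
      have hfr : f k ^ 2 ^ p.κ = f k := by
        rw [← hfi.2, p.hκ]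
        refine word_pow_card K ?_
        rw [← p.hκ]; exact hfi.1
      have h4 : 4 ≤ 2 ^ p.κ := by
        calc 4 = 2 ^ 2 := rfl
          _ ≤ _ := Nat.pow_le_pow_right (by norm_num) (by omega)
      have h5 : f k ^ (2 ^ p.κ - 2) * (f k * f k) = f k := by
        rw [← sq, ← pow_add, Nat.sub_add_cancel (by omega), hfr]
      have h6 := hf0 k hi
      field_simp
      apply mul_right_cancel₀ h6
      linear_combination h5
  refine key _ ?_
  have h1w : 1 < 2 ^ p.κ := Nat.one_lt_two_pow (by omega)
  refine St.run_loop (n := p.κ - 1) (by simp (disch := omega) only [evs, Nat.reduceAdd,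
      Nat.reduceEqDiff, hρ]) (by omega)
    (fun t m' => (m' (4 * p.B + i) < 2 ^ p.κ ∧
        word K (m' (4 * p.B + i)) = f i ^ (2 ^ (t + 1) - 2)) ∧
      (m' (10 * p.B + 2) < 2 ^ p.κ ∧ word K (m' (10 * p.B + 2)) = f i ^ 2 ^ t) ∧
      ∀ a, a ≠ 4 * p.B + i → a ≠ 10 * p.B + 2 → m' a = m a) ⟨?_, ?_, ?_⟩ ?_
  · rw [Function.update_of_ne (by omega), Function.update_self]
    exact ⟨h1w, by simp [word_one]⟩
  · rw [Function.update_self]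
    exact ⟨hfi.1, by rw [hfi.2]; simp⟩
  · intro a h1 h2
    rw [Function.update_of_ne h2, Function.update_of_ne h1]
  rintro t ht m' ⟨h1, h2, h3⟩
  have hE := (hρ.loopEnv (k := 26) (v := 2 * p.D) (i := i) (by norm_num)).loopEnv (k := 29)
    (v := p.κ - 1) (i := t) (by norm_num)
  have hTm' : Tab K p m' := hr.tab.of_eq fun a h h' => by
    rw [h3 a (by omega) (by omega), hoff a (by omega) (by omega)]
  set y := m' (10 * p.B + 2) with hy
  rw [St.run_bind (v := y) (by simp (disch := omega) only [evs, Nat.reduceAdd, Nat.reduceEqDiff,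
      hρ, hy])]
  obtain ⟨v, hv, v1, v2⟩ := kmulE_exists (K := K) (p := p) (μ := m') (x := y) (y := y)
    (a := .var 32) (b := .var 32)
    (hE.update (i := 32) (v := y) (by norm_num)) hTm' (by simp only [evs, Nat.reduceAdd,
        Nat.reduceEqDiff]) (by simp only [evs, Nat.reduceAdd, Nat.reduceEqDiff]) h2 h2
  rw [St.run_bind hv, St.run_seq, St.run_store (a := .var 16 + 2) (x := 10 * p.B + 2) (y := v)
    (by simp (disch := omega) only [evs, Nat.reduceAdd, Nat.reduceEqDiff, hρ]) (by simp only [evs,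
        Nat.reduceAdd, Nat.reduceEqDiff])]
  set z := m' (4 * p.B + i) with hz
  have hzz : Function.update m' (10 * p.B + 2) v (4 * p.B + i) = z := by
    rw [Function.update_of_ne (by omega)]
  rw [St.run_bind (v := z) (by
    simp (disch := omega) only [evs, Nat.reduceAdd, Nat.reduceEqDiff, hρ]
    rw [if_neg (by omega)])]
  obtain ⟨u, hu, u1, u2⟩ := kmulE_exists (K := K) (p := p)
    (μ := Function.update m' (10 * p.B + 2) v) (x := z) (y := v)
    (a := .var 34) (b := .var 33)
    (((hE.update (i := 32) (v := y) (by norm_num)).update (i := 33) (v := v)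
      (by norm_num)).update (i := 34) (v := z) (by norm_num))
    (hTm'.of_eq fun a h h' => Function.update_of_ne (by omega) _ _)
    (by simp only [evs, Nat.reduceAdd, Nat.reduceEqDiff]) (by simp only [evs, Nat.reduceAdd,
        Nat.reduceEqDiff]) h1 ⟨v1, v2⟩
  rw [St.run_store (x := 4 * p.B + i) (by simp (disch := omega) only [evs, Nat.reduceAdd,
      Nat.reduceEqDiff, hρ]) hu]
  refine ⟨?_, ?_, fun a ha ha' => ?_⟩
  · rw [Function.update_self]
    refine ⟨u1, u2.trans ?_⟩
    rw [← pow_add, ← pow_add]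
    congr 1
    have : 2 ^ (t + 1) = 2 ^ t + 2 ^ t := by rw [pow_succ, mul_two]
    have : 2 ^ (t + 1 + 1) = 2 ^ (t + 1) + 2 ^ (t + 1) := by rw [pow_succ 2 (t + 1), mul_two]
    have := Nat.two_pow_pos t
    omega
  · rw [Function.update_of_ne (by omega), Function.update_self]
    refine ⟨v1, v2.trans ?_⟩
    rw [← pow_add, pow_succ, mul_two]
  · rw [Function.update_of_ne ha, Function.update_of_ne ha']
    exact h3 a ha ha'

/-- What the multiplication needs. -/
structure MulReady (K : Type) [Field K] [CharP K 2] [IsAlgClosed K] [Algebra (ZMod 2) K] (p : Par)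
    (P : (ZMod 2)[X]) (μ : ℕ → ℕ) : Prop extends Ready K p μ where
  modulus : Vals K p μ (3 * p.B) P
  inverse : Rep K p μ (4 * p.B) (2 * p.D) fun k => (aeval (pt (cantor K p.j) k) P)⁻¹

theorem MulReady.of_eq {P : (ZMod 2)[X]} {μ' : ℕ → ℕ} (h : MulReady K p P μ)
    (h2 : ∀ a, 2 * p.B ≤ a → a < 5 * p.B → μ' a = μ a)
    (h7 : ∀ a, 7 * p.B ≤ a → a < 8 * p.B → μ' a = μ a) : MulReady K p P μ' := by
  have := p.lin
  exact ⟨h.toReady.of_eq (fun a _ _ => h2 a (by omega) (by omega)) h7,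
    h.modulus.of_eq fun k hk => h2 _ (by omega) (by omega),
    h.inverse.of_eq fun k hk => h2 _ (by omega) (by omega)⟩

theorem MulReady.off {P : (ZMod 2)[X]} {μ' : ℕ → ℕ} (h : MulReady K p P μ)
    (h' : Off p.B (2 * p.B) μ' μ) : MulReady K p P μ' := by
  have := p.lin
  exact h.of_eq (fun a _ _ => h' a (by omega)) (fun a _ _ => h' a (by omega))

theorem Vals.off {μ' : ℕ → ℕ} {R : (ZMod 2)[X]} {a₀ : ℕ} (h : Vals K p μ a₀ R)
    (h' : Off p.B (2 * p.B) μ' μ) (ha : 2 * p.B ≤ a₀) : Vals K p μ' a₀ R :=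
  Rep.off h h' (Or.inr ha)

/-- Together with `aeval_sub_high` this is why `sub p.L` is the Montgomery modulus: on the lower
half of the points its multiples vanish, on the upper half dividing by it does nothing. -/
theorem aeval_sub_low {k : ℕ} (hk : k / p.D = 0) :
    aeval (pt (cantor K p.j) k) (sub p.L) = 0 := by
  have hD0 : 0 < p.D := by have := p.lin; omega
  have hkD : k < p.D := (Nat.div_eq_zero_iff_lt hD0).1 hk
  rw [aeval_pt_sub (cantor_zero K p.j) (fun i hi => cantor_step hi)
    (by rw [pow_succ', ← p.hD]; omega), ← p.hD, hk]
  simp [pt]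

theorem aeval_sub_high {k : ℕ} (hk : k / p.D = 1) :
    aeval (pt (cantor K p.j) k) (sub p.L) = 1 := by
  have hD0 : 0 < p.D := by have := p.lin; omega
  have hkD : k < 2 * p.D := (Nat.div_lt_iff_lt_mul hD0).1 (by omega)
  rw [aeval_pt_sub (cantor_zero K p.j) (fun i hi => cantor_step hi)
    (by rw [pow_succ', ← p.hD]; omega), ← p.hD, hk]
  have := bsum_two_pow (cantor K p.j) 0
  rw [pow_zero] at this
  rw [pt, this, cantor_zero]

end Multiplication
end RazExtractor

namespace RazExtractor

/-! ### Montgomery multiplication of value arrays -/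

section Montgomery
set_option linter.unusedSectionVars false
set_option linter.unusedSimpArgs false
open Polynomial
variable {K : Type} [Field K] [CharP K 2] [IsAlgClosed K] [Algebra (ZMod 2) K] {p : Par}
  {ρ μ : ℕ → ℕ}

/-- On the lower half of the points these are the values of the Montgomery quotient, as `A * A' + q
* P` vanishes there. The upper half is not used. -/
theorem productLoop_run (hρ : p.Env ρ) {P A A' : (ZMod 2)[X]} (hr : MulReady K p P μ)
    {x y ax ay : ℕ}
    (hx : x < 23) (hy : y < 23) (hax : ρ x = ax) (hay : ρ y = ay) (hax1 : 2 * p.B ≤ ax)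
    (hax2 : ax ≤ 9 * p.B) (hay1 : 2 * p.B ≤ ay) (hay2 : ay ≤ 9 * p.B)
    (hA : Vals K p μ ax A) (hA' : Vals K p μ ay A') :
    let q := St.loop (.var 18 + .var 18) (.bind (.ld (.var x + .var 26)) (.bind (.ld (.var y + .var 26))
      (.bind (kmulE (.var 29) (.var 30)) (.bind (.ld (.var 10 + .var 26))
        (.store (.var 5 + .var 26) (kmulE (.var 31) (.var 32)))))))
    Rep K p (q.run p.w 26 ρ μ) p.B (2 * p.D) (fun k => aeval (pt (cantor K p.j) k) (A * A') *
      (aeval (pt (cantor K p.j) k) P)⁻¹) ∧ Off p.B (2 * p.B) (q.run p.w 26 ρ μ) μ := by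
  have hlin := p.lin
  intro q
  have hx' : ∀ k, 23 ≤ k → (x = k) = False := fun k hk => by simp; omega
  have hy' : ∀ k, 23 ≤ k → (y = k) = False := fun k hk => by simp; omega
  have h := rep_loop_run (K := K) (p := p) (μ := μ) (ρ := ρ) (e := .var 18 + .var 18)
    (b := .bind (.ld (.var x + .var 26)) (.bind (.ld (.var y + .var 26))
      (.bind (kmulE (.var 29) (.var 30)) (.bind (.ld (.var 10 + .var 26))
        (.store (.var 5 + .var 26) (kmulE (.var 31) (.var 32)))))))
    (l := 26) (N := 2 * p.D) (a₀ := p.B) (F := fun k => aeval (pt (cantor K p.j) k) (A * A') *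
      (aeval (pt (cantor K p.j) k) P)⁻¹)
    (by simp (disch := omega) only [evs, Nat.reduceAdd, Nat.reduceEqDiff, hρ]; omega) (by omega) (by
      intro i hi m hoff
      have hoff' : Off p.B (2 * p.B) m μ := hoff.mono le_rfl (by omega)
      have h1 := hA.off hoff' hax1 i hi
      have h2 := hA'.off hoff' hay1 i hi
      have hm := hr.off hoff'
      have h4 := hm.inverse i hi
      have hE := hρ.loopEnv (k := 26) (v := 2 * p.D) (i := i) (by norm_num)
      rw [St.run_bind (v := m (ax + i)) (by simp (disch := omega) only [evs, Nat.reduceAdd,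
          Nat.reduceEqDiff, hx', hax]),
        St.run_bind (v := m (ay + i)) (by simp (disch := omega) only [evs, Nat.reduceAdd,
            Nat.reduceEqDiff, hy', hay])]
      have hE2 := (hE.update (i := 29) (v := m (ax + i)) (by norm_num)).update (i := 30)
        (v := m (ay + i)) (by norm_num)
      obtain ⟨v, hv, hv1⟩ := kmulE_exists (a := .var 29) (b := .var 30) hE2 hm.tab
        (by simp only [evs, Nat.reduceAdd, Nat.reduceEqDiff]) (by simp only [evs, Nat.reduceAdd,
            Nat.reduceEqDiff]) h1 h2
      rw [St.run_bind hv, St.run_bind (v := m (4 * p.B + i))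
        (by simp (disch := omega) only [evs, Nat.reduceAdd, Nat.reduceEqDiff, hρ])]
      have hE3 := (hE2.update (i := 31) (v := v) (by norm_num)).update (i := 32)
        (v := m (4 * p.B + i)) (by norm_num)
      obtain ⟨u, hu, hu1⟩ := kmulE_exists (a := .var 31) (b := .var 32) hE3 hm.tab
        (by simp only [evs, Nat.reduceAdd, Nat.reduceEqDiff]) (by simp only [evs, Nat.reduceAdd,
            Nat.reduceEqDiff]) hv1 h4
      refine ⟨u, St.run_store (by simp (disch := omega) only [evs, Nat.reduceAdd, Nat.reduceEqDiff,
          hρ]) hu, hu1.1, ?_⟩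
      rw [hu1.2, map_mul])
  exact ⟨h.1, h.2.mono le_rfl (by omega)⟩

/-- On the upper half of the points these are the values of the reduced product, since `sub p.L` is
one there. -/
theorem combineLoop_run (hρ : p.Env ρ) {P A A' q : (ZMod 2)[X]} (hr : MulReady K p P μ)
    {x y ax ay : ℕ}
    (hx : x < 23) (hy : y < 23) (hax : ρ x = ax) (hay : ρ y = ay) (hax1 : 2 * p.B ≤ ax)
    (hax2 : ax ≤ 9 * p.B) (hay1 : 2 * p.B ≤ ay) (hay2 : ay ≤ 9 * p.B)
    (hA : Vals K p μ ax A) (hA' : Vals K p μ ay A') (hq : Vals K p μ p.B q) :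
    let c := St.loop (.var 18 + .var 18) (.bind (.ld (.var x + .var 26)) (.bind (.ld (.var y + .var 26))
      (.bind (.ld (.var 9 + .var 26)) (.bind (.ld (.var 5 + .var 26))
        (.store (.var 5 + .var 26) (kmulE (.var 29) (.var 30) ^^^ kmulE (.var 31) (.var 32)))))))
    Vals K p (c.run p.w 26 ρ μ) p.B (A * A' + q * P) ∧
      Off p.B (2 * p.B) (c.run p.w 26 ρ μ) μ := by
  have hlin := p.lin
  intro c
  have hx' : ∀ k, 23 ≤ k → (x = k) = False := fun k hk => by simp; omega
  have hy' : ∀ k, 23 ≤ k → (y = k) = False := fun k hk => by simp; omega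
  have h := rep_loop_run (K := K) (p := p) (μ := μ) (ρ := ρ) (e := .var 18 + .var 18)
    (b := .bind (.ld (.var x + .var 26)) (.bind (.ld (.var y + .var 26))
      (.bind (.ld (.var 9 + .var 26)) (.bind (.ld (.var 5 + .var 26))
        (.store (.var 5 + .var 26) (kmulE (.var 29) (.var 30) ^^^ kmulE (.var 31) (.var 32)))))))
    (l := 26) (N := 2 * p.D) (a₀ := p.B)
    (F := fun k => aeval (pt (cantor K p.j) k) (A * A' + q * P))
    (by simp (disch := omega) only [evs, Nat.reduceAdd, Nat.reduceEqDiff, hρ]; omega) (by omega) (by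
      intro i hi m hoff
      have hoff' : Off p.B (2 * p.B) m μ := hoff.mono le_rfl (by omega)
      have h1 := hA.off hoff' hax1 i hi
      have h2 := hA'.off hoff' hay1 i hi
      have hm := hr.off hoff'
      have h4 := hm.modulus i hi
      have h5 := hq i hi
      rw [← hoff _ (by omega)] at h5
      have hE := hρ.loopEnv (k := 26) (v := 2 * p.D) (i := i) (by norm_num)
      rw [St.run_bind (v := m (ax + i)) (by simp (disch := omega) only [evs, Nat.reduceAdd,
          Nat.reduceEqDiff, hx', hax]),
        St.run_bind (v := m (ay + i)) (by simp (disch := omega) only [evs, Nat.reduceAdd,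
            Nat.reduceEqDiff, hy', hay]),
        St.run_bind (v := m (3 * p.B + i)) (by simp (disch := omega) only [evs, Nat.reduceAdd,
            Nat.reduceEqDiff, hρ]),
        St.run_bind (v := m (p.B + i)) (by simp (disch := omega) only [evs, Nat.reduceAdd,
            Nat.reduceEqDiff, hρ])]
      have hE2 := (((hE.update (i := 29) (v := m (ax + i)) (by norm_num)).update (i := 30)
        (v := m (ay + i)) (by norm_num)).update (i := 31) (v := m (3 * p.B + i))
        (by norm_num)).update (i := 32) (v := m (p.B + i)) (by norm_num)
      obtain ⟨v, hv, hv1⟩ := kmulE_exists (a := .var 29) (b := .var 30) hE2 hm.tab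
        (by simp only [evs, Nat.reduceAdd, Nat.reduceEqDiff]) (by simp only [evs, Nat.reduceAdd,
            Nat.reduceEqDiff]) h1 h2
      obtain ⟨u, hu, hu1⟩ := kmulE_exists (a := .var 31) (b := .var 32) hE2 hm.tab
        (by simp only [evs, Nat.reduceAdd, Nat.reduceEqDiff]) (by simp only [evs, Nat.reduceAdd,
            Nat.reduceEqDiff]) h4 h5
      refine ⟨v ^^^ u, St.run_store (by simp (disch := omega) only [evs, Nat.reduceAdd,
          Nat.reduceEqDiff, hρ])
        (by rw [Ex.ev_xor, hv, hu]), Nat.xor_lt_two_pow hv1.1 hu1.1, ?_⟩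
      rw [word_xor, hv1.2, hu1.2, map_add, map_mul, map_mul, mul_comm (aeval _ P)])
  exact ⟨h.1, h.2.mono le_rfl (by omega)⟩

/-- The polynomials `q` and `R` exist by `montgomery`; the program recovers their coefficients,
those of `q` from the lower half and those of `R` from the upper half. Both have degree below `D`,
so one half of the points determines them. -/
theorem mmP_run (hρ : p.Env ρ) {P A A' : (ZMod 2)[X]} (hr : MulReady K p P μ)
    {x y dst ax ay ad : ℕ} (hx : x < 23) (hy : y < 23) (hdst : dst < 23)
    (hax : ρ x = ax) (hay : ρ y = ay) (had : ρ dst = ad) (hax1 : 2 * p.B ≤ ax)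
    (hax2 : ax ≤ 9 * p.B) (hay1 : 2 * p.B ≤ ay) (hay2 : ay ≤ 9 * p.B) (had1 : 2 * p.B ≤ ad)
    (had2 : ad ≤ 9 * p.B) (hA : Vals K p μ ax A) (hA' : Vals K p μ ay A')
    (hP0 : ∀ k < 2 * p.D, aeval (pt (cantor K p.j) k) P ≠ 0) (hcop : IsCoprime P (sub p.L))
    (hPd : P.natDegree = p.d) (hdA : A.degree < P.degree) (hdA' : A'.degree < P.degree) :
    ∃ q R : (ZMod 2)[X], R.degree < P.degree ∧ R * sub p.L = A * A' + q * P ∧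
      Vals K p ((mmP x y dst).run p.w 26 ρ μ) ad R ∧
      ∀ a, (a < p.B ∨ 2 * p.B ≤ a) → (a < ad ∨ ad + p.B ≤ a) →
        (mmP x y dst).run p.w 26 ρ μ a = μ a := by
  have hlin := p.lin
  have hD := p.hD
  obtain ⟨hs, hsd⟩ := sub_monic_natDegree p.L
  have hP : P ≠ 0 := by rintro rfl; exact hP0 0 (by omega) (by simp)
  have hPdeg : P.degree = (p.d : ℕ) := by rw [degree_eq_natDegree hP, hPd]
  have hsdeg : (sub p.L).degree = (p.D : ℕ) := by
    rw [degree_eq_natDegree hs.ne_zero, hsd, hD]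
  -- Two factors of degree below `d`, and `d < D`.
  have hT : (A * A').degree < P.degree + (sub p.L).degree := by
    rcases eq_or_ne A 0 with rfl | hA0
    · rw [zero_mul, degree_zero, hPdeg, hsdeg]; exact WithBot.bot_lt_coe _
    rcases eq_or_ne A' 0 with rfl | hA0'
    · rw [mul_zero, degree_zero, hPdeg, hsdeg]; exact WithBot.bot_lt_coe _
    rw [degree_mul, degree_eq_natDegree hA0, degree_eq_natDegree hA0', hPdeg, hsdeg]
    rw [degree_eq_natDegree hA0, hPdeg] at hdA
    rw [degree_eq_natDegree hA0', hPdeg] at hdA'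
    norm_cast at hdA hdA' ⊢
    omega
  obtain ⟨q, R, hq, hqR, hR⟩ := montgomery hs hcop hP hT
  refine ⟨q, R, hR, hqR, ?_⟩
  obtain ⟨cq, -, hcq⟩ := exists_novel_coeffs p.D q (by rwa [← hsdeg])
  obtain ⟨cR, -, hcR⟩ := exists_novel_coeffs p.D R
    (hR.trans (by rw [hPdeg]; exact_mod_cast hlin.2.2.2.2.2.1))
  have hcq := hcq p.D le_rfl
  have hcR := hcR p.D le_rfl
  simp only [mmP, St.run_seq]
  obtain ⟨a1, a2⟩ := productLoop_run hρ hr hx hy hax hay hax1 hax2 hay1 hay2 hA hA'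
  have r1 := hr.off a2
  obtain ⟨b1, b2⟩ := invP_coeffs hρ r1.toReady hcq a1 (s := 0) (by norm_num) (by
    intro k hk
    have hkD : k < p.D := (Nat.div_eq_zero_iff_lt (by omega)).1 hk
    have e := congrArg (aeval (pt (cantor K p.j) k)) hqR
    rw [map_mul, aeval_sub_low hk, mul_zero, map_add, map_mul (aeval _) q P] at e
    have h0 := hP0 k (by omega)
    field_simp
    have := CharTwo.add_self_eq_zero (aeval (pt (cantor K p.j) k) q * aeval (pt (cantor K p.j) k) P)
    linear_combination -e - this)
  rw [zero_mul, add_zero] at b1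
  obtain ⟨d1, d2⟩ := dupUpP_run hρ b1
  have o1 := d2.trans (b2.trans a2)
  obtain ⟨f1, f2⟩ := fwdP_vals hρ (hr.off o1).toReady hcq d1
  have o2 := f2.trans o1
  obtain ⟨g1, g2⟩ := combineLoop_run hρ (hr.off o2) hx hy hax hay hax1 hax2 hay1 hay2
    (hA.off o2 hax1) (hA'.off o2 hay1) f1
  have o3 := g2.trans o2
  obtain ⟨i1, i2⟩ := invP_coeffs hρ (hr.off o3).toReady hcR g1 (s := 1) (by norm_num) (by
    intro k hk
    have e := congrArg (aeval (pt (cantor K p.j) k)) hqR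
    rw [map_mul, aeval_sub_high hk, mul_one] at e
    exact e.symm)
  rw [one_mul] at i1
  have o4 := i2.trans o3
  obtain ⟨j1, j2⟩ := dupDownP_run hρ i1
  have o5 := j2.trans o4
  obtain ⟨k1, k2⟩ := fwdP_vals hρ (hr.off o5).toReady hcR j1
  have o6 := k2.trans o5
  obtain ⟨s1, s2⟩ := saveP_run hρ hdst had had1 had2 k1
  exact ⟨s1, fun a h h' => (s2 a h').trans (o6 a h)⟩

end Montgomery
end RazExtractor

namespace RazExtractor

/-! ### The main part: setup, powering and output -/

section Main
set_option linter.unusedSectionVars false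
set_option linter.unusedSimpArgs false
open Polynomial
variable {K : Type} [Field K] [CharP K 2] [IsAlgClosed K] [Algebra (ZMod 2) K] {p : Par}
  {ρ μ : ℕ → ℕ}

/-- The points lie in a field of degree `κ` below that of `P`, so `P` has no zero among them and its
values can be inverted. -/
theorem aeval_word_ne_zero {P : (ZMod 2)[X]} (hP : Irreducible P) (hPκ : p.κ < P.natDegree)
    {u : K} {v : ℕ} (hv : v < 2 ^ p.κ) (hvu : word K v = u) : aeval u P ≠ 0 := by
  have hlin := p.lin
  refine aeval_ne_zero_of_natDegree hP (by omega) hPκ ?_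
  rw [← hvu, p.hκ]
  refine word_pow_card K ?_
  rw [← p.hκ]; exact hv

/-- The memory before the precomputation. -/
structure Input (p : Par) (P : (ZMod 2)[X]) (μ : ℕ → ℕ) : Prop where
  hx : ∀ k < p.n₁, μ k < 2
  hy : ∀ k < p.n₂, μ (p.n₁ + k) < 2
  hP : ∀ i ≤ p.d, μ (p.n₁ + (p.n₂ + i)) = (P.coeff i).val
  free : ∀ a, 7 * p.B ≤ a → a < 8 * p.B → μ a = 0

/-- The polynomial encoding the sum of the first half of the first source and the second source. -/
noncomputable def sumPoly (p : Par) (μ : ℕ → ℕ) : (ZMod 2)[X] :=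
  ofCoeffs p.D fun k => ((if k < p.n₁ / 2 then μ k else 0 : ℕ) : ZMod 2) +
    ((if k < p.n₂ then μ (p.n₁ + k) else 0 : ℕ) : ZMod 2)

/-- The polynomial encoding the second half of the first source. -/
noncomputable def factorPoly (p : Par) (μ : ℕ → ℕ) : (ZMod 2)[X] :=
  ofCoeffs p.D fun k => ((if k < p.d then μ (p.n₁ / 2 + k) else 0 : ℕ) : ZMod 2)

theorem setupP_run (hρ : p.Env ρ) {P : (ZMod 2)[X]} (hP : Irreducible P)
    (hPd : P.natDegree = p.d) (hPκ : p.κ < P.natDegree) (hin : Input p P μ) :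
    MulReady K p P (setupP.run p.w 26 ρ μ) ∧
      Vals K p (setupP.run p.w 26 ρ μ) (5 * p.B) (sumPoly p μ) ∧
      Vals K p (setupP.run p.w 26 ρ μ) (6 * p.B) (factorPoly p μ) ∧
      ∀ k < 2 * p.D, aeval (pt (cantor K p.j) k) P ≠ 0 := by
  have hlin := p.lin
  simp only [setupP, St.run_seq]
  obtain ⟨a1, a2⟩ := tableP_run (K := K) hρ hin.free
  set m1 := tableP.run p.w 26 ρ μ
  obtain ⟨b1, b2⟩ := cantorP_run hρ a1
  set m2 := cantorP.run p.w 26 ρ m1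
  obtain ⟨c1, c2⟩ := pointsP_run hρ b1
  set m3 := pointsP.run p.w 26 ρ m2
  obtain ⟨d1, d2⟩ := coeffsP_run (μ := m3) hρ
  set m4 := coeffsP.run p.w 26 ρ m3
  have low4 : ∀ a < 2 * p.B, m4 a = μ a := fun a ha => by
    rw [d2 a (by omega), c2 a (by omega), b2 a (by omega), a2 a (by omega)]
  have r4 : Ready K p m4 := ⟨((a1.off b2 (by omega)).off c2 (by omega)).off d2 (by omega),
    c1.off d2 (by omega)⟩
  obtain ⟨e1, e2⟩ := loadPolyP_run hρ d1 hPd fun i hi => by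
    rw [low4 _ (by omega), hin.hP i hi]
  set m5 := loadPolyP.run p.w 26 ρ m4
  obtain ⟨f1, f2⟩ := evalP_run (dst := 9) (a₀ := 3 * p.B) hρ (r4.off e2) (by norm_num) (by simp only [hρ])
    (by omega) (by omega) e1
  set m6 := (evalP 9).run p.w 26 ρ m5
  have r6 : Ready K p m6 := (r4.off e2).of_eq (fun a _ _ => f2 a (by omega) (by omega))
    (fun a _ _ => f2 a (by omega) (by omega))
  have h0 : ∀ k < 2 * p.D, aeval (pt (cantor K p.j) k) P ≠ 0 := fun k hk =>
    aeval_word_ne_zero hP hPκ (r4.points k hk).1 (r4.points k hk).2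
  obtain ⟨g1, g2⟩ := invertP_run hρ r6 f1 h0
  set m7 := invertP.run p.w 26 ρ m6
  have r7 : MulReady K p P m7 := ⟨r6.of_eq (fun a _ _ => g2 a (by omega) (by omega))
    (fun a _ _ => g2 a (by omega) (by omega)),
    f1.of_eq fun k hk => g2 _ (by omega) (by omega), g1⟩
  have low7 : ∀ a < p.B, m7 a = μ a := fun a ha => by
    rw [g2 a (by omega) (by omega), f2 a (by omega) (by omega), e2 a (by omega),
      low4 a (by omega)]
  obtain ⟨i1, i2⟩ := loadAP_run (μ := m7) hρ
    (fun k hk => by rw [low7 _ (by omega)]; exact hin.hx k (by omega))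
    (fun k hk => by rw [low7 _ (by omega)]; exact hin.hy k hk)
  set m8 := loadAP.run p.w 26 ρ m7
  obtain ⟨j1, j2⟩ := evalP_run (K := K) (dst := 11) (a₀ := 5 * p.B) hρ (r7.off i2).toReady
    (by norm_num) (by simp only [hρ]) (by omega) (by omega) i1
  set m9 := (evalP 11).run p.w 26 ρ m8
  have r9 : MulReady K p P m9 := (r7.off i2).of_eq (fun a _ _ => j2 a (by omega) (by omega))
    (fun a _ _ => j2 a (by omega) (by omega))
  have low9 : ∀ a < p.B, m9 a = μ a := fun a ha => by
    rw [j2 a (by omega) (by omega), i2 a (by omega), low7 a ha]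
  obtain ⟨k1, k2⟩ := loadBP_run (μ := m9) hρ
    (fun k hk => by rw [low9 _ (by omega)]; exact hin.hx _ (by omega))
  set m10 := loadBP.run p.w 26 ρ m9
  obtain ⟨l1, l2⟩ := evalP_run (K := K) (dst := 12) (a₀ := 6 * p.B) hρ (r9.off k2).toReady
    (by norm_num) (by simp only [hρ]) (by omega) (by omega) k1
  set m11 := (evalP 12).run p.w 26 ρ m10
  refine ⟨(r9.off k2).of_eq (fun a _ _ => l2 a (by omega) (by omega))
    (fun a _ _ => l2 a (by omega) (by omega)), ?_, ?_, h0⟩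
  · have e : sumPoly p μ = ofCoeffs p.D fun k =>
        ((if k < p.n₁ / 2 then m7 k else 0 : ℕ) : ZMod 2) +
        ((if k < p.n₂ then m7 (p.n₁ + k) else 0 : ℕ) : ZMod 2) := by
      rw [sumPoly]
      congr 1
      funext k
      congr 2
      · split_ifs with h
        · rw [low7 _ (by omega)]
        · rfl
      · split_ifs with h
        · rw [low7 _ (by omega)]
        · rfl
    rw [e]
    exact Rep.of_eq j1 fun k hk => by
      rw [l2 _ (by omega) (by omega), k2 _ (by omega)]
  · have e : factorPoly p μ = ofCoeffs p.D fun k =>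
        ((if k < p.d then m9 (p.n₁ / 2 + k) else 0 : ℕ) : ZMod 2) := by
      rw [factorPoly]
      congr 1
      funext k
      congr 1
      split_ifs with h
      · rw [low9 _ (by omega)]
      · rfl
    rw [e]
    exact l1

/-- After `t` rounds the two arrays hold `B₀ * A₀ ^ (2 ^ t - 1)` and `A₀ ^ 2 ^ t`, each up to the
factor `c ^ (2 ^ t - 1)`. Multiples of `P` disappear under `φ`. -/
theorem powersLoop_run (hρ : p.Env ρ) {P A₀ B₀ : (ZMod 2)[X]} (hr : MulReady K p P μ)
    (hA : Vals K p μ (5 * p.B) A₀) (hB : Vals K p μ (6 * p.B) B₀)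
    (hP0 : ∀ k < 2 * p.D, aeval (pt (cantor K p.j) k) P ≠ 0) (hcop : IsCoprime P (sub p.L))
    (hPd : P.natDegree = p.d) (hdA : A₀.degree < P.degree) (hdB : B₀.degree < P.degree)
    {F : Type} [Field F] (φ : (ZMod 2)[X] →+* F) (hφ : φ P = 0) :
    ∃ R : (ZMod 2)[X], R.degree < P.degree ∧
      φ R = (φ (sub p.L))⁻¹ ^ (2 ^ p.L - 1) * φ B₀ * φ A₀ ^ (2 ^ p.L - 1) ∧
      Vals K p ((St.loop (.var 17) (.seq (mmP 12 11 12) (mmP 11 11 11))).run p.w 23 ρ μ)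
        (6 * p.B) R ∧
      Ready K p ((St.loop (.var 17) (.seq (mmP 12 11 12) (mmP 11 11 11))).run p.w 23 ρ μ) := by
  have hlin := p.lin
  have hs0 : φ (sub p.L) ≠ 0 := by
    intro h
    obtain ⟨a, b, hab⟩ := hcop
    have := congrArg φ hab
    simp [hφ, h] at this
  set c := (φ (sub p.L))⁻¹ with hc
  have key : ∀ m, (MulReady K p P m ∧ ∃ R S : (ZMod 2)[X], R.degree < P.degree ∧
      S.degree < P.degree ∧ φ R = c ^ (2 ^ p.L - 1) * φ B₀ * φ A₀ ^ (2 ^ p.L - 1) ∧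
      φ S = c ^ (2 ^ p.L - 1) * φ A₀ ^ 2 ^ p.L ∧
      Vals K p m (6 * p.B) R ∧ Vals K p m (5 * p.B) S) →
    ∃ R : (ZMod 2)[X], R.degree < P.degree ∧
      φ R = c ^ (2 ^ p.L - 1) * φ B₀ * φ A₀ ^ (2 ^ p.L - 1) ∧
      Vals K p m (6 * p.B) R ∧ Ready K p m := by
    rintro m ⟨h, R, S, h1, -, h3, -, h5, -⟩
    exact ⟨R, h1, h3, h5, h.toReady⟩
  refine key _ ?_
  refine St.run_loop (n := p.L) (by simp only [evs, Nat.reduceAdd, Nat.reduceEqDiff, hρ]) (by omega)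
    (fun t m => MulReady K p P m ∧ ∃ R S : (ZMod 2)[X], R.degree < P.degree ∧
      S.degree < P.degree ∧ φ R = c ^ (2 ^ t - 1) * φ B₀ * φ A₀ ^ (2 ^ t - 1) ∧
      φ S = c ^ (2 ^ t - 1) * φ A₀ ^ 2 ^ t ∧
      Vals K p m (6 * p.B) R ∧ Vals K p m (5 * p.B) S)
    ⟨hr, B₀, A₀, hdB, hdA, by simp, by simp, hB, hA⟩ ?_
  rintro t ht m ⟨hm, R, S, hR, hS, hφR, hφS, hvR, hvS⟩
  have hE := hρ.loopEnv (k := 23) (v := p.L) (i := t) le_rfl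
  have h11 : loopEnv 23 ρ p.L t 11 = 5 * p.B := by simp only [hE]
  have h12 : loopEnv 23 ρ p.L t 12 = 6 * p.B := by simp only [hE]
  have hp : 2 ^ (t + 1) = 2 ^ t + 2 ^ t := by rw [pow_succ, mul_two]
  have hp0 := Nat.two_pow_pos t
  -- A Montgomery product has the factors `c` of both inputs and one of its own.
  have e1 : 2 ^ (t + 1) - 1 = 1 + (2 ^ t - 1) + (2 ^ t - 1) := by omega
  have e2 : 2 ^ (t + 1) - 1 = (2 ^ t - 1) + 2 ^ t := by omega
  rw [St.run_seq]
  obtain ⟨q, R', hR', hqR, v1, o1⟩ := mmP_run hE hm (x := 12) (y := 11) (dst := 12) (by norm_num)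
    (by norm_num) (by norm_num) h12 h11 h12 (by omega) (by omega) (by omega) (by omega) (by omega)
    (by omega) hvR hvS hP0 hcop hPd hR hS
  set m' := (mmP 12 11 12).run p.w 26 (loopEnv 23 ρ p.L t) m
  have hm' : MulReady K p P m' := hm.of_eq (fun a _ _ => o1 a (by omega) (by omega))
    (fun a _ _ => o1 a (by omega) (by omega))
  have hvS' : Vals K p m' (5 * p.B) S := Rep.of_eq hvS fun k hk => o1 _ (by omega) (by omega)
  obtain ⟨q', S', hS', hqS, v2, o2⟩ := mmP_run hE hm' (x := 11) (y := 11) (dst := 11) (by norm_num)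
    (by norm_num) (by norm_num) h11 h11 h11 (by omega) (by omega) (by omega) (by omega) (by omega)
    (by omega) hvS' hvS' hP0 hcop hPd hS hS
  refine ⟨hm'.of_eq (fun a _ _ => o2 a (by omega) (by omega))
    (fun a _ _ => o2 a (by omega) (by omega)), R', S', hR', hS', ?_, ?_,
    Rep.of_eq v1 fun k hk => o2 _ (by omega) (by omega), v2⟩
  · have e := congrArg φ hqR
    rw [map_mul, map_add, map_mul, map_mul, hφ, mul_zero, add_zero, hφR, hφS] at e
    rw [(eq_mul_inv_iff_mul_eq₀ hs0).2 e, ← hc]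
    rw [show c ^ (2 ^ (t + 1) - 1) = c * c ^ (2 ^ t - 1) * c ^ (2 ^ t - 1) by
      rw [e1, pow_add, pow_add, pow_one], show φ A₀ ^ (2 ^ (t + 1) - 1) =
      φ A₀ ^ (2 ^ t - 1) * φ A₀ ^ 2 ^ t by rw [e2, pow_add]]
    ring
  · have e := congrArg φ hqS
    rw [map_mul, map_add, map_mul, map_mul, hφ, mul_zero, add_zero, hφS] at e
    rw [(eq_mul_inv_iff_mul_eq₀ hs0).2 e, ← hc]
    rw [show c ^ (2 ^ (t + 1) - 1) = c * c ^ (2 ^ t - 1) * c ^ (2 ^ t - 1) by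
      rw [e1, pow_add, pow_add, pow_one], hp, pow_add]
    ring

/-- The inverse transform returns words for the field elements 0 and 1; by `word_injOn` these words
are the bits themselves. -/
theorem outputP_run (hρ : p.Env ρ) (hr : Ready K p μ) {c : ℕ → ZMod 2} {R : (ZMod 2)[X]}
    (hR : R = ∑ t ∈ Finset.range p.D, C (c t) * novel t) (hv : Vals K p μ (6 * p.B) R)
    {i : ℕ} (hi : i < p.d) : outputP.run p.w 26 ρ μ i = (c i).val := by
  have hlin := p.lin
  simp only [outputP, St.run_seq]
  obtain ⟨h3, h4⟩ := fillP_run (w := p.w) (ρ := ρ) (μ := μ) (n := .var 18 + .var 18)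
    (dst := .var 5) (src := .ld (.var 12 + .var 26)) (N := 2 * p.D) (a₀ := p.B)
    (s := fun i => μ (6 * p.B + i)) (by simp (disch := omega) only [evs, Nat.reduceAdd, Nat.reduceEqDiff, hρ]; omega) (by omega)
    (fun i m => by simp (disch := omega) only [evs, Nat.reduceAdd, Nat.reduceEqDiff, hρ])
    (fun i hi m hm => by simp (disch := omega) only [evs, Nat.reduceAdd, Nat.reduceEqDiff, hρ]; exact hm _ (by omega))
  set m := (fillP (.var 18 + .var 18) (.var 5) (.ld (.var 12 + .var 26))).run p.w 26 ρ μ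
  have hm : Rep K p m p.B (2 * p.D) fun k => aeval (pt (cantor K p.j) k) R := fun k hk => by
    rw [h3 k hk]; exact hv k hk
  obtain ⟨b1, b2⟩ := invP_coeffs hρ (hr.off (h4.mono le_rfl (by omega))) hR hm (s := 0)
    (by norm_num) (fun _ _ => rfl)
  set m' := invP.run p.w 26 ρ m
  obtain ⟨h5, -⟩ := fillP_run (w := p.w) (ρ := ρ) (μ := m') (n := .var 7)
    (dst := 0) (src := .ld (.var 5 + .var 26)) (N := p.d) (a₀ := 0)
    (s := fun i => m' (p.B + i)) (by simp only [evs, Nat.reduceAdd, Nat.reduceEqDiff,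
        hρ]) (by omega)
    (fun i m => by simp (disch := omega) only [evs, Nat.reduceAdd, Nat.reduceEqDiff])
    (fun i hi m hm => by simp (disch := omega) only [evs, Nat.reduceAdd, Nat.reduceEqDiff, hρ]; exact hm _ (by omega))
  have h6 := h5 i hi
  rw [zero_add] at h6
  rw [h6]
  have h7 := b1 i (by omega)
  rw [zero_mul, add_zero] at h7
  have hc2 : (c i).val < 2 := ZMod.val_lt _
  have h8 := word_bit (K := K) hc2
  rw [ZMod.natCast_zmod_val] at h8
  rw [p.hκ] at h7
  refine word_injOn K (i := p.j) h7.1 (hc2.trans_le (Nat.le_self_pow (by positivity) 2)) ?_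
  rw [h7.2, h8]

theorem loop_one_run {w k : ℕ} (hw : 1 < 2 ^ w) (b : St) :
    (St.loop 1 b).run w k ρ μ = b.run w (k + 3) (loopEnv k ρ 1 0) μ := by
  have h : (1 : Ex).ev w ρ μ = 1 := Nat.mod_eq_of_lt hw
  rw [St.run, h, Nat.mod_eq_of_lt hw]
  rfl

/-- The algebraic closure serves only to interpret machine words; the result is stated through `φ`,
later the reduction modulo `P`. -/
theorem mainP_run (hρ : p.Env ρ) {P : (ZMod 2)[X]} (hP : Irreducible P)
    (hPd : P.natDegree = p.d) (hPκ : p.κ < P.natDegree) (hin : Input p P μ)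
    (hdA : (sumPoly p μ).degree < P.degree) (hdB : (factorPoly p μ).degree < P.degree)
    {F : Type} [Field F] (φ : (ZMod 2)[X] →+* F) (hφ : φ P = 0) :
    ∃ c : ℕ → ZMod 2, (∀ t, p.d ≤ t → c t = 0) ∧
      φ (∑ t ∈ Finset.range p.d, C (c t) * novel t) =
        (φ (sub p.L))⁻¹ ^ (2 ^ p.L - 1) * φ (factorPoly p μ) * φ (sumPoly p μ) ^ (2 ^ p.L - 1) ∧
      ∀ i < p.d, mainP.run p.w 23 ρ μ i = (c i).val := by
  have hlin := p.lin
  have hcop : IsCoprime P (sub p.L) := isCoprime_sub hP (j := p.j) (by rw [← p.hκ]; omega)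
    (by rw [← p.hκ]; exact hPκ)
  let K := AlgebraicClosure (ZMod 2)
  have : CharP K 2 := charP_of_injective_algebraMap (algebraMap (ZMod 2) K).injective 2
  simp only [mainP, St.run_seq]
  rw [loop_one_run (by omega), loop_one_run (by omega)]
  obtain ⟨s1, s2, s3, s4⟩ := setupP_run (K := K) (hρ.loopEnv (k := 23) (v := 1) (i := 0) le_rfl)
    hP hPd hPκ hin
  obtain ⟨R, hR, hφR, hv, hr⟩ := powersLoop_run hρ s1 s2 s3 s4 hcop hPd hdA hdB φ hφ
  obtain ⟨c, hc0, hc⟩ := exists_novel_coeffs p.d R (by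
    rwa [degree_eq_natDegree hP.ne_zero, hPd] at hR)
  refine ⟨c, hc0, ?_, fun i hi => ?_⟩
  · rw [← hc p.d le_rfl, hφR]
  · exact outputP_run (hρ.loopEnv (k := 23) (v := 1) (i := 0) le_rfl) hr (hc p.D (by omega)) hv hi

end Main
end RazExtractor

namespace RazExtractor

/-! ### A calculus of step counts, and the parameters of a run -/

section Parameters
set_option linter.unusedSectionVars false
set_option linter.unusedSimpArgs false
open Polynomial

namespace St

/-- The cost with every loop body executed once. -/
def size : St → ℕ
  | store a v => a.cost + (v.cost + 1)
  | seq p q => p.size + q.size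
  | bind e b => e.cost + b.size
  | loop e b => e.cost + 6 + (b.size + 3)

/-- The cost is at most `M` times the size, whatever the memory. -/
def CostLe (w M : ℕ) (p : St) (K : ℕ) (ρ : ℕ → ℕ) : Prop := ∀ μ, p.cost w K ρ μ ≤ p.size * M

/-- From the given configuration the cost is at most `M` times the size and the result
satisfies `R`. -/
def Meets (w M : ℕ) (R : (ℕ → ℕ) → Prop) (p : St) (K : ℕ) (ρ μ : ℕ → ℕ) : Prop :=
  p.cost w K ρ μ ≤ p.size * M ∧ R (p.run w K ρ μ)

variable {w M M' N K : ℕ} {ρ μ : ℕ → ℕ} {R : (ℕ → ℕ) → Prop}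

theorem costLe_store (a v : Ex) (hM : 1 ≤ M) : CostLe w M (store a v) K ρ :=
  fun _ => Nat.le_mul_of_pos_right _ hM

theorem CostLe.seq {p q : St} (hp : CostLe w M p K ρ) (hq : CostLe w M q K ρ) :
    CostLe w M (seq p q) K ρ := fun μ => by
  rw [cost, size, add_mul]; exact Nat.add_le_add (hp _) (hq _)

theorem CostLe.bind {e : Ex} {b : St} (hM : 1 ≤ M)
    (hb : ∀ v, (∃ μ, v = e.ev w ρ μ) → CostLe w M b (K + 1) (Function.update ρ K v)) :
    CostLe w M (bind e b) K ρ := fun μ => by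
  rw [cost, size, add_mul]
  exact Nat.add_le_add (Nat.le_mul_of_pos_right _ hM) (hb _ ⟨μ, rfl⟩ _)

/-- The size of a program is an absolute constant, so all dependence on the input goes into the
multiplier `M`; nested loops multiply their bounds there. -/
theorem loop_cost_le {e : Ex} {b : St} (hN : e.ev w ρ μ ≤ N) (hM : 1 ≤ M) (hM' : 1 ≤ M')
    (hNM : N * M' ≤ M) (hb : ∀ i < N, ∀ n, CostLe w M' b (K + 3) (loopEnv K ρ n i)) :
    (loop e b).cost w K ρ μ ≤ (loop e b).size * M := by
  have hN' : e.ev w ρ μ % 2 ^ w ≤ N := (Nat.mod_le _ _).trans hN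
  rw [cost, size, add_mul]
  refine Nat.add_le_add (Nat.le_mul_of_pos_right _ hM) ?_
  refine (Finset.sum_le_card_nsmul _ _ ((b.size + 3) * M') fun i hi => ?_).trans ?_
  · rw [add_mul]
    refine Nat.add_le_add (hb i ?_ _ _) (Nat.le_mul_of_pos_right _ hM')
    exact (Finset.mem_range.1 hi).trans_le hN'
  · rw [Finset.card_range, smul_eq_mul, mul_left_comm]
    exact Nat.mul_le_mul_left _ ((Nat.mul_le_mul_right _ hN').trans hNM)

theorem CostLe.loop {e : Ex} {b : St} (hN : ∀ μ, e.ev w ρ μ ≤ N) (hM : 1 ≤ M) (hM' : 1 ≤ M')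
    (hNM : N * M' ≤ M) (hb : ∀ i < N, ∀ n, CostLe w M' b (K + 3) (loopEnv K ρ n i)) :
    CostLe w M (loop e b) K ρ := fun μ => loop_cost_le (hN μ) hM hM' hNM hb

theorem Meets.bind {e : Ex} {b : St} {v : ℕ} (he : e.ev w ρ μ = v) (hM : 1 ≤ M)
    (hb : Meets w M R b (K + 1) (Function.update ρ K v) μ) : Meets w M R (bind e b) K ρ μ := by
  rw [Meets, cost, size, add_mul, run, he]
  exact ⟨Nat.add_le_add (Nat.le_mul_of_pos_right _ hM) hb.1, hb.2⟩

theorem Meets.seq {p q : St} {μ' : ℕ → ℕ} (hp : p.cost w K ρ μ ≤ p.size * M)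
    (hr : p.run w K ρ μ = μ') (hq : Meets w M R q K ρ μ') : Meets w M R (seq p q) K ρ μ := by
  rw [Meets, cost, size, add_mul, run, hr]
  exact ⟨Nat.add_le_add hp hq.1, hq.2⟩

end St

/-- After `i` rounds the cell holds `min i (Nat.clog 2 M)`, as the test `2 ^ c < M` is `c < Nat.clog
2 M`. -/
theorem countLoop_run {w l N a M : ℕ} {ρ μ : ℕ → ℕ} {n A bnd : Ex} (hn : n.ev w ρ μ = N)
    (hN : N < 2 ^ w) (hA : ∀ i m, A.ev w (loopEnv l ρ N i) m = a)
    (hb : ∀ i m, bnd.ev w (loopEnv l ρ N i) m = M) (h0 : μ a = 0) (hM : Nat.clog 2 M ≤ N)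
    (hMw : 2 ^ Nat.clog 2 M < 2 ^ w) :
    (St.loop n (.store A (.ld A + .op .lt ((1 : Ex) <<< .ld A) bnd))).run w l ρ μ =
      Function.update μ a (Nat.clog 2 M) := by
  have key : ∀ m, m = Function.update μ a (min N (Nat.clog 2 M)) →
      m = Function.update μ a (Nat.clog 2 M) := fun m h => by rw [h, min_eq_right hM]
  refine key _ ?_
  refine St.run_loop hn hN (fun i m => m = Function.update μ a (min i (Nat.clog 2 M))) ?_ ?_
  · rw [Nat.zero_min, ← h0, Function.update_eq_self]
  rintro i hi m rfl
  set c := Nat.clog 2 M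
  set v := min i c with hv
  have hvc : v ≤ c := min_le_right _ _
  have h2 : 2 ^ v ≤ 2 ^ c := Nat.pow_le_pow_right (by norm_num) hvc
  have hv2 : v < 2 ^ v := Nat.lt_two_pow_self
  have h1 : (1 : Ex).ev w (loopEnv l ρ N i) (Function.update μ a v) = 1 :=
    have h : 1 < 2 ^ w := by omega
    Nat.mod_eq_of_lt h
  have hlt : 2 ^ v < M ↔ v < c := (Nat.lt_clog_iff_pow_lt (by norm_num)).symm
  rw [St.run_store (hA i _) (y := v + if v < c then 1 else 0), Function.update_idem]
  · congr 1
    split_ifs with h <;> omega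
  · rw [Ex.ev_add, Ex.ev_lt, Ex.ev_shl, Ex.ev_ld, hA, hb, h1, Function.update_self,
      eval_shl (by omega),
      one_mul, eval_add]
    · simp only [hlt]
    · split_ifs <;> omega

theorem two_pow_clog_le {x : ℕ} (hx : 1 < x) : 2 ^ Nat.clog 2 x ≤ 2 * (x - 1) := by
  have h := Nat.pow_pred_clog_lt_self (b := 2) (by norm_num) hx
  have hpos : 0 < Nat.clog 2 x := Nat.clog_pos (by norm_num) hx
  obtain ⟨l, hl⟩ : ∃ l, Nat.clog 2 x = l + 1 := ⟨_, (Nat.succ_pred hpos.ne').symm⟩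
  rw [hl] at h ⊢
  rw [Nat.pred_succ] at h
  rw [pow_succ]
  omega

theorem four_mul_lt_two_pow {l : ℕ} (hl : 5 ≤ l) : 4 * l < 2 ^ l := by
  induction l, hl using Nat.le_induction with
  | base => norm_num
  | succ l hl ih => rw [pow_succ]; omega

/-- The parameters of a run. -/
def razPar (n₁ n₂ : ℕ) (h₁ : 80 ≤ n₁) (h₂ : 2 * n₂ ≤ n₁) : Par where
  w := 8 * (Nat.log 2 n₁ + 1)
  n₁ := n₁
  n₂ := n₂
  B := 4 * n₁
  d := n₁ - n₁ / 2
  L := Nat.clog 2 (n₁ - n₁ / 2 + 1)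
  D := 2 ^ Nat.clog 2 (n₁ - n₁ / 2 + 1)
  j := Nat.clog 2 (Nat.clog 2 (n₁ - n₁ / 2 + 1) + 1)
  κ := 2 ^ Nat.clog 2 (Nat.clog 2 (n₁ - n₁ / 2 + 1) + 1)
  Q := 2 ^ 2 ^ (Nat.clog 2 (Nat.clog 2 (n₁ - n₁ / 2 + 1) + 1) - 1)
  S := 2 ^ 2 ^ (Nat.clog 2 (Nat.clog 2 (n₁ - n₁ / 2 + 1) + 1) - 2)
  hB := rfl
  hd := rfl
  hn₂ := h₂
  hn₁ := by omega
  hw := by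
    have h := Nat.lt_pow_succ_log_self (b := 2) (by norm_num) n₁
    rw [Nat.succ_eq_add_one] at h
    have h6 : 6 ≤ Nat.log 2 n₁ := (Nat.le_log_iff_pow_le (by norm_num) (by omega)).2 (by omega)
    calc 64 * n₁ < 2 ^ 6 * 2 ^ (Nat.log 2 n₁ + 1) := by omega
      _ = 2 ^ (6 + (Nat.log 2 n₁ + 1)) := (pow_add 2 _ _).symm
      _ ≤ _ := Nat.pow_le_pow_right (by norm_num) (by omega)
  hD := rfl
  hdD := Nat.lt_of_succ_le (Nat.le_pow_clog (by norm_num) _)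
  hDn := by
    have := two_pow_clog_le (x := n₁ - n₁ / 2 + 1) (by omega)
    omega
  hκ := rfl
  hj := by
    -- `n₁ ≥ 80` gives `d ≥ 40`, hence `L ≥ 6` and `j ≥ 3`, so that words can be quartered.
    have h6 : 5 < Nat.clog 2 (n₁ - n₁ / 2 + 1) :=
      (Nat.lt_clog_iff_pow_lt (by norm_num)).2 (by omega)
    exact (Nat.lt_clog_iff_pow_lt (by norm_num)).2 (by omega)
  hLκ := Nat.le_pow_clog (by norm_num) _
  hκL := by
    have h5 : 5 < Nat.clog 2 (n₁ - n₁ / 2 + 1) :=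
      (Nat.lt_clog_iff_pow_lt (by norm_num)).2 (by omega)
    have := two_pow_clog_le (x := Nat.clog 2 (n₁ - n₁ / 2 + 1) + 1) (by omega)
    omega
  hκw := by
    have h5 : 5 < Nat.clog 2 (n₁ - n₁ / 2 + 1) :=
      (Nat.lt_clog_iff_pow_lt (by norm_num)).2 (by omega)
    have h := two_pow_clog_le (x := Nat.clog 2 (n₁ - n₁ / 2 + 1) + 1) (by omega)
    have h' : Nat.clog 2 (n₁ - n₁ / 2 + 1) ≤ Nat.log 2 n₁ + 1 := by
      refine Nat.clog_le_of_le_pow ?_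
      have := Nat.lt_pow_succ_log_self (b := 2) (by norm_num) n₁
      rw [Nat.succ_eq_add_one] at this
      omega
    exact Nat.pow_le_pow_right (by norm_num) (by omega)
  hQ := rfl
  hS := rfl

/-- `κ ≤ 2 L` is logarithmic in `d`: combine `2 ^ L ≤ 2 d` with `4 L < 2 ^ L`. -/
theorem κ_lt_d {n₁ n₂ : ℕ} (h₁ : 80 ≤ n₁) (h₂ : 2 * n₂ ≤ n₁) :
    (razPar n₁ n₂ h₁ h₂).κ < (razPar n₁ n₂ h₁ h₂).d := by
  have h := (razPar n₁ n₂ h₁ h₂).hκL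
  have h5 : 5 < (razPar n₁ n₂ h₁ h₂).L := (Nat.lt_clog_iff_pow_lt (by norm_num)).2 (by omega)
  have h1 : 2 ^ (razPar n₁ n₂ h₁ h₂).L ≤ _ :=
    two_pow_clog_le (x := n₁ - n₁ / 2 + 1) (by omega)
  have h2 := four_mul_lt_two_pow h5.le
  change _ < n₁ - n₁ / 2
  omega

/-- Reduction of a run to the run of its main part. -/
theorem razSt_meets {n₁ n₂ : ℕ} (h₁ : 80 ≤ n₁) (h₂ : 2 * n₂ ≤ n₁) {ρ μ : ℕ → ℕ}
    (hρ0 : ρ 0 = n₁) (hρ2 : ρ 2 = n₂) (hμ : ∀ a, 40 * n₁ ≤ a → μ a = 0) {M : ℕ} (hM : n₁ ≤ M)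
    {R : (ℕ → ℕ) → Prop}
    (hmain : ∀ ρ' μ', (razPar n₁ n₂ h₁ h₂).Env ρ' → (∀ a, a < 40 * n₁ → μ' a = μ a) →
      St.Meets (razPar n₁ n₂ h₁ h₂).w M R mainP 23 ρ' μ') :
    St.Meets (razPar n₁ n₂ h₁ h₂).w M R razSt 5 ρ μ := by
  set p := razPar n₁ n₂ h₁ h₂ with hp
  have hlin := p.lin
  have e1 : p.n₁ = n₁ := rfl
  have e2 : p.n₂ = n₂ := rfl
  have hD := p.hD
  have hκ := p.hκ
  have hL : p.L = Nat.clog 2 (p.d + 1) := rfl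
  have hj : p.j = Nat.clog 2 (p.L + 1) := rfl
  have hj3 := p.hj
  have hM1 : 1 ≤ M := by omega
  have hLd : p.L ≤ p.d := by
    rw [hL]; refine Nat.clog_le_of_le_pow ?_; exact Nat.lt_two_pow_self
  have hjL : p.j ≤ p.L := by
    rw [hj]; refine Nat.clog_le_of_le_pow ?_; exact Nat.lt_two_pow_self
  rw [razSt]
  refine St.Meets.bind (v := p.B) (by simp (disch := omega) only [evs, Nat.reduceAdd, Nat.reduceEqDiff, hρ0]; omega) hM1 ?_
  refine St.Meets.bind (v := n₁ / 2) (by simp (disch := omega) only [evs, Nat.reduceAdd,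
      Nat.reduceEqDiff, hρ0]) hM1 ?_
  refine St.Meets.bind (v := p.d) (by simp (disch := omega) only [evs, Nat.reduceAdd, Nat.reduceEqDiff, hρ0]; omega) hM1 ?_
  refine St.Meets.bind (v := 2 * p.B) (by simp (disch := omega) only [evs, Nat.reduceAdd, Nat.reduceEqDiff]; omega) hM1 ?_
  refine St.Meets.bind (v := 3 * p.B) (by simp (disch := omega) only [evs, Nat.reduceAdd, Nat.reduceEqDiff]; omega) hM1 ?_
  refine St.Meets.bind (v := 4 * p.B) (by simp (disch := omega) only [evs, Nat.reduceAdd, Nat.reduceEqDiff]; omega) hM1 ?_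
  refine St.Meets.bind (v := 5 * p.B) (by simp (disch := omega) only [evs, Nat.reduceAdd, Nat.reduceEqDiff]; omega) hM1 ?_
  refine St.Meets.bind (v := 6 * p.B) (by simp (disch := omega) only [evs, Nat.reduceAdd, Nat.reduceEqDiff]; omega) hM1 ?_
  refine St.Meets.bind (v := 7 * p.B) (by simp (disch := omega) only [evs, Nat.reduceAdd, Nat.reduceEqDiff]; omega) hM1 ?_
  refine St.Meets.bind (v := 8 * p.B) (by simp (disch := omega) only [evs, Nat.reduceAdd, Nat.reduceEqDiff]; omega) hM1 ?_
  refine St.Meets.bind (v := 9 * p.B) (by simp (disch := omega) only [evs, Nat.reduceAdd, Nat.reduceEqDiff]; omega) hM1 ?_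
  refine St.Meets.bind (v := 10 * p.B) (by simp (disch := omega) only [evs, Nat.reduceAdd, Nat.reduceEqDiff]; omega) hM1 ?_
  refine St.Meets.seq (St.loop_cost_le (N := p.d) (M' := 1) (by simp (disch := omega) only [evs, Nat.reduceAdd, Nat.reduceEqDiff]; rfl) hM1
    le_rfl (by omega) fun _ _ _ => St.costLe_store _ _ le_rfl)
    (countLoop_run (N := p.d) (M := p.d + 1) (a := 10 * p.B)
      (by simp (disch := omega) only [evs, Nat.reduceAdd, Nat.reduceEqDiff]) (by omega)
      (fun i m => by simp (disch := omega) only [evs, Nat.reduceAdd, Nat.reduceEqDiff])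
      (fun i m => by simp (disch := omega) only [evs, Nat.reduceAdd,
          Nat.reduceEqDiff]) (hμ _ (by omega)) hLd
      (by rw [← hL, ← hD]; omega)) ?_
  rw [← hL, paramsP]
  refine St.Meets.bind (v := p.L) (by simp (disch := omega) only [evs, Nat.reduceAdd,
      Nat.reduceEqDiff]) hM1 ?_
  refine St.Meets.bind (v := p.D) (by simp (disch := omega) only [evs, Nat.reduceAdd,
      Nat.reduceEqDiff, one_mul, ← hD]) hM1 ?_
  refine St.Meets.seq (St.loop_cost_le (N := p.L) (M' := 1) (by simp (disch := omega) only [evs, Nat.reduceAdd, Nat.reduceEqDiff]; rfl) hM1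
    le_rfl (by omega) fun _ _ _ => St.costLe_store _ _ le_rfl)
    (countLoop_run (N := p.L) (M := p.L + 1) (a := 10 * p.B + 1)
      (by simp (disch := omega) only [evs, Nat.reduceAdd, Nat.reduceEqDiff]) (by omega)
      (fun i m => by simp (disch := omega) only [evs, Nat.reduceAdd, Nat.reduceEqDiff])
      (fun i m => by simp (disch := omega) only [evs, Nat.reduceAdd, Nat.reduceEqDiff])
      (by rw [Function.update_of_ne (by omega)]; exact hμ _ (by omega)) hjL
      (by rw [← hj, ← hκ]; omega)) ?_
  rw [← hj]
  have hk2 : p.κ / 2 = 2 ^ (p.j - 1) := by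
    rw [hκ]
    obtain ⟨i, hi⟩ : ∃ i, p.j = i + 1 := ⟨p.j - 1, by omega⟩
    rw [hi, pow_succ, Nat.mul_div_cancel _ (by norm_num), Nat.add_sub_cancel]
  have hk4 : p.κ / 4 = 2 ^ (p.j - 2) := by
    rw [hκ]
    obtain ⟨i, hi⟩ : ∃ i, p.j = i + 2 := ⟨p.j - 2, by omega⟩
    rw [hi, pow_add, show 2 ^ 2 = 4 from rfl, Nat.mul_div_cancel _ (by norm_num),
      Nat.add_sub_cancel]
  have hSQ : p.S ≤ p.Q := by rw [← p.S_mul_S]; exact Nat.le_mul_self _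
  refine St.Meets.bind (v := p.j) (by simp (disch := omega) only [evs, Nat.reduceAdd,
      Nat.reduceEqDiff]) hM1 ?_
  refine St.Meets.bind (v := p.κ) (by simp (disch := omega) only [evs, Nat.reduceAdd,
      Nat.reduceEqDiff, one_mul, ← hκ]) hM1 ?_
  refine St.Meets.bind (v := p.Q) (by
    simp (disch := omega) only [evs, Nat.reduceAdd, Nat.reduceEqDiff]
    rw [hk2, eval_shl (by rw [← p.hQ]; omega), one_mul, p.hQ]) hM1 ?_
  refine St.Meets.bind (v := p.S) (by
    simp (disch := omega) only [evs, Nat.reduceAdd, Nat.reduceEqDiff]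
    rw [hk4, eval_shl (by rw [← p.hS]; omega), one_mul, p.hS]) hM1 ?_
  refine hmain _ _ ?_ fun a ha => ?_
  · refine ⟨?_, ?_, ?_, ?_, ?_, ?_, ?_, ?_, ?_, ?_, ?_, ?_, ?_, ?_, ?_, ?_, ?_, ?_, ?_, ?_⟩ <;>
      simp only [evs, Nat.reduceAdd, Nat.reduceEqDiff, hρ0, hρ2, e1, e2]
  · rw [Function.update_of_ne (by omega), Function.update_of_ne (by omega)]

end Parameters
end RazExtractor

namespace RazExtractor

/-! ### Step counts of the program -/

namespace St

/-- Statements without loops. -/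
def flat : St → Prop
  | store _ _ => True
  | seq p q => p.flat ∧ q.flat
  | bind _ b => b.flat
  | loop _ _ => False

theorem flat.costLe {w M : ℕ} (hM : 1 ≤ M) : ∀ {p : St} {K : ℕ} {ρ : ℕ → ℕ}, p.flat
    → CostLe w M p K ρ
  | store _ _, _, _, _ => costLe_store _ _ hM
  | seq _ _, _, _, h => (flat.costLe hM h.1).seq (flat.costLe hM h.2)
  | bind _ _, _, _, h => CostLe.bind hM fun _ _ => flat.costLe hM h

end St

section Costs
set_option linter.unusedSectionVars false
set_option linter.unusedSimpArgs false
variable {p : Par} {ρ : ℕ → ℕ} {M : ℕ}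

theorem fillP_cost {w N K : ℕ} {n : Ex} (dst src : Ex) (hn : ∀ μ, n.ev w ρ μ ≤ N) (hN : N ≤ M)
    (hM : 1 ≤ M) : St.CostLe w M (fillP n dst src) K ρ :=
  St.CostLe.loop hn hM le_rfl (by omega) fun _ _ _ => St.costLe_store _ _ le_rfl

theorem two_pow_le_D {i : ℕ} (hi : i ≤ p.L) : 2 ^ i ≤ p.D := by
  rw [p.hD]; exact Nat.pow_le_pow_right (by norm_num) hi

/-- Each of the fewer than `L` levels fills a square of side at most `S`, and `S * S = Q ≤ D`. -/
theorem tableP_cost (hρ : p.Env ρ) (hM : p.D * p.L ≤ M) : St.CostLe p.w M tableP 26 ρ := by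
  have hlin := p.lin
  have hj := p.hj
  have hL : 1 ≤ p.L := by have := p.hκ; have := Nat.one_le_two_pow (n := p.j); omega
  have hDL : p.D ≤ p.D * p.L := Nat.le_mul_of_pos_right _ hL
  have hjL : p.j ≤ p.L := by
    have h := p.hκL
    obtain ⟨i, hi⟩ : ∃ i, p.j = i + 1 := ⟨p.j - 1, by omega⟩
    rw [p.hκ, hi, pow_succ] at h
    have := Nat.lt_two_pow_self (n := i)
    omega
  have hSQ := p.S_mul_S
  have hS1 : 1 ≤ p.S := by rw [p.hS]; exact Nat.one_le_two_pow
  refine St.CostLe.seq (St.costLe_store _ _ (by omega)) ?_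
  refine St.CostLe.loop (N := p.j - 2) (M' := p.D)
    (fun μ => by simp (disch := omega) only [evs, Nat.reduceAdd, Nat.reduceEqDiff, hρ]; rfl) (by omega) (by omega)
    ((Nat.mul_le_mul_right _ (by omega : p.j - 2 ≤ p.L)).trans (by rwa [mul_comm]))
    fun i hi n => ?_
  have hz : 2 ^ 2 ^ i * 2 ^ 2 ^ i ≤ p.S := by
    rw [← pow_add, ← two_mul, ← pow_succ', p.hS]
    exact Nat.pow_le_pow_right (by norm_num) (Nat.pow_le_pow_right (by norm_num) (by omega))
  have hzz : 2 ^ 2 ^ i ≤ 2 ^ 2 ^ i * 2 ^ 2 ^ i := Nat.le_mul_self _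
  have hSS : p.S ≤ p.S * p.S := Nat.le_mul_self _
  have hi2 : 2 ^ i < 2 ^ 2 ^ i := Nat.lt_two_pow_self
  refine St.CostLe.bind (by omega) ?_
  rintro v ⟨μ, hv⟩
  have hv' : v = 2 ^ 2 ^ i := by
    rw [hv]; simp (disch := omega) only [evs, Nat.reduceAdd, Nat.reduceEqDiff, one_mul]
  refine St.CostLe.bind (by omega) ?_
  rintro u ⟨μ', hu⟩
  have hu' : u ≤ p.S := by
    rw [hu]; simp (disch := omega) only [evs, Nat.reduceAdd, Nat.reduceEqDiff, hv']; exact hz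
  refine St.CostLe.loop (N := p.S) (M' := p.S)
    (fun μ => by simp (disch := omega) only [evs, Nat.reduceAdd, Nat.reduceEqDiff]; omega) (by omega) (by omega)
    (by omega) fun k hk n' => ?_
  exact St.CostLe.loop (N := p.S) (M' := 1)
    (fun μ => by simp (disch := omega) only [evs, Nat.reduceAdd, Nat.reduceEqDiff]; omega) (by omega) (by omega)
    (by omega) fun k hk n' => St.costLe_store _ _ le_rfl

theorem cantorP_cost (hρ : p.Env ρ) (hL : 1 ≤ p.L) (hM : 2 * (p.D * p.L) ≤ M) :
    St.CostLe p.w M cantorP 26 ρ := by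
  have hlin := p.lin
  have hDL : p.L ≤ p.D * p.L := Nat.le_mul_of_pos_left _ (by omega)
  refine St.CostLe.seq (St.costLe_store _ _ (by omega)) ?_
  refine St.CostLe.loop (N := 2 * p.L) (M' := 1)
    (fun μ => by simp (disch := omega) only [evs, Nat.reduceAdd, Nat.reduceEqDiff, hρ]; omega) (by omega) (by omega)
    (by omega) fun i hi n => St.flat.costLe le_rfl (by simp [St.flat])

theorem pointsP_cost (hρ : p.Env ρ) (hL : 1 ≤ p.L) (hM : 2 * (p.D * p.L) ≤ M) :
    St.CostLe p.w M pointsP 26 ρ := by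
  have hlin := p.lin
  have hDL : p.D ≤ p.D * p.L := Nat.le_mul_of_pos_right _ hL
  refine St.CostLe.seq (St.costLe_store _ _ (by omega)) ?_
  refine St.CostLe.loop (N := p.L + 1) (M' := p.D)
    (fun μ => by simp (disch := omega) only [evs, Nat.reduceAdd, Nat.reduceEqDiff, hρ]; omega) (by omega) (by omega)
    (by rw [add_mul, one_mul, mul_comm p.L]; omega) fun i hi n => ?_
  refine St.CostLe.bind (by omega) ?_
  rintro v ⟨μ, hv⟩
  have h2 := two_pow_le_D (p := p) (i := i) (by omega)
  simp (disch := omega) only [evs, Nat.reduceAdd, Nat.reduceEqDiff, one_mul] at hv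
  refine St.CostLe.bind (by omega) fun v' _ => ?_
  exact St.CostLe.loop (N := p.D) (M' := 1)
    (fun μ => by simp (disch := omega) only [evs, Nat.reduceAdd, Nat.reduceEqDiff]; omega) (by omega) (by omega)
    (by omega) fun i hi n => St.costLe_store _ _ le_rfl

theorem coeffsP_cost (hρ : p.Env ρ) (hL : 1 ≤ p.L) (hM : p.D * p.L ≤ M) :
    St.CostLe p.w M coeffsP 26 ρ := by
  have hlin := p.lin
  have hDL : p.L ≤ p.D * p.L := Nat.le_mul_of_pos_left _ (by omega)
  refine St.CostLe.seq (St.costLe_store _ _ (by omega)) ?_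
  refine St.CostLe.loop (N := p.L) (M' := 1)
    (fun μ => by simp (disch := omega) only [evs, Nat.reduceAdd, Nat.reduceEqDiff, hρ]; omega) (by omega) (by omega)
    (by omega) fun i hi n => St.flat.costLe le_rfl (by simp [St.flat])

theorem pairLoop_cost (hρ : p.Env ρ) (hL : 1 ≤ p.L) (hM : p.D * p.L ≤ M) (ie : Ex) {body : St}
    (hb : body.flat) : St.CostLe p.w M (pairLoop ie body) 26 ρ := by
  have hlin := p.lin
  have hDL : p.D ≤ p.D * p.L := Nat.le_mul_of_pos_right _ hL
  refine St.CostLe.loop (N := p.L) (M' := p.D)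
    (fun μ => by simp (disch := omega) only [evs, Nat.reduceAdd, Nat.reduceEqDiff, hρ]; omega) (by omega) (by omega)
    (by rw [mul_comm]; exact hM) fun i hi n => ?_
  refine St.CostLe.bind (by omega) fun v _ => St.CostLe.bind (by omega) fun v' _ => ?_
  refine St.CostLe.loop (N := p.D) (M' := 1)
    (fun μ => by simp (disch := omega) only [evs, Nat.reduceAdd, Nat.reduceEqDiff, hρ]; omega) (by omega) (by omega)
    (by omega) fun i hi n => St.flat.costLe le_rfl (by simpa [St.flat] using hb)

theorem fwdP_cost (hρ : p.Env ρ) (hL : 1 ≤ p.L) (hM : p.D * p.L ≤ M) :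
    St.CostLe p.w M fwdP 26 ρ := pairLoop_cost hρ hL hM _ (by simp [St.flat])

theorem invP_cost (hρ : p.Env ρ) (hL : 1 ≤ p.L) (hM : p.D * p.L ≤ M) :
    St.CostLe p.w M invP 26 ρ := pairLoop_cost hρ hL hM _ (by simp [St.flat])

/-- `L` levels, at most `D` quotient coefficients per level, at most `L` terms of `sub i`. This
conversion alone has the full order `D L ^ 2`, and it is done once. -/
theorem convP_cost (hρ : p.Env ρ) (hL : 1 ≤ p.L) (hM : p.D * p.L * p.L ≤ M) :
    St.CostLe p.w M convP 26 ρ := by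
  have hlin := p.lin
  have hDL : p.D ≤ p.D * p.L := Nat.le_mul_of_pos_right _ hL
  have hDLL : p.D * p.L ≤ p.D * p.L * p.L := Nat.le_mul_of_pos_right _ hL
  refine St.CostLe.loop (N := p.L) (M' := p.D * p.L)
    (fun μ => by simp (disch := omega) only [evs, Nat.reduceAdd, Nat.reduceEqDiff, hρ]; omega) (by omega) (by omega)
    (by rw [mul_comm]; exact hM) fun i hi n => ?_
  refine St.CostLe.bind (by omega) ?_
  rintro v ⟨μ, hv⟩
  have hv' : v = p.L - 1 - i := by
    rw [hv]; simp (disch := omega) only [evs, Nat.reduceAdd, Nat.reduceEqDiff, hρ]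
  refine St.CostLe.bind (by omega) fun v₁ _ => St.CostLe.bind (by omega) fun v₂ _ => ?_
  refine St.CostLe.loop (N := p.D) (M' := p.L)
    (fun μ => by simp (disch := omega) only [evs, Nat.reduceAdd, Nat.reduceEqDiff, hρ]; omega) (by omega) (by omega)
    (by omega) fun k hk n' => ?_
  refine St.CostLe.bind (by omega) fun v₃ _ => St.CostLe.bind (by omega) fun v₄ _ => ?_
  exact St.CostLe.loop (N := p.L) (M' := 1)
    (fun μ => by simp (disch := omega) only [evs, Nat.reduceAdd, Nat.reduceEqDiff]; omega) (by omega) (by omega)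
    (by omega) fun i hi n => St.flat.costLe le_rfl (by simp [St.flat])

theorem dupUpP_cost (hρ : p.Env ρ) (hM : 2 * p.D ≤ M) : St.CostLe p.w M dupUpP 26 ρ :=
  have hlin := p.lin
  fillP_cost (N := p.D) _ _ (fun μ => by simp only [evs, Nat.reduceAdd, Nat.reduceEqDiff, hρ]; rfl) (by omega) (by omega)

theorem dupDownP_cost (hρ : p.Env ρ) (hM : 2 * p.D ≤ M) : St.CostLe p.w M dupDownP 26 ρ :=
  have hlin := p.lin
  fillP_cost (N := p.D) _ _ (fun μ => by simp only [evs, Nat.reduceAdd, Nat.reduceEqDiff, hρ]; rfl) (by omega) (by omega)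

theorem clearP_cost (hρ : p.Env ρ) (hM : 2 * p.D ≤ M) : St.CostLe p.w M clearP 26 ρ :=
  have hlin := p.lin
  fillP_cost (N := p.D) _ _ (fun μ => by simp only [evs, Nat.reduceAdd, Nat.reduceEqDiff, hρ]; rfl) (by omega) (by omega)

theorem saveP_cost (hρ : p.Env ρ) (hM : 2 * p.D ≤ M) (dst : ℕ) :
    St.CostLe p.w M (saveP dst) 26 ρ :=
  have hlin := p.lin
  fillP_cost (N := 2 * p.D) _ _ (fun μ => by simp (disch := omega) only [evs, Nat.reduceAdd, Nat.reduceEqDiff, hρ]; omega) hM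
    (by omega)

theorem evalP_cost (hρ : p.Env ρ) (hL : 1 ≤ p.L) (hM : 2 * (p.D * p.L) ≤ M) (dst : ℕ) :
    St.CostLe p.w M (evalP dst) 26 ρ := by
  have hDL : p.D ≤ p.D * p.L := Nat.le_mul_of_pos_right _ hL
  exact (dupUpP_cost hρ (by omega)).seq ((fwdP_cost hρ hL (by omega)).seq
    (saveP_cost hρ (by omega) dst))

theorem invertP_cost (hρ : p.Env ρ) (hL : 1 ≤ p.L) (hM : 4 * (p.D * p.L) ≤ M) :
    St.CostLe p.w M invertP 26 ρ := by
  have hlin := p.lin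
  have hDL : p.D ≤ p.D * p.L := Nat.le_mul_of_pos_right _ hL
  refine St.CostLe.loop (N := 2 * p.D) (M' := 2 * p.L)
    (fun μ => by simp (disch := omega) only [evs, Nat.reduceAdd, Nat.reduceEqDiff, hρ]; omega) (by omega) (by omega)
    (by rw [mul_mul_mul_comm]; exact hM) fun i hi n => ?_
  refine (St.costLe_store _ _ (by omega)).seq ((St.costLe_store _ _ (by omega)).seq ?_)
  exact St.CostLe.loop (N := 2 * p.L) (M' := 1)
    (fun μ => by simp (disch := omega) only [evs, Nat.reduceAdd, Nat.reduceEqDiff, hρ]; omega) (by omega) (by omega)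
    (by omega) fun i hi n => St.flat.costLe le_rfl (by simp [St.flat])

theorem mmP_cost (hρ : p.Env ρ) (hL : 1 ≤ p.L) (hM : 2 * (p.D * p.L) ≤ M) (x y dst : ℕ) :
    St.CostLe p.w M (mmP x y dst) 26 ρ := by
  have hlin := p.lin
  have hDL : p.D ≤ p.D * p.L := Nat.le_mul_of_pos_right _ hL
  have hi : St.CostLe p.w M invP 26 ρ := invP_cost hρ hL (by omega)
  have hf : St.CostLe p.w M fwdP 26 ρ := fwdP_cost hρ hL (by omega)
  refine St.CostLe.seq (St.CostLe.loop (N := 2 * p.D) (M' := 1)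
    (fun μ => by simp (disch := omega) only [evs, Nat.reduceAdd, Nat.reduceEqDiff, hρ]; omega) (by omega) (by omega)
    (by omega) fun i hi n => St.flat.costLe le_rfl (by simp [St.flat])) ?_
  refine hi.seq ((dupUpP_cost hρ (by omega)).seq (hf.seq (St.CostLe.seq (St.CostLe.loop
    (N := 2 * p.D) (M' := 1)
    (fun μ => by simp (disch := omega) only [evs, Nat.reduceAdd, Nat.reduceEqDiff, hρ]; omega) (by omega) (by omega)
    (by omega) fun i hi n => St.flat.costLe le_rfl (by simp [St.flat])) ?_)))
  exact hi.seq ((dupDownP_cost hρ (by omega)).seq (hf.seq (saveP_cost hρ (by omega) dst)))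

theorem setupP_cost (hρ : p.Env ρ) (hL : 1 ≤ p.L) (hM : 4 * (p.D * p.L * p.L) ≤ M) :
    St.CostLe p.w M setupP 26 ρ := by
  have hlin := p.lin
  have hDL : p.D ≤ p.D * p.L := Nat.le_mul_of_pos_right _ hL
  have hDLL : p.D * p.L ≤ p.D * p.L * p.L := Nat.le_mul_of_pos_right _ hL
  have he := fun dst => evalP_cost (p := p) (M := M) hρ hL (by omega) dst
  have hc : St.CostLe p.w M clearP 26 ρ := clearP_cost hρ (by omega)
  refine (tableP_cost hρ (by omega)).seq ((cantorP_cost hρ hL (by omega)).seq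
    ((pointsP_cost hρ hL (by omega)).seq ((coeffsP_cost hρ hL (by omega)).seq
    (((hc.seq (St.CostLe.seq ?_ (convP_cost hρ hL (by omega)))).seq (he 9)).seq
    ((invertP_cost hρ hL (by omega)).seq (((hc.seq (St.CostLe.seq ?_ ?_)).seq (he 11)).seq
    ((hc.seq ?_).seq (he 12))))))))
  all_goals
    exact fillP_cost (N := p.D) _ _
     (fun μ => by simp (disch := omega) only [evs, Nat.reduceAdd, Nat.reduceEqDiff, hρ]; omega) (by omega) (by omega)

theorem outputP_cost (hρ : p.Env ρ) (hL : 1 ≤ p.L) (hM : 4 * (p.D * p.L * p.L) ≤ M) :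
    St.CostLe p.w M outputP 26 ρ := by
  have hlin := p.lin
  have hDL : p.D ≤ p.D * p.L := Nat.le_mul_of_pos_right _ hL
  have hDLL : p.D * p.L ≤ p.D * p.L * p.L := Nat.le_mul_of_pos_right _ hL
  refine St.CostLe.seq ?_ ((invP_cost hρ hL (by omega)).seq ?_)
  all_goals
    exact fillP_cost (N := 2 * p.D) _ _
     (fun μ => by simp (disch := omega) only [evs, Nat.reduceAdd, Nat.reduceEqDiff, hρ]; omega) (by omega) (by omega)

/-- The `L` rounds have two products each, with a constant number of transforms of cost `D L` per
product. -/
theorem mainP_cost (hρ : p.Env ρ) (hL : 1 ≤ p.L) (hM : 4 * (p.D * p.L * p.L) ≤ M) :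
    St.CostLe p.w M mainP 23 ρ := by
  have hlin := p.lin
  have hDL : p.D ≤ p.D * p.L := Nat.le_mul_of_pos_right _ hL
  have hDLL : p.D * p.L ≤ p.D * p.L * p.L := Nat.le_mul_of_pos_right _ hL
  have h1 : ∀ μ, (1 : Ex).ev p.w ρ μ ≤ 1 := fun μ => Nat.mod_le _ _
  refine St.CostLe.seq (St.CostLe.loop h1 (M' := M) (by omega) (by omega) (by omega)
    fun i hi n => setupP_cost (hρ.loopEnv le_rfl) hL hM) (St.CostLe.seq ?_
    (St.CostLe.loop h1 (M' := M) (by omega) (by omega) (by omega)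
      fun i hi n => outputP_cost (hρ.loopEnv le_rfl) hL hM))
  refine St.CostLe.loop (N := p.L) (M' := 2 * (p.D * p.L))
    (fun μ => by simp (disch := omega) only [evs, Nat.reduceAdd, Nat.reduceEqDiff, hρ]; omega) (by omega) (by omega)
    (by rw [mul_left_comm, mul_comm p.L]; omega) fun i hi n => ?_
  have hE := hρ.loopEnv (k := 23) (v := n) (i := i) le_rfl
  exact (mmP_cost hE hL le_rfl _ _ _).seq (mmP_cost hE hL le_rfl _ _ _)

end Costs
end RazExtractor

namespace RazExtractor

/-! ### The program computes a power in the quotient field -/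

section Assembly
set_option linter.unusedSectionVars false
open Polynomial

theorem ofCoeffs_eq {D d : ℕ} {f : ℕ → ZMod 2} (hd : d ≤ D) (hf : ∀ t, d ≤ t → f t = 0) :
    ofCoeffs D f = ofCoeffs d f := by
  refine (Finset.sum_subset (Finset.range_mono hd) fun t _ ht => ?_).symm
  rw [hf t (by simpa using ht), C_0, zero_mul]

/-- Vectors over `GF(2)` as field elements, through the novel basis. -/
noncomputable def basisMap (P : (ZMod 2)[X]) (d : ℕ) : (Fin d → ZMod 2) →ₗ[ZMod 2] AdjoinRoot P :=
  Fintype.linearCombination (ZMod 2) fun i : Fin d => AdjoinRoot.mk P (novel i)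

theorem mk_ofCoeffs (P : (ZMod 2)[X]) {D d : ℕ} {f : ℕ → ZMod 2} (hd : d ≤ D)
    (hf : ∀ t, d ≤ t → f t = 0) : AdjoinRoot.mk P (ofCoeffs D f) = basisMap P d fun i => f i := by
  rw [ofCoeffs_eq hd hf, ofCoeffs, map_sum, basisMap, Fintype.linearCombination_apply,
    Finset.sum_range]
  refine Finset.sum_congr rfl fun i _ => ?_
  rw [map_mul, Algebra.smul_def, AdjoinRoot.algebraMap_eq, AdjoinRoot.mk_C]

/-- Surjective by reducing modulo `P` and expanding in the novel basis; injective because both sides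
have dimension `d`. -/
theorem basisMap_bijective {P : (ZMod 2)[X]} {d : ℕ} (hP : P ≠ 0) (hd : P.natDegree = d) :
    Function.Bijective (basisMap P d) := by
  have hs : Function.Surjective (basisMap P d) := by
    intro z
    obtain ⟨f, rfl⟩ := AdjoinRoot.mk_surjective z
    have hdeg : (f % P).degree < (d : ℕ) := by
      rw [← hd, ← degree_eq_natDegree hP]; exact EuclideanDomain.mod_lt f hP
    obtain ⟨c, hc0, hc⟩ := exists_novel_coeffs d (f % P) hdeg
    refine ⟨fun i => c i, ?_⟩
    rw [← mk_ofCoeffs P le_rfl hc0, ofCoeffs, ← hc d le_rfl, AdjoinRoot.mk_eq_mk]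
    have := EuclideanDomain.div_add_mod f P
    exact ⟨-(f / P), by linear_combination this⟩
  refine ⟨?_, hs⟩
  have := (AdjoinRoot.powerBasis hP).finite
  refine (LinearMap.injective_iff_surjective_of_finrank_eq_finrank ?_).2 hs
  rw [Module.finrank_fin_fun, (AdjoinRoot.powerBasis hP).finrank, AdjoinRoot.powerBasis_dim, hd]

/-- A bitstring as a vector, extended by zeros. -/
def pad {k : ℕ} (d : ℕ) (x : BitStr k) : Fin d → ZMod 2 := fun i =>
  if h : (i : ℕ) < k then ((x ⟨i, h⟩).toNat : ZMod 2) else 0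

theorem natCast_toNat_injective : Function.Injective fun b : Bool => (b.toNat : ZMod 2) := by
  decide

theorem pad_injective {k d : ℕ} (h : k ≤ d) : Function.Injective (pad d : BitStr k → _) := by
  intro x y hxy
  funext i
  have := congrFun hxy ⟨i, by omega⟩
  simp only [pad, i.2, dif_pos] at this
  exact natCast_toNat_injective this

theorem toNat_decide_eq_one (z : ZMod 2) : (decide (z = 1)).toNat = z.val := by
  revert z; decide

theorem IsSource.mono {n : ℕ} {X : PMF (BitStr n)} {k k' : ℝ} (h : IsSource X k) (hk : k' ≤ k) :
    IsSource X k' := hk.trans h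

theorem IsStrongTwoSourceExtractor.mono {n₁ n₂ m : ℕ} {Ext : BitStr n₁ → BitStr n₂ → BitStr m}
    {k₁ k₂ ε k₁' k₂' ε' : ℝ} (h : IsStrongTwoSourceExtractor Ext k₁ k₂ ε) (h₁ : k₁ ≤ k₁')
    (h₂ : k₂ ≤ k₂') (hε : ε ≤ ε') : IsStrongTwoSourceExtractor Ext k₁' k₂' ε' :=
  ⟨fun X Y hX hY => (h.extractor X Y (hX.mono h₁) (hY.mono h₂)).trans hε,
    fun X Y hX hY => (h.strong_first X Y (hX.mono h₁) (hY.mono h₂)).trans hε,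
    fun X Y hX hY => (h.strong_second X Y (hX.mono h₁) (hY.mono h₂)).trans hε⟩

/-- The first half of a bitstring. -/
def firstHalf {n : ℕ} (x : BitStr n) : BitStr (n / 2) := fun i => x ⟨i, by omega⟩

/-- The second half of a bitstring. -/
def secondHalf {n : ℕ} (x : BitStr n) : BitStr (n - n / 2) := fun i => x ⟨n / 2 + i, by omega⟩

theorem toNat_lt_two (b : Bool) : b.toNat < 2 := by cases b <;> decide

/-- The program computes a power in the quotient field, up to a constant factor. -/
theorem razProg_spec {n₁ n₂ : ℕ} (h₁ : 80 ≤ n₁) (h₂ : 2 * n₂ ≤ n₁) (k₁ k₂ m : ℕ) {P : (ZMod 2)[X]}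
    [hP : Fact (Irreducible P)] (hPd : P.natDegree = n₁ - n₁ / 2) (x : BitStr n₁) (y : BitStr n₂) :
    ∃ (c : ℕ → ZMod 2) (t : ℕ) (s : State),
      basisMap P (n₁ - n₁ / 2) (fun i => c i) =
        (AdjoinRoot.mk P (sub (razPar n₁ n₂ h₁ h₂).L))⁻¹ ^ (2 ^ (razPar n₁ n₂ h₁ h₂).L - 1) *
          basisMap P (n₁ - n₁ / 2) (pad _ (secondHalf x)) *
          (basisMap P (n₁ - n₁ / 2) (pad _ (firstHalf x)) +
            basisMap P (n₁ - n₁ / 2) (pad _ y)) ^ (2 ^ (razPar n₁ n₂ h₁ h₂).L - 1) ∧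
      Exec (8 * (Nat.log 2 n₁ + 1)) razProg (initState n₁ k₁ n₂ k₂ m P x y) t s ∧
      t ≤ razSt.size * (4 * ((razPar n₁ n₂ h₁ h₂).D * (razPar n₁ n₂ h₁ h₂).L *
        (razPar n₁ n₂ h₁ h₂).L)) ∧
      ∀ i < n₁ - n₁ / 2, s.mem i = (c i).val := by
  set p := razPar n₁ n₂ h₁ h₂ with hp
  have hlin := p.lin
  have e1 : p.n₁ = n₁ := rfl
  have e2 : p.n₂ = n₂ := rfl
  have ed : p.d = n₁ - n₁ / 2 := rfl
  set st := initState n₁ k₁ n₂ k₂ m P x y with hst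
  have hL : 1 ≤ p.L := by
    have h : 5 < p.L := (Nat.lt_clog_iff_pow_lt (by norm_num)).2 (by omega)
    omega
  have hDL : p.D ≤ p.D * p.L := Nat.le_mul_of_pos_right _ hL
  have hDLL : p.D * p.L ≤ p.D * p.L * p.L := Nat.le_mul_of_pos_right _ hL
  have hmx : ∀ k (hk : k < n₁), st.mem k = (x ⟨k, hk⟩).toNat := fun k hk => by
    simp [hst, initState, hk]
  have hmy : ∀ k (hk : k < n₂), st.mem (n₁ + k) = (y ⟨k, hk⟩).toNat := fun k hk => by
    simp [hst, initState, hk]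
  have hmP : ∀ k, st.mem (n₁ + (n₂ + k)) = (P.coeff k).val := fun k => by
    simp only [hst, initState]
    rw [dif_neg (by omega), dif_neg (by omega)]
    congr 2
    omega
  have hm0 : ∀ a, n₁ + n₂ + (n₁ - n₁ / 2) < a → st.mem a = 0 := fun a ha => by
    obtain ⟨k, rfl⟩ : ∃ k, a = n₁ + (n₂ + k) := ⟨a - n₁ - n₂, by omega⟩
    rw [hmP, coeff_eq_zero_of_natDegree_lt (by omega), ZMod.val_zero]
  have hmeets := razSt_meets h₁ h₂ (ρ := st.reg) (μ := st.mem)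
    (M := 4 * (p.D * p.L * p.L)) rfl rfl (fun a ha => hm0 a (by omega)) (by omega)
    (R := fun μ => ∃ c : ℕ → ZMod 2, basisMap P (n₁ - n₁ / 2) (fun i => c i) =
        (AdjoinRoot.mk P (sub p.L))⁻¹ ^ (2 ^ p.L - 1) *
          basisMap P (n₁ - n₁ / 2) (pad _ (secondHalf x)) *
          (basisMap P (n₁ - n₁ / 2) (pad _ (firstHalf x)) +
            basisMap P (n₁ - n₁ / 2) (pad _ y)) ^ (2 ^ p.L - 1) ∧
        ∀ i < n₁ - n₁ / 2, μ i = (c i).val) (by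
      intro ρ μ hρ hμ
      refine ⟨mainP_cost hρ hL le_rfl μ, ?_⟩
      have hin : Input p P μ := by
        refine ⟨fun k hk => ?_, fun k hk => ?_, fun i hi => ?_, fun a ha ha' => ?_⟩
        · rw [hμ _ (by omega), hmx k hk]; exact toNat_lt_two _
        · rw [hμ _ (by omega), e1, hmy k hk]; exact toNat_lt_two _
        · rw [hμ _ (by omega), e1, e2, hmP]
        · rw [hμ _ (by omega), hm0 a (by omega)]
      have hdeg : P.degree = (p.d : ℕ) := by rw [degree_eq_natDegree hP.out.ne_zero, hPd, ed]
      -- Since `n₁ / 2` and `n₂` are at most `d`, no coefficient from `d` on occurs, so the loaded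
      -- polynomials are reduced modulo `P`.
      have hS0 : ∀ t, p.d ≤ t → ((if t < p.n₁ / 2 then μ t else 0 : ℕ) : ZMod 2) +
          ((if t < p.n₂ then μ (p.n₁ + t) else 0 : ℕ) : ZMod 2) = 0 := fun t ht => by
        rw [if_neg (by omega), if_neg (by omega)]; simp
      have hF0 : ∀ t, p.d ≤ t → ((if t < p.d then μ (p.n₁ / 2 + t) else 0 : ℕ) : ZMod 2) = 0 :=
        fun t ht => by rw [if_neg (by omega)]; simp
      have hdS : (sumPoly p μ).degree < P.degree := by
        rw [sumPoly, ofCoeffs_eq hlin.2.2.2.2.2.1.le hS0, hdeg]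
        exact novel_sum_degree_lt _
      have hdF : (factorPoly p μ).degree < P.degree := by
        rw [factorPoly, ofCoeffs_eq hlin.2.2.2.2.2.1.le hF0, hdeg]
        exact novel_sum_degree_lt _
      obtain ⟨c, hc0, hc, hout⟩ := mainP_run hρ hP.out hPd
        (by rw [hPd]; exact κ_lt_d h₁ h₂) hin hdS hdF (AdjoinRoot.mk P) AdjoinRoot.mk_self
      refine ⟨c, ?_, hout⟩
      have hcm := mk_ofCoeffs P (f := c) (D := p.d) le_rfl hc0
      rw [ofCoeffs, hc] at hcm
      have hSm : AdjoinRoot.mk P (sumPoly p μ) = basisMap P (n₁ - n₁ / 2) (pad _ (firstHalf x)) +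
          basisMap P (n₁ - n₁ / 2) (pad _ y) := by
        rw [sumPoly, mk_ofCoeffs P hlin.2.2.2.2.2.1.le hS0, ← map_add]
        congr 1
        funext i
        change _ = (if h : (i : ℕ) < n₁ / 2 then ((firstHalf x ⟨i, h⟩).toNat : ZMod 2) else 0) +
          (if h : (i : ℕ) < n₂ then ((y ⟨i, h⟩).toNat : ZMod 2) else 0)
        congr 1
        · split_ifs with h h' h'
          · rw [hμ _ (by omega), hmx _ (by omega)]; rfl
          · exact absurd h h'
          · exact absurd h' h
          · simp
        · split_ifs with h h' h'
          · rw [hμ _ (by omega), e1, hmy _ h]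
          · exact absurd h h'
          · exact absurd h' h
          · simp
      have hFm : AdjoinRoot.mk P (factorPoly p μ) =
          basisMap P (n₁ - n₁ / 2) (pad _ (secondHalf x)) := by
        rw [factorPoly, mk_ofCoeffs P hlin.2.2.2.2.2.1.le hF0]
        congr 1
        funext i
        change _ = if h : (i : ℕ) < n₁ - n₁ / 2 then ((secondHalf x ⟨i, h⟩).toNat : ZMod 2) else 0
        rw [if_pos i.2, dif_pos (ed ▸ i.2 : (i : ℕ) < n₁ - n₁ / 2), hμ _ (by omega),
            hmx _ (by omega)]
        rfl
      rw [← hSm, ← hFm]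
      exact hcm.symm)
  obtain ⟨hcost, c, hc, hout⟩ := hmeets
  obtain ⟨s, hs, hmem, -⟩ := St.exec (w := p.w) (by change 0 < 8 * _; omega) razSt 5 st.reg st razSt_wf fun _ _ => rfl
  exact ⟨c, _, s, hc, hs, hcost, fun i hi => by rw [hmem]; exact hout i hi⟩

end Assembly
end RazExtractor


/-! ### The main theorem -/

namespace RazExtractor

section Final
open Polynomial

/-- The halves of a bitstring, the second one as a field element. -/
theorem exists_halves_equiv {n : ℕ} {P : (ZMod 2)[X]} [hP : Fact (Irreducible P)]
    [Fintype (AdjoinRoot P)] (hPd : P.natDegree = n - n / 2) :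
    ∃ e : BitStr n ≃ BitStr (n / 2) × AdjoinRoot P, ∀ x, e x =
      (firstHalf x, basisMap P (n - n / 2) (pad _ (secondHalf x))) := by
  have hb := basisMap_bijective hP.out.ne_zero hPd
  have hcard : Fintype.card (BitStr n) = Fintype.card (BitStr (n / 2) × AdjoinRoot P) := by
    rw [Fintype.card_prod, ← Fintype.card_of_bijective hb]
    simp only [Fintype.card_fun, Fintype.card_bool, Fintype.card_fin, ZMod.card, ← pow_add]
    congr 1
    omega
  have hinj : Function.Injective fun x : BitStr n =>
      (firstHalf x, basisMap P (n - n / 2) (pad _ (secondHalf x))) := by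
    intro x y hxy
    obtain ⟨h1, h2⟩ := Prod.mk.inj hxy
    have h3 := pad_injective le_rfl (hb.1 h2)
    funext i
    by_cases hi : (i : ℕ) < n / 2
    · exact congrFun h1 ⟨i, hi⟩
    · have := congrFun h3 ⟨i - n / 2, by omega⟩
      simp only [secondHalf, Nat.add_sub_cancel' (not_lt.1 hi)] at this
      exact this
  exact ⟨Equiv.ofBijective _ ((Fintype.bijective_iff_injective_and_card _).2 ⟨hinj, hcard⟩),
    fun _ => rfl⟩

/-- `D ≤ 2 n₁`, and `2 ^ L = D ≤ n₁ ^ 2` gives `L ≤ 2 log n₁`. -/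
theorem time_bound {n₁ n₂ : ℕ} (h₁ : 80 ≤ n₁) (h₂ : 2 * n₂ ≤ n₁) :
    (((razPar n₁ n₂ h₁ h₂).D * (razPar n₁ n₂ h₁ h₂).L * (razPar n₁ n₂ h₁ h₂).L : ℕ) : ℝ) ≤
      8 * (n₁ * Real.logb 2 n₁ ^ 2) := by
  set p := razPar n₁ n₂ h₁ h₂
  have hlin := p.lin
  have e1 : p.n₁ = n₁ := rfl
  have hD : (p.D : ℝ) ≤ 2 * n₁ := by
    have : p.D ≤ 2 * n₁ := by omega
    exact_mod_cast this
  have hn : (1 : ℝ) < n₁ := by exact_mod_cast (by omega : 1 < n₁)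
  have hL : (p.L : ℝ) ≤ 2 * Real.logb 2 n₁ := by
    rw [← Real.logb_rpow (b := 2) (x := (p.L : ℝ)) (by norm_num) (by norm_num),
      ← Nat.cast_ofNat (n := 2) (R := ℝ), ← Real.logb_pow, Real.rpow_natCast]
    refine Real.logb_le_logb_of_le (by norm_num) (by positivity) ?_
    have : 2 ^ p.L ≤ n₁ ^ 2 := by rw [← p.hD]; nlinarith
    exact_mod_cast this
  push_cast
  calc (p.D : ℝ) * p.L * p.L ≤ 2 * n₁ * (2 * Real.logb 2 n₁) * (2 * Real.logb 2 n₁) := by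
        have := Real.logb_nonneg (b := 2) (by norm_num) hn.le
        gcongr
    _ = _ := by ring

/-- Strength holds with the original entropies and error, so both extractors of the theorem come
from this one. -/
theorem exists_strong_extractor {n₁ k₁ n₂ k₂ m : ℕ} {δ lam : ℝ} (hk₂ : 0 < k₂)
    (hkn₂ : k₂ ≤ n₂) (hδ : 0 < δ) (hδ' : δ < 1 / 2) (hlam : 0.25 < lam)
    (hlam' : lam < δ * k₂ / 16 - 1)
    (hn : (n₂ : ℝ) ≤ (n₁ : ℝ) / 2) (hk₁ : (k₁ : ℝ) ≥ (1 / 2 + δ) * n₁ + 2 * Real.logb 2 n₁)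
    (hmax : (k₂ : ℝ) ≥ max (3.2 * Real.logb 2 (8 * n₁ / k₂)) 40)
    (hm : (m : ℝ) ≤ 1 / lam * (δ * k₂ / 16 - 1)) {P : (ZMod 2)[X]} (hP : Irreducible P)
    (hPd : P.natDegree = (n₁ + 1) / 2) :
    ∃ Ext : BitStr n₁ → BitStr n₂ → BitStr m,
      IsStrongTwoSourceExtractor Ext k₁ k₂ ((2 : ℝ) ^ ((1 - 4 * lam) * m / 2 - 1)) ∧
      ComputesInTime razProg 8 (32 * razSt.size * (n₁ * Real.logb 2 n₁ ^ 2)) k₁ k₂ P Ext := by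
  have h40 : 40 ≤ k₂ := by exact_mod_cast (le_max_right _ _).trans hmax
  have h₂ : 2 * n₂ ≤ n₁ := by
    have : (2 : ℝ) * n₂ ≤ n₁ := by linarith
    exact_mod_cast this
  have h₁ : 80 ≤ n₁ := by omega
  have hPd' : P.natDegree = n₁ - n₁ / 2 := by omega
  have hmd : m ≤ n₁ - n₁ / 2 := by
    have hk0 : (40 : ℝ) ≤ k₂ := by exact_mod_cast h40
    -- `lam > 1/4` bounds `m` by `k₂ ≤ n₂ ≤ d`, so a field element has enough coordinates for the
    -- output.
    have h1 : 1 / lam * (δ * k₂ / 16 - 1) ≤ 4 * (δ * k₂ / 16 - 1) := by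
      refine mul_le_mul_of_nonneg_right ?_ (by linarith)
      rw [div_le_iff₀ (by linarith)]; linarith
    have h2 : (m : ℝ) ≤ k₂ := by nlinarith
    have : m ≤ k₂ := by exact_mod_cast h2
    omega
  have : Fact (Irreducible P) := ⟨hP⟩
  have hb := basisMap_bijective hP.ne_zero hPd'
  have : CharP (AdjoinRoot P) 2 :=
    charP_of_injective_algebraMap (algebraMap (ZMod 2) (AdjoinRoot P)).injective 2
  let Φ := LinearEquiv.ofBijective (basisMap P (n₁ - n₁ / 2)) hb
  have : Fintype (AdjoinRoot P) := Fintype.ofEquiv _ Φ.toEquiv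
  obtain ⟨e, he⟩ := exists_halves_equiv (n := n₁) hPd'
  set p := razPar n₁ n₂ h₁ h₂ with hp
  have hlin := p.lin
  have e1 : p.n₁ = n₁ := rfl
  let res : (Fin (n₁ - n₁ / 2) → ZMod 2) →+ (Fin m → ZMod 2) :=
    { toFun := fun v i => v ⟨i, by omega⟩
      map_zero' := rfl
      map_add' := fun _ _ => rfl }
  -- The first `m` coordinates in the novel basis, exactly what the program leaves in its first `m`
  -- cells.
  let π : AdjoinRoot P →+ (Fin m → ZMod 2) := res.comp Φ.symm.toLinearMap.toAddMonoidHom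
  have hπ : Function.Surjective π := by
    intro v
    refine ⟨Φ fun i => if h : (i : ℕ) < m then v ⟨i, h⟩ else 0, ?_⟩
    funext i
    change Φ.symm (Φ _) _ = _
    rw [LinearEquiv.symm_apply_apply, dif_pos i.2]
  set c₀ := (AdjoinRoot.mk P (sub p.L))⁻¹ ^ (2 ^ p.L - 1) with hc₀
  have hs0 : AdjoinRoot.mk P (sub p.L) ≠ 0 := by
    obtain ⟨a, b, hab⟩ := isCoprime_sub hP (L := p.L) (j := p.j)
      (by rw [← p.hκ]; omega) (by rw [← p.hκ, hPd']; exact κ_lt_d h₁ h₂)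
    intro h
    have := congrArg (AdjoinRoot.mk P) hab
    simp [h] at this
  have hq2 : 2 ≤ n₁ / k₂ := (Nat.le_div_iff_mul_le hk₂).2 (by omega)
  have hq40 : n₁ / k₂ ≤ n₁ / 40 := Nat.div_le_div_left h40 (by norm_num)
  have hpD := p.hD
  let ι : BitStr (n₁ / 2) → AdjoinRoot P := fun a => basisMap P (n₁ - n₁ / 2) (pad _ a)
  let κ : BitStr n₂ → AdjoinRoot P := fun y => basisMap P (n₁ - n₁ / 2) (pad _ y)
  refine ⟨fun x y => toBits (π (c₀ * (e x).2 * (ι (e x).1 + κ y) ^ (2 ^ p.L - 1))), ?_, ?_⟩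
  -- The moment parameter is `2 (n₁ / k₂)`; as `k₂ ≥ 40`, the sets in question have at most `n₁ / 10
  -- ≤ 2 ^ L` points.
  · have hext := extractor_of_pow (k₁ := k₁) (k₂ := k₂) (c₀ := c₀) (ι := ι) (κ := κ)
      (hb.1.comp (pad_injective (by omega))) (hb.1.comp (pad_injective (by omega))) e
      (pow_ne_zero _ (inv_ne_zero hs0)) hπ (fun _ _ => rfl) (k := 2 * (n₁ / k₂)) (by omega)
      (by omega) (by positivity)
      (raz_estimate (l := p.L) hk₂ hkn₂ hδ hδ' hlam hn hk₁ hmax hm (by omega))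
    refine hext.mono le_rfl le_rfl (le_of_eq ?_)
    rw [← Real.rpow_natCast 2 m, ← Real.rpow_add (by norm_num), Real.rpow_sub (by norm_num),
      Real.rpow_one, mul_comm, mul_one_div]
    congr 2
    ring
  · intro x y
    obtain ⟨c, t, s, hc, hs, ht, hout⟩ := razProg_spec h₁ h₂ k₁ k₂ m hPd' x y
    refine ⟨t, s, hs, ?_, fun i => ?_⟩
    · calc (t : ℝ) ≤ ((razSt.size * (4 * (p.D * p.L * p.L)) : ℕ) : ℝ) := by exact_mod_cast ht
        _ = razSt.size * 4 * ((p.D * p.L * p.L : ℕ) : ℝ) := by push_cast; ring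
        _ ≤ razSt.size * 4 * (8 * (n₁ * Real.logb 2 n₁ ^ 2)) :=
          mul_le_mul_of_nonneg_left (time_bound h₁ h₂) (by positivity)
        _ = _ := by ring
    · rw [hout i (by omega)]
      change _ = (decide (π (c₀ * (e x).2 * (ι (e x).1 + κ y) ^ (2 ^ p.L - 1)) i = 1)).toNat
      rw [toNat_decide_eq_one, he]
      congr 1
      change c i = Φ.symm (c₀ * _ * (_ + _) ^ (2 ^ p.L - 1)) _
      have hΦ : Φ (fun i => c i) = _ := hc
      rw [← hΦ, LinearEquiv.symm_apply_apply]

end Final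
end RazExtractor

theorem theorem1 :
    ∃ (progWeak progStrong : RazExtractor.Prog) (c : ℕ) (C : ℝ), 0 < c ∧
      ∀ (n₁ k₁ n₂ k₂ m : ℕ) (δ lam : ℝ),
        0 < n₁ → 0 < k₁ → 0 < n₂ → 0 < k₂ → 0 < m →
        k₁ ≤ n₁ → k₂ ≤ n₂ →
        0 < δ → δ < 1 / 2 →
        0.25 < lam → lam < δ * k₂ / 16 - 1 →
        (n₂ : ℝ) ≤ (n₁ : ℝ) / 2 →
        (k₁ : ℝ) ≥ (1 / 2 + δ) * n₁ + 2 * Real.logb 2 n₁ →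
        (k₂ : ℝ) ≥ max (3.2 * Real.logb 2 (8 * n₁ / k₂)) 40 →
        (m : ℝ) ≤ 1 / lam * (δ * k₂ / 16 - 1) →
        (∃ P : Polynomial (ZMod 2), Irreducible P ∧ P.natDegree = (n₁ + 1) / 2) ∧
        ∀ P : Polynomial (ZMod 2), Irreducible P → P.natDegree = (n₁ + 1) / 2 →
          (∃ Ext : RazExtractor.BitStr n₁ → RazExtractor.BitStr n₂ → RazExtractor.BitStr m,
            RazExtractor.IsTwoSourceExtractor Ext k₁ k₂
              ((2 : ℝ) ^ ((1 - 4 * lam) * m / 2 - 1)) ∧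
            RazExtractor.ComputesInTime progWeak c (C * (n₁ * Real.logb 2 n₁ ^ 2)) k₁ k₂ P Ext) ∧
          (∃ Ext : RazExtractor.BitStr n₁ → RazExtractor.BitStr n₂ → RazExtractor.BitStr m,
            RazExtractor.IsStrongTwoSourceExtractor Ext
              (k₁ + 3 * (m + 1)) (k₂ + 3 * (m + 1))
              ((2 : ℝ) ^ ((1 - 4 * lam) * m / 2)) ∧
            RazExtractor.ComputesInTime progStrong c (C * (n₁ * Real.logb 2 n₁ ^ 2))
              k₁ k₂ P Ext) := by
  refine ⟨RazExtractor.razProg, RazExtractor.razProg, 8, 32 * RazExtractor.razSt.size,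
    by norm_num, ?_⟩
  intro n₁ k₁ n₂ k₂ m δ lam hn₁ _ _ hk₂ _ _ hkn₂ hδ hδ' hlam hlam' hn hk₁ hmax hm
  refine ⟨RazExtractor.exists_irreducible_natDegree (by omega), fun P hP hPd => ?_⟩
  obtain ⟨Ext, hext, hcomp⟩ := RazExtractor.exists_strong_extractor hk₂ hkn₂ hδ hδ' hlam hlam' hn
    hk₁ hmax hm hP hPd
  -- The second extractor is the same function: raising both entropies by `3 (m + 1)` and doubling
  -- the error only weakens the claim.
  refine ⟨⟨Ext, hext.extractor, hcomp⟩, Ext, hext.mono ?_ ?_ ?_, hcomp⟩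
  · have : (0 : ℝ) ≤ m := by positivity
    linarith
  · have : (0 : ℝ) ≤ m := by positivity
    linarith
  · exact Real.rpow_le_rpow_of_exponent_le (by norm_num) (by linarith)
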